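/- Let $p$ be a prime, let $\theta$ be a primitive $p$-th root of unity over the field $\mathbb{Q}_p$ of $p$-adic numbers, and let $\mathbb{Z}_p[\theta]$ be the ring of integers of the local cyclotomic field $\mathbb{Q}_p[\theta]$, with prime ideal $\mathfrak{p}=(\theta-1)$. For $i\in\mathbb{Z}$ let $T_i=\mathfrak{p}^i=(\theta-1)^i\,\mathbb{Z}_p[\theta]\subseteq\mathbb{Q}_p[\theta]$. The cyclic group $\langle\theta\rangle$ of order $p$ acts on each $T_i$ by multiplication; for $n\ge 1$ let $T_{-n}/T_0\rtimes\langle\theta\rangle$ be the resulting semidirect product, a finite group of order $p^{n+1}$. Then for every integer $n\ge p-1$ there is an isomorphism of graded $\mathbb{F}_p$-modules \[ H^*\bigl(T_{-n}/T_0\rtimes\langle\theta\rangle;\mathbb{F}_p\bigr)\;\cong\;H^*\bigl(T_{-(p-1)}/T_0\rtimes\langle\theta\rangle;\mathbb{F}_p\bigr), \] where the cohomology is taken with trivial coefficients; that is, in every degree the two cohomology groups are isomorphic as $\mathbb{F}_p$-vector spaces. -/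

import Mathlib

noncomputable section

namespace MaxClass

/-- The ring `ℤ_p[θ]`, as a `ℤ_p`-subalgebra of a field `K` containing `θ`. -/
abbrev Zpθ (p : ℕ) [Fact p.Prime] {K : Type} [Field K] [Algebra ℤ_[p] K] (θ : K) :
    Subalgebra ℤ_[p] K :=
  Algebra.adjoin ℤ_[p] {θ}

/-- The filtration `T_i = 𝔭 ^ i`, `i ∈ ℤ`, where `𝔭 = (θ - 1)` is the prime ideal of `ℤ_p[θ]`:
since `𝔭` is principal, its (fractional) `i`-th power is the `ℤ_p[θ]`-submodule of `K` generated
by `(θ - 1) ^ i`. -/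
def T (p : ℕ) [Fact p.Prime] {K : Type} [Field K] [Algebra ℤ_[p] K] (θ : K) (i : ℤ) :
    Submodule (Zpθ p θ) K :=
  Submodule.span (Zpθ p θ) {(θ - 1) ^ i}

/-- The `ℤ_p[θ]`-module `T_{-n} / T_0`. -/
abbrev TQuot (p : ℕ) [Fact p.Prime] {K : Type} [Field K] [Algebra ℤ_[p] K] (θ : K) (n : ℕ) :
    Type :=
  T p θ (-(n : ℤ)) ⧸ (T p θ 0).submoduleOf (T p θ (-(n : ℤ)))

/-- A primitive `p`-th root of unity `θ`, as a unit of `ℤ_p[θ]`. -/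
def thetaUnit {p : ℕ} [Fact p.Prime] {K : Type} [Field K] [Algebra ℤ_[p] K] {θ : K}
    (hθ : IsPrimitiveRoot θ p) : (Zpθ p θ)ˣ :=
  Units.ofPowEqOne ⟨θ, Algebra.self_mem_adjoin_singleton ℤ_[p] θ⟩ p
    (Subtype.ext (by simpa using hθ.pow_eq_one)) (Fact.out : p.Prime).ne_zero

/-- The cyclic group `⟨θ⟩`. -/
abbrev thetaGroup {p : ℕ} [Fact p.Prime] {K : Type} [Field K] [Algebra ℤ_[p] K] {θ : K}
    (hθ : IsPrimitiveRoot θ p) : Subgroup (Zpθ p θ)ˣ :=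
  Subgroup.zpowers (thetaUnit hθ)

/-- The action of `⟨θ⟩` on `T_{-n} / T_0` by multiplication. -/
def thetaAction {p : ℕ} [Fact p.Prime] {K : Type} [Field K] [Algebra ℤ_[p] K] {θ : K}
    (hθ : IsPrimitiveRoot θ p) (n : ℕ) :
    thetaGroup hθ →* MulAut (Multiplicative (TQuot p θ n)) :=
  (MulAutMultiplicative (TQuot p θ n)).symm.toMonoidHom.comp
    (DistribMulAction.toAddAut (thetaGroup hθ) (TQuot p θ n))

/-- The group `T_{-n} / T_0 ⋊ ⟨θ⟩`. -/
abbrev G {p : ℕ} [Fact p.Prime] {K : Type} [Field K] [Algebra ℤ_[p] K] {θ : K}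
    (hθ : IsPrimitiveRoot θ p) (n : ℕ) : Type :=
  Multiplicative (TQuot p θ n) ⋊[thetaAction hθ n] thetaGroup hθ

/-- The mod-`p` cohomology group `H^k(Γ, 𝔽_p)` with trivial coefficients. -/
abbrev H (p : ℕ) [Fact p.Prime] (Γ : Type) [Group Γ] (k : ℕ) : ModuleCat (ZMod p) :=
  groupCohomology (Rep.trivial (ZMod p) Γ (ZMod p)) k

end MaxClass

end

/-! Let R = ℤ[ℤ/p] with generator σ, put τ = σ - 1 and let N be the norm element. Sending σ to θ
identifies T_{-n}/T_0 with R/(τ^n, N) (`kappa_surjective`, `kappa_eq_zero_iff`). For n ≥ p - 1 there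
is a nonzerodivisor f = p f', with f' ≡ τ^(n-(p-1)) modulo N, such that multiplication by τ embeds
R/(τ^n, N) into R/f as the kernel of the augmentation to ℤ/q, where q = aug f is a positive power of
p (`exists_relation`). The group thus becomes the group of all affine maps b ↦ σ^t b + a of R/f with
a of augmentation zero (`nonempty_affineModel`).

As an abelian group R/f has generators σ^i and relations f σ^j, both permuted by rotation. Write x_i
for translation by σ^i. Functions on R/f with values in Λ(y_i) ⊗ 𝔽_p[v_j], with y_i of degree 1 and
v_j of degree 2, carry the differential ∑ y_i (x_i - 1) + ∑ v_j h_j. Here h_j is contraction with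
coefficients c_{ji} such that ∑_i c_{ji} (x_i - 1) is translation by f σ^j minus one. This is a
coresolution of 𝔽_p: over R the Koszul complex is exact in nonzero degrees (`exists_koszulD_eq`),
and each relation gives a surjective null-homotopic operator whose kernel may be taken at the cost
of a variable v_j (`exists_seriesD_eq`, `exists_polyD_eq`, `exists_colD_eq`). Combined with the
periodic complex of ℤ/p it yields a coresolution by acyclic representations of the whole group, so
the invariants compute the cohomology (`nonempty_groupCohomology_equiv_coh`,
`AffineModel.nonempty_equiv_coh`).

An invariant is determined by functions that depend only on the augmentation in ℤ/q. On these all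
x_i - 1 act as one operator S with S^q = 0. Since translation by f is the p-th power of translation
by f', Frobenius allows the c_{ji} to be chosen so that they act as δ_{ij} S^(q-1)
(`exists_coeffs`). In Newton coordinates the invariants form a reduced complex depending only on p
and q (`AffineModel.nonempty_equiv_red`).

Finally q can be replaced by p (`nonempty_red_equiv`). Let a be the Newton index and k ≤ p the form
degree. The wedge part preserves a + k, and the contraction part lowers it by q, going from a + k ≥
q to a + k < p. Hence the strip p ≤ a + k < q splits off as a complex with differential the product
with ∑ y_i, which is contractible; closing the gap leaves the complex for q = p. Every n ≥ p - 1
therefore leads to the same complex. -/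

noncomputable section

namespace MaxClass

/-! ### Group cohomology from invariants of an acyclic coresolution -/

section GroupCohomology

open CategoryTheory

section Cohomology

variable {k : Type*} [CommRing k] {V V' : Type*} [AddCommGroup V] [Module k V]
  [AddCommGroup V'] [Module k V']

/-- The coboundaries of the complex `W 0 → W 1 → ⋯` of submodules of `V`. -/
def coboundaries (W : ℕ → Submodule k V) (d : V →ₗ[k] V) : ℕ → Submodule k V
  | 0 => ⊥
  | n + 1 => (W n).map d

/-- The cocycles of the complex `W 0 → W 1 → ⋯` of submodules of `V`. -/
def cocycles (W : ℕ → Submodule k V) (d : V →ₗ[k] V) (n : ℕ) : Submodule k V :=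
  W n ⊓ LinearMap.ker d

/-- The cohomology of the complex `W 0 → W 1 → ⋯` of submodules of `V`. -/
abbrev Coh (W : ℕ → Submodule k V) (d : V →ₗ[k] V) (n : ℕ) : Type _ :=
  cocycles W d n ⧸ (coboundaries W d n).submoduleOf (cocycles W d n)

/-- A cochain map which is bijective on cohomology, in elementary terms. -/
theorem Coh.nonempty_equiv {W : ℕ → Submodule k V} {d : V →ₗ[k] V}
    {W' : ℕ → Submodule k V'} {d' : V' →ₗ[k] V'} (φ : ℕ → V →ₗ[k] V')
    (hφ : ∀ n, ∀ x ∈ W n, φ n x ∈ W' n)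
    (hd : ∀ n, ∀ x ∈ W n, d' (φ n x) = φ (n + 1) (d x))
    (hinj : ∀ n, ∀ x ∈ W n, d x = 0 → φ n x ∈ coboundaries W' d' n → x ∈ coboundaries W d n)
    (hsurj : ∀ n, ∀ y ∈ W' n, d' y = 0 →
      ∃ x ∈ W n, d x = 0 ∧ y - φ n x ∈ coboundaries W' d' n) (n : ℕ) :
    Nonempty (Coh W d n ≃ₗ[k] Coh W' d' n) := by
  have hZ : ∀ x ∈ cocycles W d n, φ n x ∈ cocycles W' d' n := fun x hx =>
    ⟨hφ n x hx.1, by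
      have h0 : d x = 0 := hx.2
      simp [LinearMap.mem_ker, hd n x hx.1, h0]⟩
  have hB : ∀ x ∈ coboundaries W d n, φ n x ∈ coboundaries W' d' n := by
    cases n with
    | zero =>
      intro x hx
      have : x = 0 := hx
      simp [this]
    | succ n =>
      rintro _ ⟨y, hy, rfl⟩
      exact ⟨φ n y, hφ n y hy, hd n y hy⟩
  let ψ : cocycles W d n →ₗ[k] cocycles W' d' n := (φ n).restrict hZ
  let Ψ : Coh W d n →ₗ[k] Coh W' d' n :=
    Submodule.mapQ _ _ ψ (fun x hx => hB x.1 hx)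
  refine ⟨LinearEquiv.ofBijective Ψ ⟨?_, ?_⟩⟩
  · rw [← LinearMap.ker_eq_bot, LinearMap.ker_eq_bot']
    intro z hz
    obtain ⟨x, rfl⟩ := Submodule.Quotient.mk_surjective _ z
    have hz' : (Submodule.Quotient.mk (ψ x) : Coh W' d' n) = 0 := hz
    rw [Submodule.Quotient.mk_eq_zero] at hz' ⊢
    exact hinj n x.1 x.2.1 x.2.2 hz'
  · intro z
    obtain ⟨y, rfl⟩ := Submodule.Quotient.mk_surjective _ z
    obtain ⟨x, hx, hx0, hxy⟩ := hsurj n y.1 y.2.1 y.2.2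
    let x' : cocycles W d n := ⟨x, hx, LinearMap.mem_ker.2 hx0⟩
    have h : (Submodule.Quotient.mk y : Coh W' d' n) = Submodule.Quotient.mk (ψ x') :=
      (Submodule.Quotient.eq _).2 hxy
    exact ⟨Submodule.Quotient.mk x', h.symm⟩

end Cohomology

section Acyclic

universe u

variable {k G : Type u} [CommRing k] [Group G]

/-- A representation `M` on which `1 = ∑ g χ g⁻¹` for some linear endomorphism `χ` has no
higher cohomology: it is a direct summand of a coinduced representation. -/
theorem isZero_groupCohomology_of_sum_conj_eq_id [Fintype G] {M : Type u} [AddCommGroup M] [Module k M]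
    (ρ : Representation k G M) (χ : M →ₗ[k] M)
    (hχ : ∀ x, ∑ g : G, ρ g (χ (ρ g⁻¹ x)) = x) (n : ℕ) :
    Limits.IsZero (groupCohomology (Rep.of ρ) (n + 1)) := by
  let A₀ : Rep k (⊥ : Subgroup G) := Rep.of (Representation.trivial k (⊥ : Subgroup G) M)
  let B : Rep k G := Rep.coind (⊥ : Subgroup G).subtype A₀
  have hB : Limits.IsZero (groupCohomology B (n + 1)) :=
    (isZero_groupCohomology_succ_of_subsingleton A₀ n).of_iso (groupCohomology.coindIso A₀ (n + 1))
  let i : Rep.of ρ ⟶ B := Rep.ofHom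
    { toFun := fun v => ⟨fun h => ρ h v, fun s h => by
        have : (⊥ : Subgroup G).subtype s = 1 := Subgroup.mem_bot.1 s.2
        rw [this, one_mul]; rfl⟩
      map_add' := fun x y => by ext h; simp
      map_smul' := fun c x => by ext h; simp
      isIntertwining' := fun g => by
        ext v h
        change ρ h (ρ g v) = ρ (h * g) v
        simp }
  -- A retraction of the orbit map `i`: the hypothesis on χ is precisely r ∘ i = 1, so the identity
  -- of the cohomology of ρ factors through that of a coinduced module.
  let r : B ⟶ Rep.of ρ := Rep.ofHom
    { toFun := fun F => ∑ g : G, ρ g (χ (F.1 g⁻¹))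
      map_add' := fun x y => by simp [Finset.sum_add_distrib]
      map_smul' := fun c x => by simp [Finset.smul_sum]
      isIntertwining' := fun g => by
        ext F
        simp only [LinearMap.comp_apply, LinearMap.coe_mk, AddHom.coe_mk, map_sum]
        refine Fintype.sum_equiv (Equiv.mulLeft g⁻¹) _ _ fun h => ?_
        change ρ h (χ (F.1 (h⁻¹ * g))) = ρ g (ρ (g⁻¹ * h) (χ (F.1 (g⁻¹ * h)⁻¹)))
        rw [← Module.End.mul_apply (ρ g), ← map_mul]
        simp }
  have hir : i ≫ r = 𝟙 _ := by
    ext v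
    exact hχ v
  rw [Limits.IsZero.iff_id_eq_zero]
  have h1 := (groupCohomology.functor k G (n + 1)).map_comp i r
  rw [hir, CategoryTheory.Functor.map_id] at h1
  have h2 : (groupCohomology.functor k G (n + 1)).map i = 0 := hB.eq_of_tgt _ _
  rw [h2, Limits.zero_comp] at h1
  exact h1

/-- If `0 → X₁ → X₂ → X₃ → 0` is exact and `H¹(G, X₂) = 0`, then `H¹(G, X₁)` is the cokernel of
`X₂ᴳ → X₃ᴳ`. -/
theorem exists_surjective_invariants_H1 {X : ShortComplex (Rep k G)} (hX : X.ShortExact)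
    (h : Limits.IsZero (groupCohomology X.X₂ 1)) :
    ∃ θ : X.X₃.ρ.invariants →ₗ[k] groupCohomology X.X₁ 1, Function.Surjective θ ∧
      ∀ z, θ z = 0 ↔ ∃ y ∈ X.X₂.ρ.invariants, X.g.hom y = z.1 := by
  have hepi : Epi (groupCohomology.δ hX 0 1 rfl) := groupCohomology.epi_δ_of_isZero hX 0 h
  have hex := (ShortComplex.moduleCat_exact_iff _).1
    (groupCohomology.mapShortComplex₃_exact hX (zero_add 1))
  have hzero := (groupCohomology.mapShortComplex₃ hX (zero_add 1)).zero
  have hnat := groupCohomology.map_id_comp_H0Iso_hom X.g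
  refine ⟨(groupCohomology.δ hX 0 1 rfl).hom ∘ₗ (groupCohomology.H0Iso X.X₃).inv.hom, ?_, ?_⟩
  · exact ((ModuleCat.epi_iff_surjective _).1 hepi).comp
      ((ModuleCat.epi_iff_surjective _).1 inferInstance)
  · intro z
    constructor
    · intro hz
      obtain ⟨y, hy⟩ := hex _ hz
      refine ⟨((groupCohomology.H0Iso X.X₂).hom y).1, ((groupCohomology.H0Iso X.X₂).hom y).2, ?_⟩
      have h1 := congrArg (fun f => (f.hom y).1) hnat
      have h2 : (groupCohomology.H0Iso X.X₃).hom ((groupCohomology.H0Iso X.X₃).inv z) = z := by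
        simp
      have h3 : (groupCohomology.map (MonoidHom.id G) X.g 0).hom y =
        (groupCohomology.H0Iso X.X₃).inv z := hy
      exact h1.symm.trans (congrArg Subtype.val
        ((congrArg (groupCohomology.H0Iso X.X₃).hom.hom h3).trans h2))
    · rintro ⟨y, hy, hyz⟩
      have h1 := congrArg (fun f => f.hom ((groupCohomology.H0Iso X.X₂).inv ⟨y, hy⟩)) hnat
      have h2 : (groupCohomology.map (MonoidHom.id G) X.g 0).hom
          ((groupCohomology.H0Iso X.X₂).inv ⟨y, hy⟩) = (groupCohomology.H0Iso X.X₃).inv z := by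
        apply (ModuleCat.mono_iff_injective (groupCohomology.H0Iso X.X₃).hom).1 inferInstance
        refine h1.trans ?_
        rw [ModuleCat.hom_comp, LinearMap.comp_apply]
        simp only [Iso.inv_hom_id_apply]
        exact Subtype.ext hyz
      rw [LinearMap.comp_apply, ← h2]
      exact congrArg (fun f => f.hom ((groupCohomology.H0Iso X.X₂).inv ⟨y, hy⟩)) hzero

/-- The restriction of a representation to a stable submodule. -/
def restrictRep {V : Type u} [AddCommGroup V] [Module k V] (ρ : Representation k G V)
    (W : Submodule k V) (hW : ∀ g, ∀ x ∈ W, ρ g x ∈ W) : Representation k G W where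
  toFun g := (ρ g).restrict (hW g)
  map_one' := by ext; simp
  map_mul' _ _ := by ext; simp

/-- Group cohomology is computed by the invariants of a coresolution by representations on which
`1 = ∑ g χ g⁻¹`. -/
theorem nonempty_groupCohomology_equiv_coh [Fintype G] {V : Type u} [AddCommGroup V] [Module k V]
    (ρ : Representation k G V) (d : V →ₗ[k] V) (W : ℕ → Submodule k V)
    (hW : ∀ n g, ∀ x ∈ W n, ρ g x ∈ W n) (hdW : ∀ n, ∀ x ∈ W n, d x ∈ W (n + 1))
    (hdd : ∀ n, ∀ x ∈ W n, d (d x) = 0) (hdρ : ∀ n g, ∀ x ∈ W n, d (ρ g x) = ρ g (d x))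
    (hex : ∀ n, ∀ x ∈ W (n + 1), d x = 0 → ∃ y ∈ W n, d y = x)
    (χ : V →ₗ[k] V) (hχW : ∀ n, ∀ x ∈ W n, χ x ∈ W n)
    (hχ : ∀ x, ∑ g : G, ρ g (χ (ρ g⁻¹ x)) = x)
    (u : V) (hu : u ∈ W 0) (hdu : d u = 0) (hρu : ∀ g, ρ g u = u)
    (hu0 : ∀ c : k, c • u = 0 → c = 0) (hx0 : ∀ x ∈ W 0, d x = 0 → ∃ c : k, x = c • u) (n : ℕ) :
    Nonempty (groupCohomology (Rep.trivial k G k) n ≃ₗ[k]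
      Coh (fun n => W n ⊓ ρ.invariants) d n) := by
  have hZ : ∀ n g, ∀ x ∈ cocycles W d n, ρ g x ∈ cocycles W d n := fun n g x hx =>
    ⟨hW n g x hx.1, by
      have h0 : d x = 0 := hx.2
      change d (ρ g x) = 0
      rw [hdρ n g x hx.1, h0, map_zero]⟩
  let A : ℕ → Rep k G := fun n => Rep.of (restrictRep ρ (W n) (hW n))
  let Z : ℕ → Rep k G := fun n => Rep.of (restrictRep ρ (cocycles W d n) (hZ n))
  let i : ∀ n, Z n ⟶ A n := fun n => Rep.ofHom
    { toFun := fun x => ⟨x.1, x.2.1⟩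
      map_add' := fun _ _ => rfl
      map_smul' := fun _ _ => rfl
      isIntertwining' := fun _ => rfl }
  let π : ∀ n, A n ⟶ Z (n + 1) := fun n => Rep.ofHom
    { toFun := fun x => ⟨d x.1, hdW n x.1 x.2, hdd n x.1 x.2⟩
      map_add' := fun x y => Subtype.ext (map_add d x.1 y.1)
      map_smul' := fun c x => Subtype.ext (map_smul d c x.1)
      isIntertwining' := fun g => by
        ext x
        exact hdρ n g x.1 x.2 }
  have hiπ : ∀ n, i n ≫ π n = 0 := fun n => by
    ext x
    exact x.2.2
  -- Dimension shifting: the coresolution is cut into 0 → Z n → W n → Z (n+1) → 0 with acyclic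
  -- middle term, so H^(n+1)(Z 0) is H^1(Z n), a cokernel of a map between invariants.
  let S : ℕ → ShortComplex (Rep k G) := fun n => ShortComplex.mk (i n) (π n) (hiπ n)
  have hS : ∀ n, (S n).ShortExact := fun n => by
    have hi : Mono (i n) := (Rep.mono_iff_injective _).2 fun x y h =>
      Subtype.ext (congrArg (fun z : W n => z.1) h)
    have hπ : Epi (π n) := (Rep.epi_iff_surjective _).2 fun x => by
      obtain ⟨y, hy, hyx⟩ := hex n x.1 x.2.1 x.2.2
      exact ⟨⟨y, hy⟩, Subtype.ext hyx⟩
    refine { exact := ?_, mono_f := hi, epi_g := hπ }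
    rw [← ShortComplex.exact_map_iff_of_faithful _ (forget₂ (Rep k G) (ModuleCat k)),
      ShortComplex.moduleCat_exact_iff]
    intro x hx
    exact ⟨⟨x.1, x.2, congrArg Subtype.val hx⟩, rfl⟩
  have hA : ∀ n m, Limits.IsZero (groupCohomology (A n) (m + 1)) := fun n m => by
    refine isZero_groupCohomology_of_sum_conj_eq_id _ (χ.restrict (hχW n)) (fun x => ?_) m
    refine Subtype.ext ?_
    rw [AddSubmonoidClass.coe_finsetSum]
    exact hχ x.1
  have hshift : ∀ m n, Nonempty (groupCohomology (Z n) (m + 1) ≃ₗ[k]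
      groupCohomology (Z (n + m)) 1) := by
    intro m
    induction m with
    | zero => exact fun n => ⟨LinearEquiv.refl _ _⟩
    | succ m ih =>
      intro n
      obtain ⟨e⟩ := ih (n + 1)
      have : IsIso (groupCohomology.δ (hS n) (m + 1) (m + 2) rfl) :=
        groupCohomology.isIso_δ_of_isZero (hS n) (m + 1) (hA n m) (hA n (m + 1))
      rw [show n + (m + 1) = n + 1 + m by omega]
      exact ⟨(asIso (groupCohomology.δ (hS n) (m + 1) (m + 2) rfl)).toLinearEquiv.symm.trans e⟩
  have hone : ∀ n, Nonempty (groupCohomology (Z n) 1 ≃ₗ[k]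
      Coh (fun n => W n ⊓ ρ.invariants) d (n + 1)) := by
    intro n
    obtain ⟨θ, hθ, hθ0⟩ := exists_surjective_invariants_H1 (hS n) (hA n 0)
    let j : cocycles (fun n => W n ⊓ ρ.invariants) d (n + 1) →ₗ[k] (Z (n + 1)).ρ.invariants :=
      { toFun := fun x => ⟨⟨x.1, x.2.1.1, x.2.2⟩, fun g => Subtype.ext (x.2.1.2 g)⟩
        map_add' := fun _ _ => rfl
        map_smul' := fun _ _ => rfl }
    have hj : Function.Surjective j := fun x =>
      ⟨⟨x.1.1, ⟨x.1.2.1, fun g => congrArg Subtype.val (x.2 g)⟩, x.1.2.2⟩, rfl⟩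
    have hker : LinearMap.ker (θ ∘ₗ j) =
        (coboundaries (fun n => W n ⊓ ρ.invariants) d (n + 1)).submoduleOf
          (cocycles (fun n => W n ⊓ ρ.invariants) d (n + 1)) := by
      ext x
      rw [LinearMap.mem_ker, LinearMap.comp_apply, hθ0]
      constructor
      · rintro ⟨y, hy, hyx⟩
        exact ⟨y.1, ⟨y.2, fun g => congrArg Subtype.val (hy g)⟩, congrArg Subtype.val hyx⟩
      · rintro ⟨y, hy, hyx⟩
        exact ⟨⟨y, hy.1⟩, fun g => Subtype.ext (hy.2 g), Subtype.ext hyx⟩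
    exact ⟨((Submodule.quotEquivOfEq _ _ hker.symm).trans
      ((θ ∘ₗ j).quotKerEquivOfSurjective (hθ.comp hj))).symm⟩
  -- The invariant vector `u` spans the cocycles of degree zero and identifies the trivial
  -- representation with Z 0.
  let e₀ : k →ₗ[k] cocycles W d 0 :=
    LinearMap.toSpanSingleton k _ ⟨u, hu, LinearMap.mem_ker.2 hdu⟩
  have he₀ : Function.Bijective e₀ := by
    constructor
    · rw [← LinearMap.ker_eq_bot, LinearMap.ker_eq_bot']
      exact fun c hc => hu0 c (congrArg Subtype.val hc)
    · rintro ⟨x, hx⟩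
      obtain ⟨c, hc⟩ := hx0 x hx.1 hx.2
      exact ⟨c, Subtype.ext hc.symm⟩
  let E : (Representation.trivial k G k).Equiv (restrictRep ρ (cocycles W d 0) (hZ 0)) :=
    .mk (LinearEquiv.ofBijective e₀ he₀) fun g => by
      ext
      change (1 : k) • u = ρ g ((1 : k) • u)
      simp [hρu]
  have hE : Nonempty (groupCohomology (Rep.trivial k G k) n ≃ₗ[k] groupCohomology (Z 0) n) :=
    ⟨((groupCohomology.functor k G n).mapIso (Rep.mkIso E)).toLinearEquiv⟩
  obtain ⟨hE⟩ := hE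
  cases n with
  | zero =>
    let E0 : (Z 0).ρ.invariants ≃ₗ[k] cocycles (fun n => W n ⊓ ρ.invariants) d 0 :=
      { toFun := fun x => ⟨x.1.1, ⟨x.1.2.1, fun g => congrArg Subtype.val (x.2 g)⟩, x.1.2.2⟩
        map_add' := fun _ _ => rfl
        map_smul' := fun _ _ => rfl
        invFun := fun x => ⟨⟨x.1, x.2.1.1, x.2.2⟩, fun g => Subtype.ext (x.2.1.2 g)⟩
        left_inv := fun _ => rfl
        right_inv := fun _ => rfl }
    have hbot : (coboundaries (fun n => W n ⊓ ρ.invariants) d 0).submoduleOf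
        (cocycles (fun n => W n ⊓ ρ.invariants) d 0) = ⊥ := by
      ext x
      exact ⟨fun h => Subtype.ext h, fun h => congrArg Subtype.val h⟩
    exact ⟨hE.trans (((groupCohomology.H0Iso (Z 0)).toLinearEquiv.trans E0).trans
      (Submodule.quotEquivOfEqBot _ hbot).symm)⟩
  | succ n =>
    obtain ⟨e1⟩ := hshift n 0
    rw [zero_add] at e1
    obtain ⟨e2⟩ := hone n
    exact ⟨hE.trans (e1.trans e2)⟩

end Acyclic

end GroupCohomology

/-! ### The exterior algebra on generators indexed by ℤ/p, with wedge, contraction and rotation -/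

section Exterior

variable (p : ℕ)

/-- The exterior algebra over `𝔽_p` on generators indexed by `ℤ/p`. -/
abbrev Lam : Type := ExteriorAlgebra (ZMod p) (ZMod p → ZMod p)

variable {p}

/-- Left multiplication by the `i`-th generator of the exterior algebra. -/
def wedge (i : ZMod p) : Lam p →ₗ[ZMod p] Lam p :=
  LinearMap.mulLeft (ZMod p) (ExteriorAlgebra.ι (ZMod p) (Pi.single i 1))

/-- Contraction with the `i`-th coordinate functional. -/
def contract (i : ZMod p) : Lam p →ₗ[ZMod p] Lam p :=
  CliffordAlgebra.contractLeft (LinearMap.proj i)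

/-- The cyclic shift of the generators of the exterior algebra. -/
def shiftLam (s : ZMod p) : Lam p →ₗ[ZMod p] Lam p :=
  (ExteriorAlgebra.map (LinearMap.funLeft (ZMod p) (ZMod p) fun j => j - s)).toLinearMap

variable (p) in
/-- The grading of the exterior algebra, extended by zero to negative degrees. -/
def gradeLam (m : ℤ) : Submodule (ZMod p) (Lam p) :=
  if 0 ≤ m then ⋀[ZMod p]^m.toNat (ZMod p → ZMod p) else ⊥

theorem gradeLam_natCast (m : ℕ) : gradeLam p m = ⋀[ZMod p]^m (ZMod p → ZMod p) := by
  simp [gradeLam]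

theorem gradeLam_of_neg {m : ℤ} (hm : m < 0) : gradeLam p m = ⊥ := by
  simp [gradeLam, not_le.2 hm]

theorem wedge_wedge_self (i : ZMod p) (x : Lam p) : wedge i (wedge i x) = 0 := by
  simp only [wedge, LinearMap.mulLeft_apply, ← mul_assoc, ExteriorAlgebra.ι_sq_zero, zero_mul]

theorem wedge_wedge (i j : ZMod p) (x : Lam p) : wedge i (wedge j x) = -wedge j (wedge i x) := by
  simp only [wedge, LinearMap.mulLeft_apply, ← mul_assoc]
  rw [eq_neg_of_add_eq_zero_left (ExteriorAlgebra.ι_add_mul_swap _ _), neg_mul]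

theorem contract_contract_self (i : ZMod p) (x : Lam p) : contract i (contract i x) = 0 :=
  CliffordAlgebra.contractLeft_contractLeft _ _

theorem contract_contract (i j : ZMod p) (x : Lam p) :
    contract i (contract j x) = -contract j (contract i x) :=
  CliffordAlgebra.contractLeft_comm _ _ _

/-- Contraction is an antiderivation. Every homotopy used below, for the Koszul complex as well as
for the final strip, comes from this relation. -/
theorem wedge_contract_add (i j : ZMod p) (x : Lam p) :
    wedge i (contract j x) + contract j (wedge i x) = if i = j then x else 0 := by
  have h := CliffordAlgebra.contractLeft_ι_mul (Q := (0 : QuadraticForm (ZMod p) _))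
    (LinearMap.proj (R := ZMod p) (φ := fun _ : ZMod p => ZMod p) j) (Pi.single i 1) x
  change contract j (wedge i x) = _ - wedge i (contract j x) at h
  rw [h]
  by_cases hij : i = j
  · subst hij; simp
  · simp [hij]

theorem wedge_mem {i : ZMod p} {m : ℤ} {x : Lam p} (hx : x ∈ gradeLam p m) :
    wedge i x ∈ gradeLam p (m + 1) := by
  rcases lt_or_ge m 0 with hm | hm
  · rw [gradeLam_of_neg hm, Submodule.mem_bot] at hx
    simp [hx]
  · lift m to ℕ using hm
    rw [gradeLam_natCast] at hx
    rw [show (m : ℤ) + 1 = ((m + 1 : ℕ) : ℤ) by push_cast; rfl, gradeLam_natCast]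
    change _ * x ∈ _ ^ (m + 1)
    rw [pow_succ']
    exact Submodule.mul_mem_mul (LinearMap.mem_range_self _ _) hx

theorem contract_algebraMap (i : ZMod p) (c : ZMod p) :
    contract i (algebraMap (ZMod p) (Lam p) c) = 0 :=
  CliffordAlgebra.contractLeft_algebraMap _ _ c

theorem contract_mem_exteriorPower (i : ZMod p) (m : ℕ) :
    ∀ x ∈ ⋀[ZMod p]^(m + 1) (ZMod p → ZMod p), contract i x ∈ ⋀[ZMod p]^m (ZMod p → ZMod p) := by
  have key : ∀ (v : ZMod p → ZMod p) (y : Lam p), contract i (ExteriorAlgebra.ι (ZMod p) v * y) =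
      v i • y - ExteriorAlgebra.ι (ZMod p) v * contract i y := fun v y =>
    CliffordAlgebra.contractLeft_ι_mul (Q := (0 : QuadraticForm (ZMod p) _))
      (LinearMap.proj (R := ZMod p) (φ := fun _ : ZMod p => ZMod p) i) v y
  induction m with
  | zero =>
    intro x hx
    have hx' : x ∈ LinearMap.range (ExteriorAlgebra.ι (ZMod p) (M := ZMod p → ZMod p)) ^ 1 := hx
    rw [pow_one] at hx'
    obtain ⟨v, rfl⟩ := hx'
    have h := key v 1
    rw [mul_one, ← map_one (algebraMap (ZMod p) (Lam p)), contract_algebraMap, mul_zero,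
      sub_zero] at h
    rw [h]
    change _ ∈ _ ^ 0
    rw [pow_zero, map_one]
    exact Submodule.smul_mem _ _ (Submodule.one_le.1 le_rfl)
  | succ m ih =>
    intro x hx
    have hx' : x ∈ LinearMap.range (ExteriorAlgebra.ι (ZMod p) (M := ZMod p → ZMod p)) *
      ⋀[ZMod p]^(m + 1) (ZMod p → ZMod p) := by
      rw [← pow_succ']; exact hx
    refine Submodule.mul_induction_on hx' ?_ ?_
    · rintro _ ⟨v, rfl⟩ y hy
      rw [key]
      refine Submodule.sub_mem _ (Submodule.smul_mem _ _ hy) ?_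
      change _ ∈ _ ^ (m + 1)
      rw [pow_succ']
      exact Submodule.mul_mem_mul (LinearMap.mem_range_self _ _) (ih y hy)
    · intro y z hy hz
      rw [map_add]
      exact Submodule.add_mem _ hy hz

theorem contract_eq_zero {i : ZMod p} {x : Lam p} (hx : x ∈ gradeLam p 0) : contract i x = 0 := by
  have hx' : x ∈ (1 : Submodule (ZMod p) (Lam p)) := by
    have := gradeLam_natCast (p := p) 0
    rw [Nat.cast_zero] at this
    rw [this] at hx
    rwa [← pow_zero]
  obtain ⟨c, rfl⟩ := Submodule.mem_one.1 hx'
  exact contract_algebraMap i c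

theorem contract_mem {i : ZMod p} {m : ℤ} {x : Lam p} (hx : x ∈ gradeLam p m) :
    contract i x ∈ gradeLam p (m - 1) := by
  rcases lt_trichotomy m 0 with hm | rfl | hm
  · rw [gradeLam_of_neg hm, Submodule.mem_bot] at hx
    simp [hx]
  · rw [contract_eq_zero hx]
    exact Submodule.zero_mem _
  · obtain ⟨n, rfl⟩ : ∃ n : ℕ, m = ((n + 1 : ℕ) : ℤ) := ⟨(m - 1).toNat, by omega⟩
    rw [gradeLam_natCast] at hx
    rw [show ((n + 1 : ℕ) : ℤ) - 1 = n by push_cast; ring, gradeLam_natCast]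
    exact contract_mem_exteriorPower i n x hx

theorem mem_gradeLam_zero {x : Lam p} (hx : x ∈ gradeLam p 0) : ∃ c : ZMod p, x = c • 1 := by
  have hx' : x ∈ (1 : Submodule (ZMod p) (Lam p)) := by
    have := gradeLam_natCast (p := p) 0
    rw [Nat.cast_zero] at this
    rw [this] at hx
    rwa [← pow_zero]
  obtain ⟨c, rfl⟩ := Submodule.mem_one.1 hx'
  exact ⟨c, Algebra.algebraMap_eq_smul_one c⟩

theorem one_mem_gradeLam : (1 : Lam p) ∈ gradeLam p 0 := by
  have := gradeLam_natCast (p := p) 0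
  rw [Nat.cast_zero] at this
  rw [this]
  change _ ∈ _ ^ 0
  rw [pow_zero]
  exact Submodule.one_le.1 le_rfl

theorem smul_one_eq_zero {c : ZMod p} (hc : c • (1 : Lam p) = 0) : c = 0 := by
  rw [← Algebra.algebraMap_eq_smul_one] at hc
  exact (ExteriorAlgebra.algebraMap_eq_zero_iff _ _).1 hc

theorem shiftLam_zero (x : Lam p) : shiftLam 0 x = x := by
  have : (LinearMap.funLeft (ZMod p) (ZMod p) fun j : ZMod p => j - 0) = LinearMap.id := by
    ext; simp
  rw [shiftLam, this, ExteriorAlgebra.map_id]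
  rfl

theorem shiftLam_add (s t : ZMod p) (x : Lam p) : shiftLam (s + t) x = shiftLam s (shiftLam t x) := by
  have : (LinearMap.funLeft (ZMod p) (ZMod p) fun j : ZMod p => j - (s + t)) =
      (LinearMap.funLeft (ZMod p) (ZMod p) fun j : ZMod p => j - s) ∘ₗ
      (LinearMap.funLeft (ZMod p) (ZMod p) fun j : ZMod p => j - t) := by
    rw [← LinearMap.funLeft_comp]
    congr 1
    funext j
    simp [sub_sub]
  simp only [shiftLam, this, AlgHom.toLinearMap_apply]
  rw [← ExteriorAlgebra.map_comp_map]
  rfl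

theorem shiftLam_one (s : ZMod p) : shiftLam s (1 : Lam p) = 1 := by simp [shiftLam]

theorem funLeft_sub_single (s i : ZMod p) :
    LinearMap.funLeft (ZMod p) (ZMod p) (fun j => j - s) (Pi.single i 1) =
      (Pi.single (i + s) 1 : ZMod p → ZMod p) := by
  ext j
  simp only [LinearMap.funLeft_apply, Pi.single_apply, sub_eq_iff_eq_add]

theorem shiftLam_wedge (s i : ZMod p) (x : Lam p) :
    shiftLam s (wedge i x) = wedge (i + s) (shiftLam s x) := by
  simp only [shiftLam, wedge, LinearMap.mulLeft_apply, AlgHom.toLinearMap_apply, map_mul,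
    ExteriorAlgebra.map_apply_ι, funLeft_sub_single]

/-- Both sides obey the same antiderivation rule under left multiplication by a vector and vanish on
scalars. -/
theorem shiftLam_contract (s i : ZMod p) (x : Lam p) :
    shiftLam s (contract i x) = contract (i + s) (shiftLam s x) := by
  have key : ∀ (j : ZMod p) (v : ZMod p → ZMod p) (y : Lam p),
      contract j (ExteriorAlgebra.ι (ZMod p) v * y) =
      v j • y - ExteriorAlgebra.ι (ZMod p) v * contract j y := fun j v y =>
    CliffordAlgebra.contractLeft_ι_mul (Q := (0 : QuadraticForm (ZMod p) _))
      (LinearMap.proj (R := ZMod p) (φ := fun _ : ZMod p => ZMod p) j) v y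
  have hmul : ∀ (v : ZMod p → ZMod p) (y : Lam p), shiftLam s (ExteriorAlgebra.ι (ZMod p) v * y) =
      ExteriorAlgebra.ι (ZMod p) (fun j => v (j - s)) * shiftLam s y := fun v y => by
    simp only [shiftLam, AlgHom.toLinearMap_apply, map_mul, ExteriorAlgebra.map_apply_ι]
    rfl
  refine CliffordAlgebra.left_induction (Q := (0 : QuadraticForm (ZMod p) _))
    (P := fun x => shiftLam s (contract i x) = contract (i + s) (shiftLam s x)) ?_ ?_ ?_ x
  · intro c
    have h1 : shiftLam s (algebraMap (ZMod p) (Lam p) c) = algebraMap (ZMod p) (Lam p) c := by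
      simp [shiftLam]
    have h2 := contract_algebraMap i c
    have h3 := contract_algebraMap (i + s) c
    change shiftLam s (contract i (algebraMap (ZMod p) (Lam p) c)) =
      contract (i + s) (shiftLam s (algebraMap (ZMod p) (Lam p) c))
    rw [h1, h2, h3, map_zero]
  · intro x y hx hy
    simp only [map_add, hx, hy]
  · intro x v hx
    change shiftLam s (contract i (ExteriorAlgebra.ι (ZMod p) v * x)) =
      contract (i + s) (shiftLam s (ExteriorAlgebra.ι (ZMod p) v * x))
    rw [key, hmul, key, map_sub, map_smul, hmul, hx]
    simp

theorem shiftLam_mem {s : ZMod p} {m : ℤ} {x : Lam p} (hx : x ∈ gradeLam p m) :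
    shiftLam s x ∈ gradeLam p m := by
  rcases lt_or_ge m 0 with hm | hm
  · rw [gradeLam_of_neg hm, Submodule.mem_bot] at hx
    simp [hx]
  · lift m to ℕ using hm
    rw [gradeLam_natCast] at hx ⊢
    have h : Submodule.map (shiftLam s) (LinearMap.range (ExteriorAlgebra.ι (ZMod p)) ^ m) ≤
        LinearMap.range (ExteriorAlgebra.ι (ZMod p) (M := ZMod p → ZMod p)) ^ m := by
      rw [shiftLam, Submodule.map_pow]
      refine pow_le_pow_left' ?_ m
      rintro _ ⟨_, ⟨v, rfl⟩, rfl⟩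
      simp
    exact h ⟨x, hx, rfl⟩

theorem gradeLam_of_lt [Fact p.Prime] {m : ℤ} (hm : (p : ℤ) < m) : gradeLam p m = ⊥ := by
  lift m to ℕ using by omega
  rw [gradeLam_natCast, ← Submodule.finrank_eq_zero, exteriorPower.finrank_eq,
    Module.finrank_fintype_fun_eq_card, ZMod.card]
  exact Nat.choose_eq_zero_of_lt (by omega)

/-- Finiteness makes it possible to invert the Newton expansion by counting. -/
instance [Fact p.Prime] (m : ℤ) : Finite (gradeLam p m) := by
  have : Module.Finite (ZMod p) (gradeLam p m) := by
    rcases lt_or_ge m 0 with hm | hm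
    · rw [gradeLam_of_neg hm]
      infer_instance
    · lift m to ℕ using hm
      rw [gradeLam_natCast]
      infer_instance
  exact Module.finite_of_finite (ZMod p)

/-- A form of positive degree killed by all contractions vanishes. -/
theorem eq_zero_of_contract_eq_zero [Fact p.Prime] {m : ℤ} (hm : 0 < m) {x : Lam p}
    (hx : x ∈ gradeLam p m) (h : ∀ i, contract i x = 0) : x = 0 := by
  -- Multiply by one generator after another. Contraction by a generator undoes the multiplication
  -- as long as that generator does not occur, so nothing is lost, yet after all p of them the
  -- degree m + p exceeds p.
  have key : ∀ l : List (ZMod p), l.Nodup → (∀ i, i ∉ l → contract i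
        (l.foldr (fun i y => wedge i y) x) = 0) ∧
      l.foldr (fun i y => wedge i y) x ∈ gradeLam p (m + l.length) ∧
      (l.foldr (fun i y => wedge i y) x = 0 → x = 0) := by
    intro l
    induction l with
    | nil => exact fun _ => ⟨fun i _ => h i, by simpa using hx, id⟩
    | cons a l ih =>
      intro hl
      obtain ⟨ha, hl⟩ := List.nodup_cons.1 hl
      obtain ⟨h1, h2, h3⟩ := ih hl
      refine ⟨fun i hi => ?_, ?_, fun h0 => h3 ?_⟩
      · rw [List.mem_cons, not_or] at hi
        have := wedge_contract_add a i (l.foldr (fun i y => wedge i y) x)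
        rw [h1 i hi.2, map_zero, zero_add, if_neg (Ne.symm hi.1)] at this
        exact this
      · have := wedge_mem (i := a) h2
        rw [List.length_cons]
        push_cast
        rwa [← add_assoc]
      · have := wedge_contract_add a a (l.foldr (fun i y => wedge i y) x)
        rw [h1 a ha, map_zero, zero_add, if_pos rfl] at this
        rw [← this]
        exact (congrArg (contract a) h0).trans (map_zero _)
  obtain ⟨-, h2, h3⟩ := key (Finset.univ : Finset (ZMod p)).toList (Finset.nodup_toList _)
  refine h3 ?_
  rw [gradeLam_of_lt (by simp [ZMod.card]; omega)] at h2
  exact h2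

end Exterior

/-! ### Diagram chases: adjoining a variable of degree two, and double complexes with exact columns
-/

section Chase

variable {k : Type*} [CommRing k] {X : Type*} [AddCommGroup X] [Module k X]

/-- The operator `d + v h` on power series in `v` with coefficients in `X`. -/
def seriesD (d h : X →ₗ[k] X) : (ℕ → X) →ₗ[k] (ℕ → X) where
  toFun y i := d (y i) + match i with
    | 0 => 0
    | i + 1 => h (y i)
  map_add' y z := by
    funext i
    cases i
    · simp
    · simp only [Pi.add_apply, map_add]; abel
  map_smul' c y := by
    funext i
    cases i <;> simp

theorem seriesD_zero (d h : X →ₗ[k] X) (y : ℕ → X) : seriesD d h y 0 = d (y 0) := by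
  simp [seriesD]

theorem seriesD_succ (d h : X →ₗ[k] X) (y : ℕ → X) (i : ℕ) :
    seriesD d h y (i + 1) = d (y (i + 1)) + h (y i) := rfl

/-- Adjoining a variable of degree two: if `g` is a surjective endomorphism of the complex
`(X, d)`, null-homotopic by `h` with `h² = 0`, and `X` is exact in nonzero degrees, then so is
the complex of power series over `ker g` with differential `d + v h`. -/
theorem exists_seriesD_eq (𝒳 : ℤ → Submodule k X) (hneg : ∀ n < 0, 𝒳 n = ⊥)
    (d g h : X →ₗ[k] X) (hd : ∀ n, ∀ x ∈ 𝒳 n, d x ∈ 𝒳 (n + 1))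
    (hh : ∀ n, ∀ x ∈ 𝒳 n, h x ∈ 𝒳 (n - 1)) (hg : ∀ n, ∀ x ∈ 𝒳 n, g x ∈ 𝒳 n)
    (hdd : ∀ n, ∀ x ∈ 𝒳 n, d (d x) = 0) (hdh : ∀ x, d (h x) + h (d x) = g x)
    (hgd : ∀ x, g (d x) = d (g x)) (hgh : ∀ x, g (h x) = h (g x)) (hhh : ∀ x, h (h x) = 0)
    (hex : ∀ n, n ≠ 0 → ∀ x ∈ 𝒳 n, d x = 0 → ∃ y ∈ 𝒳 (n - 1), d y = x)
    (hsurj : ∀ n, ∀ x ∈ 𝒳 n, ∃ y ∈ 𝒳 n, g y = x) {n : ℤ} (hn : n ≠ 0) (x : ℕ → X)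
    (hx : ∀ i : ℕ, x i ∈ 𝒳 (n - 2 * i)) (hgx : ∀ i, g (x i) = 0) (hDx : seriesD d h x = 0) :
    ∃ y : ℕ → X, (∀ i : ℕ, y i ∈ 𝒳 (n - 1 - 2 * i)) ∧ (∀ i, g (y i) = 0) ∧
      seriesD d h y = x := by
  -- The coefficients of v^0, v^1, … are cleared in turn: `K` counts those already zero and `r`
  -- bounds the remaining steps, because the degree n - 2i is negative once 2i > n.
  suffices key : ∀ (r K : ℕ), n < 2 * (K + r) → ∀ x : ℕ → X, (∀ i : ℕ, x i ∈ 𝒳 (n - 2 * i)) →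
      (∀ i, g (x i) = 0) → seriesD d h x = 0 → (∀ i < K, x i = 0) →
      ∃ y : ℕ → X, (∀ i : ℕ, y i ∈ 𝒳 (n - 1 - 2 * i)) ∧ (∀ i, g (y i) = 0) ∧
        seriesD d h y = x from
    key (n.toNat + 1) 0 (by push_cast; omega) x hx hgx hDx (by simp)
  intro r
  induction r with
  | zero =>
    intro K hK x hx hgx hDx hxK
    have hx' : ∀ i, x i = 0 := fun i => by
      by_cases hi : i < K
      · exact hxK i hi
      · have := hx i
        rwa [hneg _ (by omega), Submodule.mem_bot] at this
    refine ⟨0, fun i => Submodule.zero_mem _, by simp, ?_⟩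
    rw [map_zero]
    exact (funext hx').symm
  | succ r ih =>
    intro K hK x hx hgx hDx hxK
    suffices hy : ∃ y : ℕ → X, (∀ i : ℕ, y i ∈ 𝒳 (n - 1 - 2 * i)) ∧ (∀ i, g (y i) = 0) ∧
        ∀ i ≤ K, seriesD d h y i = x i by
      obtain ⟨y, hy, hgy, hyx⟩ := hy
      have hz := ih (K + 1) (by push_cast at hK ⊢; omega) (x - seriesD d h y)
        (fun i => ?_) (fun i => ?_) ?_ (fun i hi => ?_)
      · obtain ⟨z, hz, hgz, hzx⟩ := hz
        refine ⟨y + z, fun i => Submodule.add_mem _ (hy i) (hz i), fun i => ?_, ?_⟩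
        · rw [Pi.add_apply, map_add, hgy, hgz, add_zero]
        · rw [map_add, hzx, add_sub_cancel]
      · refine Submodule.sub_mem _ (hx i) ?_
        cases i with
        | zero =>
          rw [seriesD_zero]
          have := hd _ _ (hy 0)
          convert this using 2
          simp
        | succ i =>
          rw [seriesD_succ]
          refine Submodule.add_mem _ ?_ ?_
          · have := hd _ _ (hy (i + 1))
            convert this using 2
            ring
          · have := hh _ _ (hy i)
            convert this using 2
            push_cast
            ring
      · rw [Pi.sub_apply, map_sub, hgx, zero_sub, neg_eq_zero]
        cases i with
        | zero => rw [seriesD_zero, hgd, hgy, map_zero]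
        | succ i => rw [seriesD_succ, map_add, hgd, hgh, hgy, hgy, map_zero, map_zero, add_zero]
      · rw [map_sub, hDx, zero_sub, neg_eq_zero]
        funext i
        match i with
        | 0 => rw [seriesD_zero, seriesD_zero, hdd _ _ (hy 0)]; rfl
        | 1 =>
          rw [seriesD_succ, seriesD_succ, seriesD_zero, map_add, hdd _ _ (hy _), zero_add, hdh, hgy]
          rfl
        | i + 2 =>
          rw [seriesD_succ, seriesD_succ, seriesD_succ, map_add, map_add, hdd _ _ (hy _), zero_add,
            hhh, add_zero, hdh, hgy]
          rfl
      · rw [Pi.sub_apply, hyx i (by omega), sub_self]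
    have hdxK : d (x K) = 0 := by
      have := congrFun hDx K
      cases K with
      | zero => rwa [seriesD_zero] at this
      | succ K => rwa [seriesD_succ, hxK K (by omega), map_zero, add_zero] at this
    by_cases he : n - 2 * K = 0
    · -- the coefficient `x K` has degree zero
      obtain ⟨K, rfl⟩ : ∃ K', K = K' + 1 := ⟨K - 1, by omega⟩
      -- Exactness is not available in degree zero. The coefficient is instead reached from the
      -- previous power of v: if g y is the coefficient, then h y = 0 for degree reasons and the
      -- homotopy formula gives h (d y) = g y.
      obtain ⟨y, hy, hgy⟩ := hsurj _ _ (hx (K + 1))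
      have hhy : h y = 0 := by
        have := hh _ _ hy
        rwa [hneg _ (by omega), Submodule.mem_bot] at this
      have hhdy : h (d y) = x (K + 1) := by
        have := hdh y
        rwa [hhy, map_zero, zero_add, hgy] at this
      refine ⟨Pi.single K (d y), fun i => ?_, fun i => ?_, fun i hi => ?_⟩
      · by_cases hi : i = K
        · subst hi
          rw [Pi.single_eq_same]
          have := hd _ _ hy
          convert this using 2
          push_cast
          ring
        · rw [Pi.single_eq_of_ne hi]
          exact Submodule.zero_mem _
      · by_cases hi : i = K
        · subst hi
          rw [Pi.single_eq_same, hgd, hgy, hdxK]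
        · rw [Pi.single_eq_of_ne hi, map_zero]
      · have hdd' : ∀ i, d (Pi.single (M := fun _ => X) K (d y) i) = 0 := fun i => by
          by_cases hi : i = K
          · subst hi
            rw [Pi.single_eq_same, hdd _ _ hy]
          · rw [Pi.single_eq_of_ne hi, map_zero]
        cases i with
        | zero => rw [seriesD_zero, hdd', hxK 0 (by omega)]
        | succ i =>
          rw [seriesD_succ, hdd', zero_add]
          by_cases hi' : i = K
          · subst hi'
            rw [Pi.single_eq_same, hhdy]
          · rw [Pi.single_eq_of_ne hi', map_zero, hxK _ (by omega)]
    · obtain ⟨y, hy, hdy, hgy⟩ : ∃ y ∈ 𝒳 (n - 2 * K - 1), d y = x K ∧ g y = 0 := by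
        obtain ⟨y, hy, hdy⟩ := hex _ he _ (hx K) hdxK
        -- A primitive y of `x K` must be corrected to lie in ker g. In degree zero this is
        -- automatic, since g y = h (x K) and the next coefficient of x vanishes. Otherwise g y is a
        -- cocycle, hence of the form d (g z), and y - d z works.
        by_cases he1 : n - 2 * K - 1 = 0
        · refine ⟨y, hy, hdy, ?_⟩
          have h1 : h y = 0 := by
            have := hh _ _ hy
            rwa [hneg _ (by omega), Submodule.mem_bot] at this
          have h2 : x (K + 1) = 0 := by
            have := hx (K + 1)
            rwa [hneg _ (by push_cast; omega), Submodule.mem_bot] at this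
          have h3 := congrFun hDx (K + 1)
          rw [seriesD_succ, h2, map_zero, zero_add] at h3
          rw [← hdh, h1, map_zero, zero_add, hdy, h3]
          rfl
        · obtain ⟨z', hz', hdz'⟩ := hex _ he1 (g y) (hg _ _ hy) (by rw [← hgd, hdy, hgx])
          obtain ⟨z, hz, hgz⟩ := hsurj _ _ hz'
          refine ⟨y - d z, Submodule.sub_mem _ hy ?_, ?_, ?_⟩
          · have := hd _ _ hz
            rwa [sub_add_cancel] at this
          · rw [map_sub, hdd _ _ hz, sub_zero, hdy]
          · rw [map_sub, hgd, hgz, hdz', sub_self]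
      refine ⟨Pi.single K y, fun i => ?_, fun i => ?_, fun i hi => ?_⟩
      · by_cases hi : i = K
        · subst hi
          rw [Pi.single_eq_same]
          convert hy using 2
          ring
        · rw [Pi.single_eq_of_ne hi]
          exact Submodule.zero_mem _
      · by_cases hi : i = K
        · subst hi
          rw [Pi.single_eq_same, hgy]
        · rw [Pi.single_eq_of_ne hi, map_zero]
      · cases i with
        | zero =>
          rw [seriesD_zero]
          by_cases hi' : 0 = K
          · subst hi'
            rw [Pi.single_eq_same, hdy]
          · rw [Pi.single_eq_of_ne hi', map_zero, hxK 0 (by omega)]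
        | succ i =>
          rw [seriesD_succ, Pi.single_eq_of_ne (show i ≠ K by omega), map_zero, add_zero]
          by_cases hi' : i + 1 = K
          · subst hi'
            rw [Pi.single_eq_same, hdy]
          · rw [Pi.single_eq_of_ne hi', map_zero, hxK _ (by omega)]

/-- The differential of the total complex of the double complex with columns `(X, d)` and
horizontal differentials `τ i`. -/
def totD (d : X →ₗ[k] X) (τ : ℕ → X →ₗ[k] X) : (ℕ → X) →ₗ[k] (ℕ → X) where
  toFun z i := (-1 : k) ^ i • d (z i) + match i with
    | 0 => 0
    | i + 1 => τ i (z i)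
  map_add' y z := by
    funext i
    cases i
    · simp
    · simp only [Pi.add_apply, map_add, smul_add]; abel
  map_smul' c y := by
    funext i
    cases i <;> simp [smul_comm c]

theorem totD_zero (d : X →ₗ[k] X) (τ : ℕ → X →ₗ[k] X) (z : ℕ → X) :
    totD d τ z 0 = d (z 0) := by
  simp [totD]

theorem totD_succ (d : X →ₗ[k] X) (τ : ℕ → X →ₗ[k] X) (z : ℕ → X) (i : ℕ) :
    totD d τ z (i + 1) = (-1 : k) ^ (i + 1) • d (z (i + 1)) + τ i (z i) := rfl

theorem totD_mem {𝒳 : ℤ → Submodule k X} {d : X →ₗ[k] X} {τ : ℕ → X →ₗ[k] X}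
    (hd : ∀ n, ∀ x ∈ 𝒳 n, d x ∈ 𝒳 (n + 1)) (hτ : ∀ i n, ∀ x ∈ 𝒳 n, τ i x ∈ 𝒳 n)
    {n : ℤ} {z : ℕ → X} (hz : ∀ i : ℕ, z i ∈ 𝒳 (n - i)) (i : ℕ) :
    totD d τ z i ∈ 𝒳 (n + 1 - i) := by
  cases i with
  | zero =>
    rw [totD_zero]
    have := hd _ _ (hz 0)
    convert this using 2
    simp
  | succ i =>
    rw [totD_succ]
    refine Submodule.add_mem _ (Submodule.smul_mem _ _ ?_) ?_
    · have := hd _ _ (hz (i + 1))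
      convert this using 2
      ring
    · have := hτ i _ _ (hz i)
      convert this using 2
      push_cast
      ring

/-- As d and τ commute, the alternating sign on d makes the mixed terms cancel. -/
theorem totD_totD {𝒳 : ℤ → Submodule k X} {d : X →ₗ[k] X} {τ : ℕ → X →ₗ[k] X}
    (hdd : ∀ n, ∀ x ∈ 𝒳 n, d (d x) = 0) (hdτ : ∀ i x, d (τ i x) = τ i (d x))
    (hττ : ∀ i x, τ (i + 1) (τ i x) = 0) {n : ℤ} {z : ℕ → X} (hz : ∀ i : ℕ, z i ∈ 𝒳 (n - i)) :
    totD d τ (totD d τ z) = 0 := by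
  funext i
  match i with
  | 0 => rw [totD_zero, totD_zero, hdd _ _ (hz 0)]; rfl
  | 1 =>
    rw [totD_succ, totD_succ, totD_zero, map_add, map_smul, hdd _ _ (hz _), hdτ]
    simp
  | i + 2 =>
    rw [totD_succ, totD_succ, totD_succ, map_add, map_add, map_smul, map_smul, hdd _ _ (hz _), hdτ,
      hττ, smul_zero, zero_add, add_zero, ← add_smul, pow_succ]
    simp

/-- If the columns of a double complex are exact in nonzero degrees, a cocycle of the total
complex is cohomologous to one concentrated in column degree zero. -/
theorem exists_totD_eq {𝒳 : ℤ → Submodule k X} (hneg : ∀ n < 0, 𝒳 n = ⊥)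
    {d : X →ₗ[k] X} {τ : ℕ → X →ₗ[k] X}
    (hd : ∀ n, ∀ x ∈ 𝒳 n, d x ∈ 𝒳 (n + 1)) (hτ : ∀ i n, ∀ x ∈ 𝒳 n, τ i x ∈ 𝒳 n)
    (hdd : ∀ n, ∀ x ∈ 𝒳 n, d (d x) = 0) (hdτ : ∀ i x, d (τ i x) = τ i (d x))
    (hττ : ∀ i x, τ (i + 1) (τ i x) = 0)
    (hex : ∀ n, n ≠ 0 → ∀ x ∈ 𝒳 n, d x = 0 → ∃ y ∈ 𝒳 (n - 1), d y = x)
    {n : ℤ} (z : ℕ → X) (hz : ∀ i : ℕ, z i ∈ 𝒳 (n - i)) (hDz : totD d τ z = 0) :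
    ∃ y : ℕ → X, (∀ i : ℕ, y i ∈ 𝒳 (n - 1 - i)) ∧
      ∀ i : ℕ, (i : ℤ) ≠ n → (z - totD d τ y) i = 0 := by
  -- The entries i < n are cleared one by one: the first nonzero one is a column cocycle of positive
  -- degree n - i. Entries with i > n vanish because their column degree is negative.
  suffices key : ∀ K : ℕ, (K : ℤ) ≤ n → ∃ y : ℕ → X, (∀ i : ℕ, y i ∈ 𝒳 (n - 1 - i)) ∧
      ∀ i < K, (z - totD d τ y) i = 0 by
    have hmem : ∀ y : ℕ → X, (∀ i : ℕ, y i ∈ 𝒳 (n - 1 - i)) → ∀ i : ℕ, n < i →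
        (z - totD d τ y) i = 0 := fun y hy i hi => by
      have h1 := Submodule.sub_mem _ (hz i) (show totD d τ y i ∈ 𝒳 (n - i) by
        have := totD_mem hd hτ hy i
        rwa [sub_add_cancel] at this)
      rwa [hneg _ (by omega), Submodule.mem_bot] at h1
    rcases lt_or_ge n 0 with hn | hn
    · exact ⟨0, fun i => Submodule.zero_mem _, fun i _ =>
        hmem 0 (fun i => Submodule.zero_mem _) i (by omega)⟩
    · lift n to ℕ using hn
      obtain ⟨y, hy, hyz⟩ := key n le_rfl
      refine ⟨y, hy, fun i hi => ?_⟩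
      rcases lt_trichotomy i n with h | h | h
      · exact hyz i h
      · exact absurd (by exact_mod_cast h) hi
      · exact hmem y hy i (by exact_mod_cast h)
  intro K
  induction K with
  | zero => exact fun _ => ⟨0, fun i => Submodule.zero_mem _, by simp⟩
  | succ K ih =>
    intro hK
    push_cast at hK
    obtain ⟨y, hy, hyz⟩ := ih (by omega)
    set w := z - totD d τ y with hw
    have hDw : totD d τ w = 0 := by
      rw [hw, map_sub, hDz, totD_totD hdd hdτ hττ hy, sub_zero]
    have hwK : w K ∈ 𝒳 (n - K) := Submodule.sub_mem _ (hz K) (by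
        have := totD_mem hd hτ hy K
        rwa [sub_add_cancel] at this)
    have hdw : d (w K) = 0 := by
      have h := congrFun hDw K
      cases K with
      | zero => rwa [totD_zero] at h
      | succ K =>
        rw [totD_succ, hyz K (by omega), map_zero, add_zero] at h
        have h' := congrArg (fun x => (-1 : k) ^ (K + 1) • x) h
        simpa [smul_smul, ← mul_pow] using h'
    obtain ⟨v, hv, hdv⟩ := hex _ (by omega) _ hwK hdw
    refine ⟨y + Pi.single K ((-1 : k) ^ K • v), fun i => Submodule.add_mem _ (hy i) ?_,
      fun i hi => ?_⟩
    · by_cases hi : i = K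
      · subst hi
        rw [Pi.single_eq_same]
        refine Submodule.smul_mem _ _ ?_
        convert hv using 2
        ring
      · rw [Pi.single_eq_of_ne hi]
        exact Submodule.zero_mem _
    · rw [map_add, ← sub_sub, ← hw, Pi.sub_apply]
      have hsq : (-1 : k) ^ K * (-1) ^ K = 1 := by rw [← mul_pow]; simp
      cases i with
      | zero =>
        rw [totD_zero]
        by_cases hi' : 0 = K
        · subst hi'
          rw [Pi.single_eq_same]
          simp [hdv]
        · rw [Pi.single_eq_of_ne hi', map_zero, hyz 0 (by omega), sub_zero]
      | succ i =>
        rw [totD_succ, Pi.single_eq_of_ne (show i ≠ K by omega), map_zero, add_zero]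
        by_cases hi' : i + 1 = K
        · subst hi'
          rw [Pi.single_eq_same, map_smul, smul_smul, hsq, one_smul, hdv, sub_self]
        · rw [Pi.single_eq_of_ne hi', map_zero, smul_zero, hyz _ (by omega), sub_zero]

end Chase

/-! ### Adjoining finitely many variables of degree two -/

section Polynomials

variable {k : Type*} [CommRing k] {Y : Type*} [DecidableEq Y]
  {N : Type*} [AddCommGroup N] [Module k N]

/-- Multiplication by the `i`-th variable on power series, i.e. families indexed by exponents. -/
def varMul (k : Type*) [CommRing k] {N : Type*} [AddCommGroup N] [Module k N] (i : Y) :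
    ((Y → ℕ) → N) →ₗ[k] ((Y → ℕ) → N) where
  toFun x α := if α i = 0 then 0 else x (α - Pi.single i 1)
  map_add' x y := by
    funext α
    by_cases h : α i = 0 <;> simp [h]
  map_smul' c x := by
    funext α
    by_cases h : α i = 0 <;> simp [h]

theorem varMul_apply (i : Y) (x : (Y → ℕ) → N) (α : Y → ℕ) :
    varMul k i x α = if α i = 0 then 0 else x (α - Pi.single i 1) := rfl

theorem varMul_comm (i j : Y) (x : (Y → ℕ) → N) :
    varMul k i (varMul k j x) = varMul k j (varMul k i x) := by
  by_cases hij : i = j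
  · rw [hij]
  funext α
  simp only [varMul_apply, Pi.sub_apply, Pi.single_eq_of_ne hij, Pi.single_eq_of_ne (Ne.symm hij),
    Nat.sub_zero]
  rw [tsub_right_comm]
  split_ifs <;> rfl

theorem varMul_compLeft (i : Y) (f : N →ₗ[k] N) (x : (Y → ℕ) → N) :
    varMul k i (f.compLeft (Y → ℕ) x) = f.compLeft (Y → ℕ) (varMul k i x) := by
  funext α
  simp only [varMul_apply, LinearMap.compLeft_apply, Function.comp_apply]
  split_ifs <;> simp

/-- The operator `d + ∑ j ∈ J, v_j h_j` on power series. -/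
def polyD (J : Finset Y) (d : N →ₗ[k] N) (h : Y → N →ₗ[k] N) :
    ((Y → ℕ) → N) →ₗ[k] ((Y → ℕ) → N) :=
  d.compLeft (Y → ℕ) + ∑ j ∈ J, (h j).compLeft (Y → ℕ) ∘ₗ varMul k j

theorem polyD_apply (J : Finset Y) (d : N →ₗ[k] N) (h : Y → N →ₗ[k] N) (x : (Y → ℕ) → N)
    (α : Y → ℕ) : polyD J d h x α =
      d (x α) + ∑ j ∈ J, if α j = 0 then 0 else h j (x (α - Pi.single j 1)) := by
  simp only [polyD, LinearMap.add_apply, LinearMap.sum_apply, Pi.add_apply, Finset.sum_apply,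
    LinearMap.compLeft_apply, Function.comp_apply, LinearMap.comp_apply, varMul_apply]
  congr 1
  refine Finset.sum_congr rfl fun j _ => ?_
  split_ifs <;> simp

/-- Off-diagonal terms cancel in pairs under the swap. The diagonal is a separate assumption because
antisymmetry does not force it to vanish when p = 2. -/
theorem sum_sum_eq_zero_of_antisymm {Y M : Type*} [AddCommGroup M] (J : Finset Y) (F : Y → Y → M)
    (h0 : ∀ i, F i i = 0) (h1 : ∀ i j, F i j = -F j i) : ∑ i ∈ J, ∑ j ∈ J, F i j = 0 := by
  rw [← Finset.sum_product']
  refine Finset.sum_involution (fun a _ => a.swap) (fun a _ => ?_) (fun a _ ha h => ?_)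
    (fun a ha => ?_) (fun a _ => ?_)
  · rw [h1 a.1 a.2]
    exact neg_add_cancel _
  · apply ha
    have : a.2 = a.1 := congrArg Prod.fst h
    rw [this, h0]
  · rw [Finset.mem_product] at ha ⊢
    exact ha.symm
  · exact Prod.swap_swap a

/-- Since the h's anticommute, the variables already adjoined contribute nothing, so `h j` remains a
null-homotopy of `g j` for the enlarged differential. This is what lets `exists_seriesD_eq` be
iterated. -/
theorem polyD_compLeft_add {J : Finset Y} {d : N →ₗ[k] N} {g h : Y → N →ₗ[k] N}
    (hdh : ∀ j x, d (h j x) + h j (d x) = g j x)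
    (hhh' : ∀ i j x, h i (h j x) = -h j (h i x)) (j : Y) (x : (Y → ℕ) → N) :
    polyD J d h ((h j).compLeft (Y → ℕ) x) + (h j).compLeft (Y → ℕ) (polyD J d h x) =
      (g j).compLeft (Y → ℕ) x := by
  funext α
  simp only [Pi.add_apply, LinearMap.compLeft_apply, Function.comp_apply, polyD_apply, map_add,
    map_sum, ← hdh]
  have : ∀ i ∈ J, (if α i = 0 then 0 else h i (h j (x (α - Pi.single i 1)))) =
      -h j (if α i = 0 then 0 else h i (x (α - Pi.single i 1))) := fun i _ => by
    split_ifs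
    · simp
    · exact hhh' i j _
  rw [Finset.sum_congr rfl this, Finset.sum_neg_distrib]
  abel

theorem polyD_compLeft_comm {J : Finset Y} {d : N →ₗ[k] N} {h : Y → N →ₗ[k] N} {f : N →ₗ[k] N}
    (hfd : ∀ x, f (d x) = d (f x)) (hfh : ∀ j x, f (h j x) = h j (f x)) (x : (Y → ℕ) → N) :
    f.compLeft (Y → ℕ) (polyD J d h x) = polyD J d h (f.compLeft (Y → ℕ) x) := by
  funext α
  simp only [LinearMap.compLeft_apply, Function.comp_apply, polyD_apply, map_add, map_sum, hfd]
  congr 1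
  refine Finset.sum_congr rfl fun j _ => ?_
  split_ifs <;> simp [hfh]

variable [Fintype Y]

/-- The power series of degree `n` in the variables from `J`, with coefficients killed by the
operators `g j`, `j ∈ J`. -/
def polyGrade (J : Finset Y) (L : ℤ → Submodule k N) (g : Y → N →ₗ[k] N) (n : ℤ) :
    Submodule k ((Y → ℕ) → N) where
  carrier := {x | ∀ α, x α ∈ L (n - 2 * ∑ i, (α i : ℤ)) ∧ (∀ i ∈ J, g i (x α) = 0) ∧
    ∀ i ∉ J, α i ≠ 0 → x α = 0}
  add_mem' := by
    intro x y hx hy α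
    obtain ⟨hx1, hx2, hx3⟩ := hx α
    obtain ⟨hy1, hy2, hy3⟩ := hy α
    rw [Pi.add_apply]
    exact ⟨add_mem hx1 hy1, fun i hi => by rw [map_add, hx2 i hi, hy2 i hi, add_zero],
      fun i hi h => by rw [hx3 i hi h, hy3 i hi h, add_zero]⟩
  zero_mem' := fun α => ⟨zero_mem _, fun i _ => map_zero (g i), fun _ _ _ => rfl⟩
  smul_mem' := by
    intro c x hx α
    obtain ⟨hx1, hx2, hx3⟩ := hx α
    rw [Pi.smul_apply]
    exact ⟨Submodule.smul_mem _ c hx1, fun i hi => by rw [map_smul, hx2 i hi, smul_zero],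
      fun i hi h => by rw [hx3 i hi h, smul_zero]⟩

theorem mem_polyGrade {Y : Type*} [Fintype Y] {J : Finset Y} {L : ℤ → Submodule k N} {g : Y → N →ₗ[k] N} {n : ℤ}
    {x : (Y → ℕ) → N} : x ∈ polyGrade J L g n ↔ ∀ α, x α ∈ L (n - 2 * ∑ i, (α i : ℤ)) ∧
      (∀ i ∈ J, g i (x α) = 0) ∧ ∀ i ∉ J, α i ≠ 0 → x α = 0 := Iff.rfl

theorem sum_sub_single {α : Y → ℕ} {j : Y} (hj : α j ≠ 0) :
    ∑ i, ((α - Pi.single j 1 : Y → ℕ) i : ℤ) = ∑ i, (α i : ℤ) - 1 := by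
  have h1 : ∀ i, ((α - Pi.single j 1 : Y → ℕ) i : ℤ) = α i - (if i = j then 1 else 0) := fun i => by
    by_cases h : i = j
    · subst h
      rw [Pi.sub_apply, Pi.single_eq_same, if_pos rfl]
      omega
    · rw [Pi.sub_apply, Pi.single_eq_of_ne h, if_neg h]
      simp
  rw [Finset.sum_congr rfl fun i _ => h1 i]
  simp

theorem sum_update {α : Y → ℕ} {j : Y} (m : ℕ) :
    ∑ i, (Function.update α j m i : ℤ) = ∑ i, (α i : ℤ) - α j + m := by
  have h1 : ∀ i, (Function.update α j m i : ℤ) = α i + (if i = j then (m : ℤ) - α j else 0) :=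
    fun i => by
      by_cases h : i = j
      · subst h; simp
      · simp [h]
  simp only [h1, Finset.sum_add_distrib, Finset.sum_ite_eq', Finset.mem_univ, if_true]
  ring

theorem polyD_mem {J : Finset Y} {L : ℤ → Submodule k N} {d : N →ₗ[k] N} {g h : Y → N →ₗ[k] N}
    (hd : ∀ n, ∀ x ∈ L n, d x ∈ L (n + 1)) (hh : ∀ j n, ∀ x ∈ L n, h j x ∈ L (n - 1))
    (hgd : ∀ j x, g j (d x) = d (g j x)) (hgh : ∀ i j x, g i (h j x) = h j (g i x))
    {n : ℤ} {x : (Y → ℕ) → N} (hx : x ∈ polyGrade J L g n) :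
    polyD J d h x ∈ polyGrade J L g (n + 1) := by
  rw [mem_polyGrade] at hx ⊢
  intro α
  rw [polyD_apply]
  refine ⟨Submodule.add_mem _ ?_ (Submodule.sum_mem _ fun j _ => ?_), fun i hi => ?_,
    fun i hi hα => ?_⟩
  · have := hd _ _ (hx α).1
    convert this using 2
    ring
  · split_ifs with hj
    · exact Submodule.zero_mem _
    · have := hh j _ _ (hx (α - Pi.single j 1)).1
      rw [sum_sub_single hj] at this
      convert this using 2
      ring
  · rw [map_add, hgd, (hx α).2.1 i hi, map_zero, zero_add, map_sum]
    refine Finset.sum_eq_zero fun j _ => ?_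
    split_ifs
    · exact map_zero _
    · rw [hgh, (hx _).2.1 i hi, map_zero]
  · rw [(hx α).2.2 i hi hα, map_zero, zero_add]
    refine Finset.sum_eq_zero fun j hj => ?_
    split_ifs
    · rfl
    · rw [(hx _).2.2 i hi, map_zero]
      rw [Pi.sub_apply, Pi.single_eq_of_ne (by rintro rfl; exact hi hj)]
      simpa using hα

/-- The square of d + ∑ v_j h_j is ∑ v_j g_j, which vanishes on coefficients in the kernels of the
`g j`; that condition is part of `polyGrade`. -/
theorem polyD_polyD {J : Finset Y} {L : ℤ → Submodule k N} {d : N →ₗ[k] N} {g h : Y → N →ₗ[k] N}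
    (hdd : ∀ n, ∀ x ∈ L n, d (d x) = 0) (hdh : ∀ j x, d (h j x) + h j (d x) = g j x)
    (hhh : ∀ j x, h j (h j x) = 0) (hhh' : ∀ i j x, h i (h j x) = -h j (h i x))
    {n : ℤ} {x : (Y → ℕ) → N} (hx : x ∈ polyGrade J L g n) :
    polyD J d h (polyD J d h x) = 0 := by
  rw [mem_polyGrade] at hx
  have e1 : d.compLeft (Y → ℕ) (d.compLeft (Y → ℕ) x) = 0 := funext fun α => hdd _ _ (hx α).1
  have e2 : ∀ j ∈ J, d.compLeft (Y → ℕ) ((h j).compLeft (Y → ℕ) (varMul k j x)) +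
      (h j).compLeft (Y → ℕ) (varMul k j (d.compLeft (Y → ℕ) x)) = 0 := fun j hj => by
    rw [varMul_compLeft]
    funext α
    simp only [Pi.add_apply, LinearMap.compLeft_apply, Function.comp_apply, hdh, varMul_apply]
    split_ifs
    · exact map_zero _
    · exact (hx _).2.1 j hj
  have e3 : ∑ i ∈ J, ∑ j ∈ J, (h i).compLeft (Y → ℕ) (varMul k i
      ((h j).compLeft (Y → ℕ) (varMul k j x))) = 0 := by
    refine sum_sum_eq_zero_of_antisymm J _ (fun i => ?_) (fun i j => ?_)
    · rw [varMul_compLeft]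
      funext α
      exact hhh i _
    · rw [varMul_compLeft, varMul_compLeft, varMul_comm]
      funext α
      exact hhh' i j _
  simp only [polyD, LinearMap.add_apply, LinearMap.sum_apply, map_add, map_sum,
    LinearMap.comp_apply]
  rw [e1, zero_add, Finset.sum_add_distrib, ← add_assoc, ← Finset.sum_add_distrib,
    Finset.sum_eq_zero fun j hj => (add_comm _ _).trans (e2 j hj), zero_add, Finset.sum_comm]
  exact e3

/-- Adjoining several variables of degree two, see `exists_seriesD_eq`. -/
theorem exists_polyD_eq {L : ℤ → Submodule k N} (hneg : ∀ n < 0, L n = ⊥) {d : N →ₗ[k] N}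
    {g h : Y → N →ₗ[k] N} (hd : ∀ n, ∀ x ∈ L n, d x ∈ L (n + 1))
    (hh : ∀ j n, ∀ x ∈ L n, h j x ∈ L (n - 1)) (hg : ∀ j n, ∀ x ∈ L n, g j x ∈ L n)
    (hdd : ∀ n, ∀ x ∈ L n, d (d x) = 0) (hdh : ∀ j x, d (h j x) + h j (d x) = g j x)
    (hgd : ∀ j x, g j (d x) = d (g j x)) (hgh : ∀ i j x, g i (h j x) = h j (g i x))
    (hgg : ∀ i j x, g i (g j x) = g j (g i x))
    (hhh : ∀ j x, h j (h j x) = 0) (hhh' : ∀ i j x, h i (h j x) = -h j (h i x))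
    (hex : ∀ n, n ≠ 0 → ∀ x ∈ L n, d x = 0 → ∃ y ∈ L (n - 1), d y = x)
    (hsurj : ∀ (J : Finset Y), ∀ j ∉ J, ∀ n, ∀ x ∈ L n, (∀ i ∈ J, g i x = 0) →
      ∃ y ∈ L n, (∀ i ∈ J, g i y = 0) ∧ g j y = x) (J : Finset Y) :
    ∀ n, n ≠ 0 → ∀ x ∈ polyGrade J L g n, polyD J d h x = 0 →
      ∃ y ∈ polyGrade J L g (n - 1), polyD J d h y = x := by
  induction J using Finset.induction_on with
  | empty =>
    intro n hn x hx hDx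
    rw [mem_polyGrade] at hx
    have hsupp : ∀ α, α ≠ 0 → x α = 0 := fun α hα => by
      obtain ⟨i, hi⟩ := Function.ne_iff.1 hα
      exact (hx α).2.2 i (by simp) hi
    obtain ⟨y, hy, hdy⟩ := hex n hn (x 0) (by simpa using (hx 0).1)
      (by simpa [polyD_apply] using congrFun hDx 0)
    refine ⟨Pi.single 0 y, mem_polyGrade.2 fun α => ?_, ?_⟩
    · by_cases hα : α = 0
      · subst hα
        refine ⟨by simpa using hy, by simp, fun i _ h => absurd rfl h⟩
      · rw [Pi.single_eq_of_ne hα]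
        exact ⟨zero_mem _, by simp, by simp⟩
    · funext α
      rw [polyD_apply, Finset.sum_empty, add_zero]
      by_cases hα : α = 0
      · subst hα
        rw [Pi.single_eq_same, hdy]
      · rw [Pi.single_eq_of_ne hα, map_zero, hsupp α hα]
  | insert j J hj ih =>
    intro n hn x hx hDx
    rw [mem_polyGrade] at hx
    have hne : ∀ {i}, i ∈ J → i ≠ j := fun hi h => hj (h ▸ hi)
    -- The expansion of x in powers of v_j: `xs m` is the coefficient of v_j^m, a series in the
    -- variables from `J`.
    let xs : ℕ → (Y → ℕ) → N := fun m α => if α j = 0 then x (Function.update α j m) else 0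
    have hsub : ∀ (α : Y → ℕ) (m : ℕ) {i}, i ∈ J →
        Function.update α j m - Pi.single i 1 = Function.update (α - Pi.single i 1) j m := by
      intro α m i hi
      funext l
      by_cases hl : l = j
      · subst hl
        simp [Pi.single_eq_of_ne (hne hi).symm]
      · simp [hl]
    have hsubj : ∀ (α : Y → ℕ) {i}, i ∈ J → (α - Pi.single i 1 : Y → ℕ) j = α j := by
      intro α i hi
      simp [Pi.single_eq_of_ne (hne hi).symm]
    have key := exists_seriesD_eq (polyGrade J L g) (fun m hm => ?_)
      (polyD J d h) ((g j).compLeft (Y → ℕ)) ((h j).compLeft (Y → ℕ))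
      (fun m x hx => polyD_mem hd hh hgd hgh hx) (fun m z hz => ?_) (fun m z hz => ?_)
      (fun m x hx => polyD_polyD hdd hdh hhh hhh' hx) (fun z => polyD_compLeft_add hdh hhh' j z)
      (fun z => polyD_compLeft_comm (hgd j) (hgh j) z) (fun z => funext fun α => hgh j j _)
      (fun z => funext fun α => hhh j _) ih (fun m z hz => ?_) hn xs (fun m => ?_) (fun m => ?_) ?_
    · obtain ⟨ys, hys, hgys, hDys⟩ := key
      let y : (Y → ℕ) → N := fun α => ys (α j) (Function.update α j 0)
      refine ⟨y, mem_polyGrade.2 fun α => ?_, ?_⟩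
      · obtain ⟨h1, h2, h3⟩ := mem_polyGrade.1 (hys (α j)) (Function.update α j 0)
        refine ⟨?_, fun i hi => ?_, fun i hi hα => ?_⟩
        · rw [sum_update] at h1
          convert h1 using 2
          push_cast
          ring
        · rcases Finset.mem_insert.1 hi with rfl | hi
          · exact congrFun (hgys (α i)) _
          · exact h2 i hi
        · rw [Finset.mem_insert, not_or] at hi
          refine h3 i hi.2 ?_
          rwa [Function.update_of_ne hi.1]
      · funext α
        have h1 := congrFun (congrFun hDys (α j)) (Function.update α j 0)
        have h2 : xs (α j) (Function.update α j 0) = x α := by simp [xs]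
        rw [h2] at h1
        rw [← h1, polyD_apply, Finset.sum_insert hj]
        have h3 : ∀ i ∈ J, (if α i = 0 then 0 else h i (y (α - Pi.single i 1))) =
            if Function.update α j 0 i = 0 then 0 else
              h i (ys (α j) (Function.update α j 0 - Pi.single i 1)) := fun i hi => by
          rw [Function.update_of_ne (hne hi)]
          simp only [y, hsubj α hi, hsub α 0 hi]
        rw [Finset.sum_congr rfl h3]
        cases hα : α j with
        | zero =>
          rw [seriesD_zero, polyD_apply, if_pos rfl, zero_add]
          simp only [y, hα]
        | succ m =>
          rw [seriesD_succ, Pi.add_apply, polyD_apply, if_neg (Nat.succ_ne_zero m)]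
          have h4 : y (α - Pi.single j 1) = ys m (Function.update α j 0) := by
            have : Function.update (α - Pi.single j 1) j 0 = Function.update α j 0 := by
              funext l
              by_cases hl : l = j
              · subst hl; simp
              · simp [hl]
            simp [y, hα, this]
          simp only [LinearMap.compLeft_apply, Function.comp_apply]
          rw [h4]
          simp only [y, hα]
          abel
    · refine eq_bot_iff.2 fun z hz => ?_
      rw [mem_polyGrade] at hz
      refine funext fun α => ?_
      have h1 := (hz α).1
      rw [hneg _ ?_] at h1
      · exact h1
      · have : 0 ≤ ∑ i, (α i : ℤ) := Finset.sum_nonneg fun i _ => Int.natCast_nonneg _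
        omega
    · refine mem_polyGrade.2 fun α => ?_
      obtain ⟨h1, h2, h3⟩ := mem_polyGrade.1 hz α
      refine ⟨?_, fun i hi => ?_, fun i hi hα => ?_⟩
      · have := hh j _ _ h1
        rw [show m - 1 - 2 * ∑ i, (α i : ℤ) = m - 2 * ∑ i, (α i : ℤ) - 1 by ring]
        exact this
      · change g i (h j (z α)) = 0
        rw [hgh, h2 i hi, map_zero]
      · change h j (z α) = 0
        rw [h3 i hi hα, map_zero]
    · refine mem_polyGrade.2 fun α => ?_
      obtain ⟨h1, h2, h3⟩ := mem_polyGrade.1 hz α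
      refine ⟨hg j _ _ h1, fun i hi => ?_, fun i hi hα => ?_⟩
      · change g i (g j (z α)) = 0
        rw [hgg, h2 i hi, map_zero]
      · change g j (z α) = 0
        rw [h3 i hi hα, map_zero]
    · rw [mem_polyGrade] at hz
      -- The preimage of 0 is required to be 0 so that choosing coefficientwise preimages preserves
      -- the support condition.
      have hc : ∀ α, ∃ y ∈ L (m - 2 * ∑ i, (α i : ℤ)), (∀ i ∈ J, g i y = 0) ∧ g j y = z α ∧
          (z α = 0 → y = 0) := fun α => by
        by_cases hα : z α = 0
        · exact ⟨0, zero_mem _, by simp, by simp [hα], fun _ => rfl⟩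
        · obtain ⟨y, hy, hy1, hy2⟩ := hsurj J j hj _ _ (hz α).1 (hz α).2.1
          exact ⟨y, hy, hy1, hy2, fun h => absurd h hα⟩
      choose y hy1 hy2 hy3 hy4 using hc
      exact ⟨y, mem_polyGrade.2 fun α =>
        ⟨hy1 α, hy2 α, fun i hi hα => hy4 α ((hz α).2.2 i hi hα)⟩, funext hy3⟩
    · refine mem_polyGrade.2 fun α => ?_
      simp only [xs]
      split_ifs with hα
      · obtain ⟨h1, h2, h3⟩ := hx (Function.update α j m)
        refine ⟨?_, fun i hi => h2 i (Finset.mem_insert_of_mem hi), fun i hi hαi => ?_⟩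
        · rw [sum_update, hα] at h1
          convert h1 using 2
          push_cast
          ring
        · have hij : i ≠ j := fun h => hαi (h ▸ hα)
          exact h3 i (by simp [hij, hi]) (by rwa [Function.update_of_ne hij])
      · exact ⟨zero_mem _, by simp, by simp⟩
    · funext α
      change g j (xs m α) = 0
      simp only [xs]
      split_ifs
      · exact (hx _).2.1 j (Finset.mem_insert_self _ _)
      · exact map_zero _
    · funext m α
      by_cases hα : α j = 0
      · have h1 := congrFun hDx (Function.update α j m)
        rw [polyD_apply, Finset.sum_insert hj] at h1
        have h2 : ∀ i ∈ J, (if Function.update α j m i = 0 then 0 else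
            h i (x (Function.update α j m - Pi.single i 1))) =
            if α i = 0 then 0 else h i (xs m (α - Pi.single i 1)) := fun i hi => by
          rw [Function.update_of_ne (hne hi), hsub α m hi]
          simp only [xs, hsubj α hi, hα, if_true]
        rw [Finset.sum_congr rfl h2, Function.update_self] at h1
        have h3 : xs m α = x (Function.update α j m) := by simp [xs, hα]
        rw [← h3] at h1
        cases m with
        | zero =>
          rw [seriesD_zero, polyD_apply]
          rwa [if_pos rfl, zero_add] at h1
        | succ m =>
          have h4 : x (Function.update α j (m + 1) - Pi.single j 1) = xs m α := by
            have : Function.update α j (m + 1) - Pi.single j 1 = Function.update α j m := by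
              funext l
              by_cases hl : l = j
              · subst hl; simp
              · simp [hl]
            simp [xs, hα, this]
          rw [if_neg (Nat.succ_ne_zero m), h4] at h1
          rw [seriesD_succ, Pi.add_apply, polyD_apply]
          refine Eq.trans ?_ h1
          change _ + h j (xs m α) = _
          abel
      · have h0 : ∀ m, xs m α = 0 := fun m => by simp [xs, hα]
        have h1 : polyD J d h (xs m) α = 0 := by
          rw [polyD_apply, h0, map_zero, zero_add]
          refine Finset.sum_eq_zero fun i hi => ?_
          have : xs m (α - Pi.single i 1) = 0 := by
            simp only [xs, hsubj α hi, hα, if_false]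
          rw [this, map_zero, ite_self]
        cases m with
        | zero => rw [seriesD_zero, h1]; rfl
        | succ m =>
          rw [seriesD_succ, Pi.add_apply, h1, zero_add]
          change h j (xs m α) = 0
          rw [h0, map_zero]

end Polynomials

/-! ### Translation operators on functions and the solution of difference equations -/

section Translation

/-- Partial sums from 0 in both directions. -/
theorem exists_int_sub_eq {M : Type*} [AddCommGroup M] (U : AddSubgroup M) (u : ℤ → M)
    (hu : ∀ n, u n ∈ U) : ∃ S : ℤ → M, (∀ n, S n ∈ U) ∧ ∀ n, S (n + 1) - S n = u n := by
  refine ⟨fun n => match n with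
    | Int.ofNat n => ∑ i ∈ Finset.range n, u i
    | Int.negSucc n => -∑ i ∈ Finset.range (n + 1), u (-(i : ℤ) - 1), fun n => ?_, fun n => ?_⟩
  · cases n with
    | ofNat n => exact AddSubgroup.sum_mem _ fun i _ => hu _
    | negSucc n => exact AddSubgroup.neg_mem _ (AddSubgroup.sum_mem _ fun i _ => hu _)
  · match n with
    | Int.ofNat n =>
      change ∑ i ∈ Finset.range (n + 1), u i - ∑ i ∈ Finset.range n, u i = u n
      rw [Finset.sum_range_succ]
      abel
    | Int.negSucc 0 =>
      change ∑ i ∈ Finset.range 0, u i - -∑ i ∈ Finset.range 1, u (-(i : ℤ) - 1) = u (-1)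
      simp
    | Int.negSucc (n + 1) =>
      change -∑ i ∈ Finset.range (n + 1), u (-(i : ℤ) - 1) -
        -∑ i ∈ Finset.range (n + 2), u (-(i : ℤ) - 1) = _
      rw [Finset.sum_range_succ _ (n + 1), Int.negSucc_eq,
        show -(((n + 1 : ℕ) : ℤ) + 1) = -((n + 1 : ℕ) : ℤ) - 1 by ring]
      abel

/-- If `m` has infinite order modulo the subgroup `H`, then every `H`-invariant function is a
difference `F (b + m) - F b` of an `H`-invariant function. -/
theorem exists_translate_sub_eq {B M : Type*} [AddCommGroup B] [AddCommGroup M]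
    (H : AddSubgroup B) (m : B) (hm : ∀ n : ℤ, n • m ∈ H → n = 0) (U : AddSubgroup M)
    (f : B → M) (hfH : ∀ h ∈ H, ∀ b, f (b + h) = f b) (hfU : ∀ b, f b ∈ U) :
    ∃ F : B → M, (∀ h ∈ H, ∀ b, F (b + h) = F b) ∧ (∀ b, F b ∈ U) ∧
      ∀ b, F (b + m) - F b = f b := by
  let H' : AddSubgroup B := H ⊔ AddSubgroup.zmultiples m
  -- Modulo `H` each coset of H + ℤm is a copy of ℤ with base point `r b`; the position `ν b` is
  -- unique because m has infinite order modulo `H`. The equation is solved separately on each copy.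
  let r : B → B := fun b => (QuotientAddGroup.mk b : B ⧸ H').out
  have hr : ∀ b b', b' - b ∈ H' → r b' = r b := fun b b' h => by
    have : (QuotientAddGroup.mk b' : B ⧸ H') = QuotientAddGroup.mk b := by
      rw [eq_comm, QuotientAddGroup.eq]
      rwa [neg_add_eq_sub]
    simp only [r, this]
  have hν : ∀ b, ∃ n : ℤ, b - r b - n • m ∈ H := fun b => by
    have h1 : b - r b ∈ H' := by
      have : (QuotientAddGroup.mk (r b) : B ⧸ H') = QuotientAddGroup.mk b := Quotient.out_eq' _
      rw [QuotientAddGroup.eq] at this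
      rwa [neg_add_eq_sub] at this
    obtain ⟨h, hh, z, hz, hhz⟩ := AddSubgroup.mem_sup.1 h1
    obtain ⟨n, rfl⟩ := AddSubgroup.mem_zmultiples_iff.1 hz
    exact ⟨n, by rw [← hhz]; simpa using hh⟩
  choose ν hν using hν
  have huniq : ∀ b n, b - r b - n • m ∈ H → n = ν b := fun b n h => by
    have h1 := H.sub_mem (hν b) h
    have h2 : b - r b - ν b • m - (b - r b - n • m) = (n - ν b) • m := by
      rw [sub_smul]; abel
    rw [h2] at h1
    exact sub_eq_zero.1 (hm _ h1)
  have hS := fun c : B => exists_int_sub_eq U (fun n => f (c + n • m)) fun n => hfU _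
  choose S hSU hS using hS
  refine ⟨fun b => S (r b) (ν b), fun h hh b => ?_, fun b => hSU _ _, fun b => ?_⟩
  · have h1 : r (b + h) = r b := hr _ _ (by
      rw [add_sub_cancel_left]; exact AddSubgroup.mem_sup_left hh)
    have h2 : ν (b + h) = ν b := huniq _ _ (by
      have := H.add_mem (hν (b + h)) (H.neg_mem hh)
      rw [h1] at this
      convert this using 1
      abel)
    simp only [h1, h2]
  · have h1 : r (b + m) = r b := hr _ _ (by
      rw [add_sub_cancel_left]
      exact AddSubgroup.mem_sup_right (AddSubgroup.mem_zmultiples m))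
    have h2 : ν (b + m) = ν b + 1 := (huniq _ _ (by
      have := hν b
      rw [h1]
      convert this using 1
      rw [add_smul, one_smul]
      abel)).symm
    simp only [h1, h2, hS]
    have := hfH _ (hν b) (r b + ν b • m)
    rw [← this]
    congr 1
    abel

variable (p : ℕ)

/-- The group ring `ℤ[ℤ/p]`. -/
abbrev CycRing : Type := AddMonoidAlgebra ℤ (ZMod p)

/-- The algebra over `𝔽_p` of the additive group of `ℤ[ℤ/p]`. -/
abbrev TransAlg : Type := AddMonoidAlgebra (ZMod p) (CycRing p)

variable {p}

/-- The basis element of `ℤ[ℤ/p]` indexed by `i`. -/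
abbrev gen (i : ZMod p) : CycRing p := AddMonoidAlgebra.single i 1

/-- The basis element of `TransAlg p` indexed by `u`. -/
abbrev mon (u : CycRing p) : TransAlg p := AddMonoidAlgebra.single u 1

variable {B : Type*} [AddCommGroup B] (β : CycRing p →+ B)

/-- The action of `TransAlg p` by translations on functions on a quotient of `ℤ[ℤ/p]`. -/
def translate : TransAlg p →ₐ[ZMod p] Module.End (ZMod p) (B → Lam p) :=
  AddMonoidAlgebra.lift (ZMod p) _ (CycRing p)
    { toFun := fun u => LinearMap.funLeft (ZMod p) (Lam p) fun b => b + β u.toAdd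
      map_one' := by
        ext x b
        simp
      map_mul' := fun u v => by
        ext x b
        simp [add_assoc, add_comm (β u.toAdd)] }

theorem translate_mon (u : CycRing p) (x : B → Lam p) (b : B) :
    translate β (mon u) x b = x (b + β u) := by
  simp [translate, mon]

/-- The operator on functions combining a translation operator and an operator on values. -/
def valOp (F : Lam p →ₗ[ZMod p] Lam p) (s : TransAlg p) : (B → Lam p) →ₗ[ZMod p] (B → Lam p) :=
  F.compLeft B ∘ₗ translate β s

theorem translate_compLeft (F : Lam p →ₗ[ZMod p] Lam p) (s : TransAlg p) (x : B → Lam p) :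
    translate β s (F.compLeft B x) = F.compLeft B (translate β s x) := by
  induction s using AddMonoidAlgebra.induction_linear with
  | zero => simp
  | add s t hs ht => simp only [map_add, LinearMap.add_apply, hs, ht]
  | single u c =>
    have : (AddMonoidAlgebra.single u c : TransAlg p) = c • mon u := by simp [mon]
    rw [this]
    simp only [map_smul, LinearMap.smul_apply]
    congr 1
    funext b
    simp only [translate_mon, LinearMap.compLeft_apply, Function.comp_apply]

theorem valOp_valOp (F F' : Lam p →ₗ[ZMod p] Lam p) (s s' : TransAlg p) (x : B → Lam p) :
    valOp β F s (valOp β F' s' x) = valOp β (F ∘ₗ F') (s * s') x := by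
  simp only [valOp, LinearMap.comp_apply, translate_compLeft, map_mul, Module.End.mul_apply]
  rfl

/-- The functions with values in forms of degree `n`. -/
def funGrade (B : Type*) (n : ℤ) : Submodule (ZMod p) (B → Lam p) where
  carrier := {x | ∀ b, x b ∈ gradeLam p n}
  add_mem' hx hy b := add_mem (hx b) (hy b)
  zero_mem' _ := zero_mem _
  smul_mem' c _ hx b := Submodule.smul_mem _ c (hx b)

theorem translate_mem {n : ℤ} {x : B → Lam p} (hx : x ∈ funGrade B n) (s : TransAlg p) :
    translate β s x ∈ funGrade B n := by
  induction s using AddMonoidAlgebra.induction_linear with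
  | zero => simp
  | add s t hs ht =>
    rw [map_add]
    exact add_mem hs ht
  | single u c =>
    have : (AddMonoidAlgebra.single u c : TransAlg p) = c • mon u := by simp [mon]
    rw [this, map_smul]
    refine Submodule.smul_mem _ _ fun b => ?_
    rw [translate_mon]
    exact hx _

end Translation

/-! ### Exactness of the Koszul complex of functions on ℤ[ℤ/p] -/

section Koszul

theorem funGrade_of_neg {p : ℕ} {B : Type*} {n : ℤ} (hn : n < 0) :
    (funGrade B n : Submodule (ZMod p) (B → Lam p)) = ⊥ := by
  refine eq_bot_iff.2 fun x hx => funext fun b => ?_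
  have := hx b
  rwa [gradeLam_of_neg hn] at this

variable {p : ℕ} [Fact p.Prime] {B : Type*} [AddCommGroup B] (β : CycRing p →+ B)

/-- The Koszul differential `∑ i ∈ J, y_i (x_i - 1)` on forms with function coefficients. -/
def koszulD (J : Finset (ZMod p)) : (B → Lam p) →ₗ[ZMod p] (B → Lam p) :=
  ∑ i ∈ J, valOp β (wedge i) (mon (gen i) - 1)

/-- The contraction with the one-form with coefficients `c`. -/
def contractForm (c : ZMod p → TransAlg p) : (B → Lam p) →ₗ[ZMod p] (B → Lam p) :=
  ∑ i, valOp β (contract i) (c i)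

theorem valOp_add_valOp {F F' : Lam p →ₗ[ZMod p] Lam p} {c : ZMod p}
    (h : ∀ x, F (F' x) + F' (F x) = c • x) (s s' : TransAlg p) (x : B → Lam p) :
    valOp β F s (valOp β F' s' x) + valOp β F' s' (valOp β F s x) =
      c • translate β (s * s') x := by
  rw [valOp_valOp, valOp_valOp, mul_comm s' s]
  funext b
  exact h _

theorem valOp_valOp_eq_neg {F F' : Lam p →ₗ[ZMod p] Lam p} (h : ∀ x, F (F' x) = -F' (F x))
    (s s' : TransAlg p) (x : B → Lam p) :
    valOp β F s (valOp β F' s' x) = -valOp β F' s' (valOp β F s x) := by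
  rw [valOp_valOp, valOp_valOp, mul_comm s' s]
  funext b
  exact h _

theorem valOp_valOp_self {F : Lam p →ₗ[ZMod p] Lam p} (h : ∀ x, F (F x) = 0)
    (s s' : TransAlg p) (x : B → Lam p) : valOp β F s (valOp β F s' x) = 0 := by
  rw [valOp_valOp]
  funext b
  exact h _

theorem koszulD_koszulD (J : Finset (ZMod p)) (x : B → Lam p) :
    koszulD β J (koszulD β J x) = 0 := by
  simp only [koszulD, LinearMap.sum_apply, map_sum]
  rw [Finset.sum_comm]
  exact sum_sum_eq_zero_of_antisymm J _
    (fun i => valOp_valOp_self β (fun x => wedge_wedge_self i x) _ _ _)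
    (fun i j => valOp_valOp_eq_neg β (fun x => wedge_wedge i j x) _ _ _)

theorem contractForm_comm (c c' : ZMod p → TransAlg p) (x : B → Lam p) :
    contractForm β c (contractForm β c' x) = -contractForm β c' (contractForm β c x) := by
  simp only [contractForm, LinearMap.sum_apply, map_sum, ← Finset.sum_neg_distrib]
  rw [Finset.sum_comm]
  refine Finset.sum_congr rfl fun i _ => Finset.sum_congr rfl fun j _ => ?_
  exact valOp_valOp_eq_neg β (fun x => contract_contract _ _ x) _ _ _

theorem contractForm_self (c : ZMod p → TransAlg p) (x : B → Lam p) :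
    contractForm β c (contractForm β c x) = 0 := by
  simp only [contractForm, LinearMap.sum_apply, map_sum]
  refine sum_sum_eq_zero_of_antisymm Finset.univ _ (fun i => ?_) (fun i j => ?_)
  · exact valOp_valOp_self β (fun x => contract_contract_self i x) _ _ _
  · rw [valOp_valOp, valOp_valOp, mul_comm (c i)]
    funext b
    exact contract_contract _ _ _

theorem wedge_contract_add_smul (i j : ZMod p) (x : Lam p) :
    wedge i (contract j x) + contract j (wedge i x) = (if i = j then (1 : ZMod p) else 0) • x := by
  rw [wedge_contract_add]
  split_ifs <;> simp

/-- Cartan's formula. For the coefficients of `exists_coeffs` the right side is translation by a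
relation minus one, so each relation is null-homotopic. -/
theorem koszulD_contractForm_add (c : ZMod p → TransAlg p) (x : B → Lam p) :
    koszulD β Finset.univ (contractForm β c x) + contractForm β c (koszulD β Finset.univ x) =
      translate β (∑ i, c i * (mon (gen i) - 1)) x := by
  simp only [koszulD, contractForm, LinearMap.sum_apply, map_sum]
  rw [Finset.sum_comm, ← Finset.sum_add_distrib]
  refine Finset.sum_congr rfl fun i _ => ?_
  rw [← Finset.sum_add_distrib, Finset.sum_eq_single i]
  · rw [valOp_add_valOp β (wedge_contract_add_smul i i), if_pos rfl, one_smul, mul_comm]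
  · intro j _ hj
    rw [valOp_add_valOp β (wedge_contract_add_smul i j), if_neg hj.symm, zero_smul]
  · simp

theorem contract_koszulD_add (J : Finset (ZMod p)) (i : ZMod p) (x : B → Lam p) :
    (contract i).compLeft B (koszulD β J x) + koszulD β J ((contract i).compLeft B x) =
      if i ∈ J then translate β (mon (gen i) - 1) x else 0 := by
  have h1 : ∀ y : B → Lam p, (contract i).compLeft B y = valOp β (contract i) 1 y := fun y => by
    simp [valOp]
  simp only [h1, koszulD, LinearMap.sum_apply, map_sum]
  rw [← Finset.sum_add_distrib]
  have h2 : ∀ j ∈ J, valOp β (contract i) 1 (valOp β (wedge j) (mon (gen j) - 1) x) +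
      valOp β (wedge j) (mon (gen j) - 1) (valOp β (contract i) 1 x) =
      if i = j then translate β (mon (gen i) - 1) x else 0 := fun j _ => by
    rw [add_comm, valOp_add_valOp β (wedge_contract_add_smul j i), mul_one]
    by_cases h : i = j
    · subst h; simp
    · simp [h, Ne.symm h]
  rw [Finset.sum_congr rfl h2, Finset.sum_ite_eq]

theorem koszulD_mem {J : Finset (ZMod p)} {n : ℤ} {x : B → Lam p} (hx : x ∈ funGrade B n) :
    koszulD β J x ∈ funGrade B (n + 1) := by
  rw [koszulD, LinearMap.sum_apply]
  exact Submodule.sum_mem _ fun i _ b => wedge_mem (translate_mem β hx _ b)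

theorem contractForm_mem {c : ZMod p → TransAlg p} {n : ℤ} {x : B → Lam p}
    (hx : x ∈ funGrade B n) : contractForm β c x ∈ funGrade B (n - 1) := by
  rw [contractForm, LinearMap.sum_apply]
  exact Submodule.sum_mem _ fun i _ b => contract_mem (translate_mem β hx _ b)

theorem translate_translate_comm (s t : TransAlg p) (x : B → Lam p) :
    translate β s (translate β t x) = translate β t (translate β s x) := by
  rw [← Module.End.mul_apply, ← map_mul, mul_comm, map_mul, Module.End.mul_apply]

theorem translate_koszulD (s : TransAlg p) (J : Finset (ZMod p)) (x : B → Lam p) :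
    translate β s (koszulD β J x) = koszulD β J (translate β s x) := by
  rw [koszulD, LinearMap.sum_apply, map_sum, LinearMap.sum_apply]
  refine Finset.sum_congr rfl fun i _ => ?_
  rw [valOp, LinearMap.comp_apply, translate_compLeft, translate_translate_comm, LinearMap.comp_apply]

theorem translate_contractForm (s : TransAlg p) (c : ZMod p → TransAlg p) (x : B → Lam p) :
    translate β s (contractForm β c x) = contractForm β c (translate β s x) := by
  rw [contractForm, LinearMap.sum_apply, map_sum, LinearMap.sum_apply]
  refine Finset.sum_congr rfl fun i _ => ?_
  rw [valOp, LinearMap.comp_apply, translate_compLeft, translate_translate_comm, LinearMap.comp_apply]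

theorem translate_mon_sub_one_apply (u : CycRing p) (x : B → Lam p) (b : B) :
    translate β (mon u - 1) x b = x (b + β u) - x b := by
  rw [map_sub, map_one, LinearMap.sub_apply, Pi.sub_apply, translate_mon]
  rfl

/-- Cancel f and compare coefficients at j. This is ℤ-independence of the elements f σ^i, the
infinite-order hypothesis of `exists_translate_sub_eq`; it is needed both for f = 1 and for the
relations. -/
theorem eq_zero_of_zsmul_mem_closure {f : CycRing p} (hf : ∀ a, f * a = 0 → a = 0)
    {S : Set (ZMod p)} {j : ZMod p} (hj : j ∉ S) {n : ℤ}
    (h : n • (f * gen j) ∈ AddSubgroup.closure ((fun i => f * gen i) '' S)) : n = 0 := by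
  have key : ∀ x ∈ AddSubgroup.closure ((fun i => f * gen i) '' S),
      ∃ w : CycRing p, x = f * w ∧ w.coeff j = 0 := by
    intro x hx
    induction hx using AddSubgroup.closure_induction with
    | mem x hx =>
      obtain ⟨i, hi, rfl⟩ := hx
      refine ⟨gen i, rfl, ?_⟩
      have : i ≠ j := fun h => hj (h ▸ hi)
      simp [gen, this]
    | zero => exact ⟨0, by simp⟩
    | add x y _ _ hx hy =>
      obtain ⟨w, rfl, hw⟩ := hx
      obtain ⟨v, rfl, hv⟩ := hy
      exact ⟨w + v, by rw [mul_add], by simp [hw, hv]⟩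
    | neg x _ hx =>
      obtain ⟨w, rfl, hw⟩ := hx
      exact ⟨-w, by rw [mul_neg], by simp [hw]⟩
  obtain ⟨w, hw, hwj⟩ := key _ h
  have h1 : n • gen j - w = 0 := hf _ (by rw [mul_sub, mul_smul_comm, hw, sub_self])
  have h2 := congrArg (fun v : CycRing p => v.coeff j) h1
  simpa [gen, hwj] using h2

theorem invariant_of_mem_closure {M : Type*} {S : Set B} {x : B → M}
    (hx : ∀ s ∈ S, ∀ b, x (b + s) = x b) {h : B} (hh : h ∈ AddSubgroup.closure S) (b : B) :
    x (b + h) = x b := by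
  induction hh using AddSubgroup.closure_induction generalizing b with
  | mem s hs => exact hx s hs b
  | zero => rw [add_zero]
  | add s t _ _ hs ht => rw [← add_assoc, ht, hs]
  | neg s _ hs =>
    have := hs (b + -s)
    rw [neg_add_cancel_right] at this
    exact this.symm

/-- The Koszul complex of functions on `ℤ[ℤ/p]` is exact in nonzero degrees. -/
theorem exists_koszulD_eq (J : Finset (ZMod p)) : ∀ n, n ≠ 0 →
    ∀ x : CycRing p → Lam p, x ∈ funGrade (CycRing p) n → (∀ i ∉ J, ∀ b, contract i (x b) = 0) →
      (∀ i ∉ J, ∀ b, x (b + gen i) = x b) → koszulD (AddMonoidHom.id _) J x = 0 →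
      ∃ y ∈ funGrade (CycRing p) (n - 1), (∀ i ∉ J, ∀ b, contract i (y b) = 0) ∧
        (∀ i ∉ J, ∀ b, y (b + gen i) = y b) ∧ koszulD (AddMonoidHom.id _) J y = x := by
  induction J using Finset.induction_on with
  | empty =>
    intro n hn x hx hcx _ _
    refine ⟨0, zero_mem _, by simp, by simp, ?_⟩
    rw [map_zero]
    funext b
    rcases lt_or_gt_of_ne hn with hn | hn
    · have := hx b
      rw [gradeLam_of_neg hn] at this
      exact this.symm
    · exact (eq_zero_of_contract_eq_zero hn (hx b) fun i => hcx i (by simp) b).symm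
  | insert j J hj ih =>
    intro n hn x hx hcx hix hDx
    set I := AddMonoidHom.id (CycRing p) with hI
    have hins : ∀ {i}, i ∉ insert j J → i ≠ j ∧ i ∉ J := fun h => by
      rwa [Finset.mem_insert, not_or] at h
    have hK : ∀ y : CycRing p → Lam p, koszulD I (insert j J) y =
        (wedge j).compLeft _ (translate I (mon (gen j) - 1) y) + koszulD I J y := fun y => by
      rw [koszulD, Finset.sum_insert hj]
      rfl
    -- Forms of degree n - 1 that do not involve generators outside `J`; in particular y_j is
    -- absent.
    let U : Submodule (ZMod p) (Lam p) :=
      gradeLam p (n - 1) ⊓ ⨅ i : {i // i ∉ J}, LinearMap.ker (contract i.1)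
    have hUc : ∀ {v}, v ∈ U → ∀ i ∉ J, contract i v = 0 := fun {v} hv i hi =>
      (Submodule.mem_iInf _).1 hv.2 ⟨i, hi⟩
    -- Solve (x_j - 1) y₁ = (contraction of x by j). Subtracting the differential of y₁ then removes
    -- the generator y_j from x.
    obtain ⟨y₁, hy₁H, hy₁U, hy₁⟩ := exists_translate_sub_eq
      (AddSubgroup.closure ((fun i => 1 * gen i) '' {i | i ∉ insert j J})) (1 * gen j)
      (fun m hm => eq_zero_of_zsmul_mem_closure (fun a h => by rwa [one_mul] at h)
        (show j ∉ {i | i ∉ insert j J} from fun h => h (Finset.mem_insert_self _ _)) hm) U.toAddSubgroup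
      (fun b => contract j (x b))
      (fun h hh b => congrArg (contract j) (invariant_of_mem_closure (by
        rintro _ ⟨i, hi, rfl⟩ b
        simp only [one_mul]
        exact hix i hi b) hh b))
      (fun b => ⟨contract_mem (hx b), (Submodule.mem_iInf _).2 fun i => by
        change contract i.1 (contract j (x b)) = 0
        by_cases hij : i.1 = j
        · rw [hij, contract_contract_self]
        · rw [contract_contract, hcx i.1 (by simp [hij, i.2]), map_zero, neg_zero]⟩)
    simp only [one_mul] at hy₁
    have hy₁g : translate I (mon (gen j) - 1) y₁ = (contract j).compLeft _ x := by
      funext b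
      rw [translate_mon_sub_one_apply]
      exact hy₁ b
    have hy₁c : ∀ i ∉ J, (contract i).compLeft (CycRing p) y₁ = 0 := fun i hi =>
      funext fun b => hUc (hy₁U b) i hi
    have hy₁i : ∀ i ∉ insert j J, ∀ b, y₁ (b + gen i) = y₁ b := fun i hi b =>
      hy₁H _ (AddSubgroup.subset_closure ⟨i, hi, one_mul _⟩) b
    have hy₁m : y₁ ∈ funGrade (CycRing p) (n - 1) := fun b => (hy₁U b).1
    set x' := x - koszulD I (insert j J) y₁ with hx'
    have hDx' : koszulD I (insert j J) x' = 0 := by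
      rw [hx', map_sub, hDx, koszulD_koszulD, sub_zero]
    have hx'm : x' ∈ funGrade (CycRing p) n := sub_mem hx (by
      have := koszulD_mem I (J := insert j J) hy₁m
      rwa [sub_add_cancel] at this)
    have hx'c : ∀ i ∉ J, (contract i).compLeft (CycRing p) x' = 0 := by
      intro i hi
      have h1 := contract_koszulD_add I (insert j J) i y₁
      rw [hy₁c i hi, map_zero, add_zero] at h1
      rw [hx', map_sub, h1]
      by_cases hij : i = j
      · subst hij
        rw [if_pos (Finset.mem_insert_self _ _), hy₁g, sub_self]
      · rw [if_neg (by simp [hij, hi]), sub_zero]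
        exact funext fun b => hcx i (by simp [hij, hi]) b
    -- For a cocycle free of y_j the homotopy formula at j makes it invariant under x_j, so the
    -- induction hypothesis for `J` applies.
    have hx'g : translate I (mon (gen j) - 1) x' = 0 := by
      have h1 := contract_koszulD_add I (insert j J) j x'
      rw [hDx', hx'c j hj, map_zero, map_zero, add_zero, if_pos (Finset.mem_insert_self _ _)] at h1
      exact h1.symm
    have hx'i : ∀ i ∉ J, ∀ b, x' (b + gen i) = x' b := by
      intro i hi b
      by_cases hij : i = j
      · subst hij
        have := congrFun hx'g b
        rw [translate_mon_sub_one_apply] at this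
        exact sub_eq_zero.1 this
      · have hi' : i ∉ insert j J := by simp [hij, hi]
        have h1 : translate I (mon (gen i) - 1) y₁ = 0 := funext fun b => by
          rw [translate_mon_sub_one_apply]
          exact sub_eq_zero.2 (hy₁i i hi' b)
        have h2 : translate I (mon (gen i) - 1) x' = 0 := by
          rw [hx', map_sub, translate_koszulD, h1, map_zero, sub_zero]
          funext b
          rw [translate_mon_sub_one_apply]
          exact sub_eq_zero.2 (hix i hi' b)
        have := congrFun h2 b
        rw [translate_mon_sub_one_apply] at this
        exact sub_eq_zero.1 this
    obtain ⟨y₂, hy₂m, hy₂c, hy₂i, hy₂⟩ := ih n hn x' hx'm (fun i hi b => congrFun (hx'c i hi) b)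
      hx'i (by
        have := hK x'
        rwa [hDx', hx'g, map_zero, zero_add, eq_comm] at this)
    have hy₂g : translate I (mon (gen j) - 1) y₂ = 0 := funext fun b => by
      rw [translate_mon_sub_one_apply]
      exact sub_eq_zero.2 (hy₂i j hj b)
    refine ⟨y₁ + y₂, add_mem hy₁m hy₂m, fun i hi b => ?_, fun i hi b => ?_, ?_⟩
    · rw [Pi.add_apply, map_add, hy₂c i (hins hi).2, add_zero]
      exact congrFun (hy₁c i (hins hi).2) b
    · rw [Pi.add_apply, Pi.add_apply, hy₁i i hi, hy₂i i (hins hi).2]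
    · rw [map_add, hK y₂, hy₂g, map_zero, zero_add, hy₂, hx', add_sub_cancel]

end Koszul

/-! ### Rotation-equivariant coefficients for the relations, controlled modulo the augmentation
ideal -/

section Coefficients

variable {p : ℕ}

/-- The augmentation of `ℤ[ℤ/p]`. -/
def aug : CycRing p →+* ℤ := (AddMonoidAlgebra.lift ℤ ℤ (ZMod p) 1).toRingHom

theorem aug_single (i : ZMod p) (n : ℤ) : aug (AddMonoidAlgebra.single i n) = n := by
  simp [aug]

theorem aug_gen (i : ZMod p) : aug (gen i) = 1 := aug_single i 1

theorem gen_mul_gen (i j : ZMod p) : gen i * gen j = gen (i + j) := by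
  simp [gen, AddMonoidAlgebra.single_mul_single]

theorem gen_zero : (gen 0 : CycRing p) = 1 := rfl

theorem mon_mul_mon (u v : CycRing p) : mon u * mon v = mon (u + v) := by
  simp [mon, AddMonoidAlgebra.single_mul_single]

theorem mon_zero : (mon 0 : TransAlg p) = 1 := rfl

theorem mon_pow (u : CycRing p) (n : ℕ) : mon u ^ n = mon (n • u) := by
  simp [mon, AddMonoidAlgebra.single_pow]

/-- The automorphism of `TransAlg p` induced by multiplication by `gen s`. -/
def rotAlg (s : ZMod p) : TransAlg p →ₐ[ZMod p] TransAlg p :=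
  AddMonoidAlgebra.lift (ZMod p) _ (CycRing p)
    { toFun := fun u => mon (gen s * u.toAdd)
      map_one' := by simp [mon_zero]
      map_mul' := fun u v => by rw [mon_mul_mon, toAdd_mul, mul_add] }

theorem rotAlg_mon (s : ZMod p) (u : CycRing p) : rotAlg s (mon u) = mon (gen s * u) := by
  simp [rotAlg, mon]

theorem rotAlg_rotAlg (s t : ZMod p) (x : TransAlg p) :
    rotAlg s (rotAlg t x) = rotAlg (t + s) x := by
  induction x using AddMonoidAlgebra.induction_linear with
  | zero => simp
  | add x y hx hy => simp only [map_add, hx, hy]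
  | single u c =>
    have : (AddMonoidAlgebra.single u c : TransAlg p) = c • mon u := by simp [mon]
    rw [this]
    simp only [map_smul, rotAlg_mon, ← mul_assoc, gen_mul_gen, add_comm s t]

variable (p) in
/-- The ideal generated by the differences of translations with the same augmentation. -/
def augIdeal : Ideal (TransAlg p) :=
  Ideal.span {x | ∃ u v : CycRing p, aug u = aug v ∧ x = mon u - mon v}

theorem mon_sub_mon_mem {u v : CycRing p} (h : aug u = aug v) : mon u - mon v ∈ augIdeal p :=
  Ideal.subset_span ⟨u, v, h, rfl⟩

theorem rotAlg_mem (s : ZMod p) {x : TransAlg p} (hx : x ∈ augIdeal p) :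
    rotAlg s x ∈ augIdeal p := by
  have : augIdeal p ≤ (augIdeal p).comap (rotAlg s) := by
    refine Ideal.span_le.2 ?_
    rintro _ ⟨u, v, h, rfl⟩
    change rotAlg s (mon u - mon v) ∈ augIdeal p
    rw [map_sub, rotAlg_mon, rotAlg_mon]
    exact mon_sub_mon_mem (by rw [map_mul, map_mul, h])
  exact this hx

/-- Modulo the ideal all basis translations coincide, so u ↦ `mon u` and u ↦ `mon (aug u • gen 0)`
are homomorphisms agreeing on the basis of ℤ[ℤ/p]. -/
theorem mon_sub_mon_aug_mem (u : CycRing p) :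
    mon u - mon (aug u • gen 0) ∈
      Ideal.span (Set.range fun l : ZMod p => (mon (gen l) - mon (gen 0) : TransAlg p)) := by
  set 𝔞 := Ideal.span (Set.range fun l : ZMod p => (mon (gen l) - mon (gen 0) : TransAlg p))
  rw [← Ideal.Quotient.mk_eq_mk_iff_sub_mem]
  let φ : CycRing p →+ Additive (TransAlg p ⧸ 𝔞) :=
    { toFun := fun u => Additive.ofMul (Ideal.Quotient.mk 𝔞 (mon u))
      map_zero' := by rw [mon_zero, map_one]; rfl
      map_add' := fun u v => by rw [← mon_mul_mon, map_mul]; rfl }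
  let ψ : CycRing p →+ Additive (TransAlg p ⧸ 𝔞) :=
    φ.comp ((zmultiplesHom (CycRing p) (gen 0)).comp (aug : CycRing p →+* ℤ).toAddMonoidHom)
  have h : φ = ψ := by
    refine AddMonoidAlgebra.addMonoidHom_ext fun l n => ?_
    have h1 : (φ.comp (zmultiplesHom (CycRing p) (gen l))) = φ.comp (zmultiplesHom (CycRing p) (gen 0)) := by
      refine AddMonoidHom.ext_int ?_
      change Additive.ofMul (Ideal.Quotient.mk 𝔞 (mon ((1 : ℤ) • gen l))) =
        Additive.ofMul (Ideal.Quotient.mk 𝔞 (mon ((1 : ℤ) • gen 0)))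
      rw [one_smul, one_smul, (Ideal.Quotient.mk_eq_mk_iff_sub_mem _ _).2]
      exact Ideal.subset_span ⟨l, rfl⟩
    have h2 := DFunLike.congr_fun h1 n
    have h3 : (AddMonoidAlgebra.single l n : CycRing p) = n • gen l := by simp [gen]
    rw [h3]
    change φ (n • gen l) = φ (aug (n • gen l) • gen 0)
    rw [map_zsmul aug, aug_gen, smul_eq_mul, mul_one]
    exact h2
  exact congrArg Additive.toMul (DFunLike.congr_fun h u)

theorem span_le_augIdeal :
    Ideal.span (Set.range fun l : ZMod p => (mon (gen l) - mon (gen 0) : TransAlg p)) ≤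
      augIdeal p := by
  refine Ideal.span_le.2 ?_
  rintro _ ⟨l, rfl⟩
  exact mon_sub_mon_mem (by rw [aug_gen, aug_gen])

variable [Fact p.Prime]

instance : CharP (TransAlg p) p :=
  charP_of_injective_algebraMap (FaithfulSMul.algebraMap_injective (ZMod p) (TransAlg p)) p

/-- The factor p in the relation is decisive. With A = `mon f' - mon (aug f' • gen 0)`, Frobenius
gives `mon (p • f') - 1` = A^p + (`mon (gen 0)` - 1)^(p^(s+1)). Expanding one factor of A^p in the
generators leaves A^(p-1), which lies in the augmentation ideal because p ≥ 2. -/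
theorem exists_coeffs_zero {f' : CycRing p} {s : ℕ} (hf' : aug f' = p ^ s) :
    ∃ c : ZMod p → TransAlg p, ∑ i, c i * (mon (gen i) - 1) = mon (p • f') - 1 ∧
      ∀ i, c i - (if i = 0 then (mon (gen 0) - 1) ^ (p ^ (s + 1) - 1) else 0) ∈ augIdeal p := by
  have hp : p.Prime := Fact.out
  set A := mon f' - mon (aug f' • gen 0) with hA
  obtain ⟨h, hh⟩ := (Ideal.mem_span_range_iff_exists_fun).1 (mon_sub_mon_aug_mem f')
  have hAm : A ∈ augIdeal p := span_le_augIdeal (mon_sub_mon_aug_mem f')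
  -- From x_l - x_0 = (x_l - 1) - (x_0 - 1): the coefficient at 0 absorbs minus the sum of all
  -- coefficients.
  let h' : ZMod p → TransAlg p := fun i => h i - if i = 0 then ∑ l, h l else 0
  have hA' : ∑ i, h' i * (mon (gen i) - 1) = A := by
    rw [hA, ← hh]
    simp only [h', sub_mul, ite_mul, zero_mul, Finset.sum_sub_distrib, Finset.sum_ite_eq',
      Finset.mem_univ, if_true, mul_sub, mul_one, Finset.sum_mul]
    abel
  have hpow : mon (p • f') - 1 = A ^ p + (mon (gen 0) - 1) ^ p ^ (s + 1) := by
    rw [← mon_pow, show mon f' = A + mon (aug f' • gen 0) by rw [hA]; ring, add_pow_char,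
      sub_pow_char_pow, one_pow, mon_pow, mon_pow, hf', ← natCast_zsmul, smul_smul,
      ← natCast_zsmul (gen 0), pow_succ']
    push_cast
    ring
  refine ⟨fun i => A ^ (p - 1) * h' i +
    if i = 0 then (mon (gen 0) - 1) ^ (p ^ (s + 1) - 1) else 0, ?_, fun i => ?_⟩
  · have h1 : 1 ≤ p ^ (s + 1) := Nat.one_le_pow _ _ hp.pos
    simp only [add_mul, Finset.sum_add_distrib, ite_mul, zero_mul, Finset.sum_ite_eq',
      Finset.mem_univ, if_true, mul_assoc]
    rw [← Finset.mul_sum, hA', hpow, ← pow_succ, ← pow_succ, Nat.sub_add_cancel hp.one_le,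
      Nat.sub_add_cancel h1]
  · rw [add_sub_cancel_right]
    refine Ideal.mul_mem_right _ _ (Ideal.pow_mem_of_mem _ hAm _ ?_)
    have := hp.two_le
    omega

/-- The rotation equivariant coefficients expressing the relations `f * gen j` in terms of the
generators. -/
theorem exists_coeffs {f' : CycRing p} {s : ℕ} (hf' : aug f' = p ^ s) :
    ∃ c : ZMod p → ZMod p → TransAlg p,
      (∀ j, ∑ i, c j i * (mon (gen i) - 1) = mon (p • f' * gen j) - 1) ∧
      (∀ t j i, rotAlg t (c j i) = c (j + t) (i + t)) ∧
      ∀ j i, c j i - (if i = j then (mon (gen 0) - 1) ^ (p ^ (s + 1) - 1) else 0) ∈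
        augIdeal p := by
  obtain ⟨c, hc, hca⟩ := exists_coeffs_zero hf'
  -- Coefficients for the relation j are the rotates by j of those for the relation 0, which makes
  -- the family equivariant.
  refine ⟨fun j i => rotAlg j (c (i - j)), fun j => ?_, fun t j i => ?_, fun j i => ?_⟩
  · rw [mul_comm, ← rotAlg_mon, ← map_one (rotAlg j), ← map_sub, ← hc, map_sum]
    refine (Equiv.sum_comp (Equiv.addLeft j) _).symm.trans (Finset.sum_congr rfl fun i _ => ?_)
    simp only [Equiv.coe_addLeft, map_mul, map_sub, map_one, rotAlg_mon, gen_mul_gen,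
      add_sub_cancel_left]
  · simp only [rotAlg_rotAlg, add_sub_add_right_eq_sub]
  · have h1 := rotAlg_mem j (hca (i - j))
    by_cases hij : i = j
    · subst hij
      rw [sub_self, if_pos rfl, map_sub, map_pow, map_sub, map_one, rotAlg_mon] at h1
      rw [if_pos rfl]
      simp only [sub_self]
      have h2 : (mon (gen i * gen 0) - 1) ^ (p ^ (s + 1) - 1) -
          (mon (gen 0) - 1) ^ (p ^ (s + 1) - 1) ∈ augIdeal p := by
        rw [← Ideal.Quotient.mk_eq_mk_iff_sub_mem, map_pow, map_pow]
        congr 1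
        rw [Ideal.Quotient.mk_eq_mk_iff_sub_mem, sub_sub_sub_cancel_right]
        exact mon_sub_mon_mem (by rw [map_mul, aug_gen, aug_gen, one_mul])
      have := add_mem h1 h2
      rwa [sub_add_sub_cancel] at this
    · have : i - j ≠ 0 := sub_ne_zero.2 hij
      rw [if_neg this, sub_zero] at h1
      rwa [if_neg hij, sub_zero]

end Coefficients

/-! ### The column complex: a coresolution of 𝔽_p by functions on ℤ[ℤ/p]/(f) -/

section Column

variable {p : ℕ} [Fact p.Prime]

/-- The quotient of `ℤ[ℤ/p]` by a principal ideal. -/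
abbrev CycQuot (f : CycRing p) : Type := CycRing p ⧸ Ideal.span {f}

/-- The projection onto `CycQuot f`, as an additive map. -/
def quo (f : CycRing p) : CycRing p →+ CycQuot f := (Ideal.Quotient.mk (Ideal.span {f})).toAddMonoidHom

theorem quo_surjective (f : CycRing p) : Function.Surjective (quo f) := Ideal.Quotient.mk_surjective

theorem quo_eq_zero_iff {f a : CycRing p} : quo f a = 0 ↔ ∃ w, a = f * w := by
  change Ideal.Quotient.mk _ a = 0 ↔ _
  rw [Ideal.Quotient.eq_zero_iff_mem, Ideal.mem_span_singleton]
  rfl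

/-- The closure of the relations `f * gen i` is the ideal generated by `f`. -/
theorem mul_mem_closure (f w : CycRing p) :
    f * w ∈ AddSubgroup.closure (Set.range fun i : ZMod p => f * gen i) := by
  induction w using AddMonoidAlgebra.induction_linear with
  | zero => rw [mul_zero]; exact zero_mem _
  | add x y hx hy => rw [mul_add]; exact add_mem hx hy
  | single i n =>
    have : (AddMonoidAlgebra.single i n : CycRing p) = n • gen i := by simp [gen]
    rw [this, mul_smul_comm]
    exact zsmul_mem (AddSubgroup.subset_closure (Set.mem_range_self i)) n

variable (f : CycRing p) (c : ZMod p → ZMod p → TransAlg p)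

/-- The differential of the column complex. -/
def colD : ((ZMod p → ℕ) → CycQuot f → Lam p) →ₗ[ZMod p] ((ZMod p → ℕ) → CycQuot f → Lam p) :=
  polyD Finset.univ (koszulD (quo f) Finset.univ) fun j => contractForm (quo f) (c j)

/-- The grading of the column complex. -/
def colGrade (n : ℤ) : Submodule (ZMod p) ((ZMod p → ℕ) → CycQuot f → Lam p) :=
  polyGrade Finset.univ (funGrade (CycQuot f)) (fun _ => 0) n

theorem mem_colGrade {n : ℤ} {x : (ZMod p → ℕ) → CycQuot f → Lam p} :
    x ∈ colGrade f n ↔ ∀ α b, x α b ∈ gradeLam p (n - 2 * ∑ i, (α i : ℤ)) :=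
  ⟨fun h α b => (h α).1 b, fun h α => ⟨fun b => h α b, fun _ _ => rfl,
    fun i hi => absurd (Finset.mem_univ i) hi⟩⟩

theorem colGrade_of_neg {n : ℤ} (hn : n < 0) : colGrade f n = ⊥ := by
  refine eq_bot_iff.2 fun x hx => ?_
  refine funext fun α => funext fun b => ?_
  have h1 := (mem_colGrade f).1 hx α b
  rw [gradeLam_of_neg] at h1
  · exact h1
  · have : 0 ≤ ∑ i, (α i : ℤ) := Finset.sum_nonneg fun i _ => Int.natCast_nonneg _
    omega

/-- Relations translate trivially on the quotient. Hence each h_j anticommutes with the Koszul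
differential there, and `colD` squares to zero. -/
theorem translate_mon_mul_gen_sub_one (j : ZMod p) (x : CycQuot f → Lam p) :
    translate (quo f) (mon (f * gen j) - 1) x = 0 := by
  funext b
  rw [translate_mon_sub_one_apply, quo_eq_zero_iff.2 ⟨_, rfl⟩, add_zero, sub_self]
  rfl

variable {f c}

theorem colD_mem {n : ℤ} {x : (ZMod p → ℕ) → CycQuot f → Lam p} (hx : x ∈ colGrade f n) :
    colD f c x ∈ colGrade f (n + 1) :=
  polyD_mem (fun _ _ hx => koszulD_mem _ hx) (fun _ _ _ hx => contractForm_mem _ hx)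
    (fun _ _ => (map_zero _).symm) (fun _ _ _ => (map_zero _).symm) hx

theorem colD_colD (hc : ∀ j, ∑ i, c j i * (mon (gen i) - 1) = mon (f * gen j) - 1) {n : ℤ}
    {x : (ZMod p → ℕ) → CycQuot f → Lam p} (hx : x ∈ colGrade f n) :
    colD f c (colD f c x) = 0 :=
  polyD_polyD (fun _ _ _ => koszulD_koszulD _ _ _)
    (fun j x => by
      rw [koszulD_contractForm_add, hc, translate_mon_mul_gen_sub_one]
      rfl)
    (fun j x => contractForm_self _ _ x) (fun i j x => contractForm_comm _ _ _ x) hx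

theorem translate_comp (s : TransAlg p) (x : CycQuot f → Lam p) :
    translate (AddMonoidHom.id _) s (x ∘ quo f) = translate (quo f) s x ∘ quo f := by
  induction s using AddMonoidAlgebra.induction_linear with
  | zero => simp
  | add s t hs ht =>
    simp only [map_add, LinearMap.add_apply, hs, ht]
    rfl
  | single u c =>
    have : (AddMonoidAlgebra.single u c : TransAlg p) = c • mon u := by simp [mon]
    rw [this]
    simp only [map_smul, LinearMap.smul_apply]
    funext b
    simp only [Pi.smul_apply, Function.comp_apply, translate_mon, map_add, AddMonoidHom.id_apply]

theorem valOp_comp (F : Lam p →ₗ[ZMod p] Lam p) (s : TransAlg p) (x : CycQuot f → Lam p) :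
    valOp (AddMonoidHom.id _) F s (x ∘ quo f) = valOp (quo f) F s x ∘ quo f := by
  rw [valOp, LinearMap.comp_apply, translate_comp]
  rfl

theorem koszulD_comp (x : CycQuot f → Lam p) :
    koszulD (AddMonoidHom.id _) Finset.univ (x ∘ quo f) = koszulD (quo f) Finset.univ x ∘ quo f := by
  simp only [koszulD, LinearMap.sum_apply, valOp_comp]
  funext b
  simp only [Finset.sum_apply, Function.comp_apply]

theorem contractForm_comp (c : ZMod p → TransAlg p) (x : CycQuot f → Lam p) :
    contractForm (AddMonoidHom.id _) c (x ∘ quo f) = contractForm (quo f) c x ∘ quo f := by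
  simp only [contractForm, LinearMap.sum_apply, valOp_comp]
  funext b
  simp only [Finset.sum_apply, Function.comp_apply]

theorem polyD_comp (x : (ZMod p → ℕ) → CycQuot f → Lam p) :
    polyD Finset.univ (koszulD (AddMonoidHom.id (CycRing p)) Finset.univ)
      (fun j => contractForm (AddMonoidHom.id (CycRing p)) (c j)) (fun α => x α ∘ quo f) =
    fun α => colD f c x α ∘ quo f := by
  funext α b
  simp only [colD, polyD_apply, koszulD_comp, contractForm_comp, Pi.add_apply, Function.comp_apply,
    Finset.sum_apply]
  congr 1
  refine Finset.sum_congr rfl fun j _ => ?_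
  split_ifs <;> rfl

/-- The column complex is exact in nonzero degrees. -/
theorem exists_colD_eq (hf : ∀ a, f * a = 0 → a = 0)
    (hc : ∀ j, ∑ i, c j i * (mon (gen i) - 1) = mon (f * gen j) - 1) (n : ℤ) (hn : n ≠ 0)
    (x : (ZMod p → ℕ) → CycQuot f → Lam p) (hx : x ∈ colGrade f n) (hDx : colD f c x = 0) :
    ∃ y ∈ colGrade f (n - 1), colD f c y = x := by
  -- Work on ℤ[ℤ/p], where g_j is translation by f σ^j minus one. The common kernel of the g_j is
  -- exactly the functions pulled back from the quotient, and g_j is surjective on the common kernel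
  -- of any others by `exists_translate_sub_eq`.
  have key := exists_polyD_eq (L := funGrade (CycRing p)) (fun _ hn => funGrade_of_neg hn)
    (d := koszulD (AddMonoidHom.id (CycRing p)) Finset.univ)
    (h := fun j => contractForm (AddMonoidHom.id (CycRing p)) (c j))
    (g := fun j => translate (AddMonoidHom.id (CycRing p)) (mon (f * gen j) - 1))
    (fun _ _ hx => koszulD_mem _ hx) (fun _ _ _ hx => contractForm_mem _ hx)
    (fun _ _ _ hx => translate_mem _ hx _) (fun _ _ _ => koszulD_koszulD _ _ _)
    (fun j x => by rw [koszulD_contractForm_add, hc])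
    (fun j x => translate_koszulD _ _ _ _) (fun i j x => translate_contractForm _ _ _ _)
    (fun i j x => translate_translate_comm _ _ _ _)
    (fun j x => contractForm_self _ _ x) (fun i j x => contractForm_comm _ _ _ x)
    (fun n hn x hx hdx => by
      obtain ⟨y, hy, _, _, hdy⟩ := exists_koszulD_eq Finset.univ n hn x hx (by simp) (by simp) hdx
      exact ⟨y, hy, hdy⟩)
    (fun J j hj n x hx hgx => by
      obtain ⟨y, hyH, hyU, hy⟩ := exists_translate_sub_eq
        (AddSubgroup.closure ((fun i => f * gen i) '' (J : Set (ZMod p)))) (f * gen j)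
        (fun m hm => eq_zero_of_zsmul_mem_closure hf (fun h => hj h) hm)
        (gradeLam p n).toAddSubgroup x
        (fun h hh b => invariant_of_mem_closure (by
          rintro _ ⟨i, hi, rfl⟩ b
          have := congrFun (hgx i hi) b
          rw [translate_mon_sub_one_apply] at this
          exact sub_eq_zero.1 this) hh b)
        hx
      refine ⟨y, hyU, fun i hi => funext fun b => ?_, funext fun b => ?_⟩
      · rw [translate_mon_sub_one_apply]
        exact sub_eq_zero.2 (hyH _ (AddSubgroup.subset_closure ⟨i, hi, rfl⟩) b)
      · rw [translate_mon_sub_one_apply]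
        exact hy b)
    Finset.univ n hn (fun α => x α ∘ quo f) (mem_polyGrade.2 fun α =>
      ⟨fun b => (mem_colGrade f).1 hx α _, fun i _ => by
        rw [translate_comp, translate_mon_mul_gen_sub_one]
        rfl, fun i hi => absurd (Finset.mem_univ i) hi⟩)
    (by
      rw [polyD_comp, hDx]
      rfl)
  obtain ⟨y', hy', hDy'⟩ := key
  rw [mem_polyGrade] at hy'
  let y : (ZMod p → ℕ) → CycQuot f → Lam p := fun α b => y' α (quo_surjective f b).choose
  -- The primitive is invariant under all f σ^i, hence under the ideal they generate additively, so
  -- it descends.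
  have hyy : (fun α => y α ∘ quo f) = y' := by
    funext α a
    have h1 := (quo_surjective f (quo f a)).choose_spec
    set a' := (quo_surjective f (quo f a)).choose with ha'
    change y' α a' = y' α a
    obtain ⟨w, hw⟩ := quo_eq_zero_iff.1 (show quo f (a' - a) = 0 by rw [map_sub, h1, sub_self])
    rw [sub_eq_iff_eq_add'.1 hw]
    refine invariant_of_mem_closure ?_ (mul_mem_closure f w) a
    rintro _ ⟨i, rfl⟩ b
    have := congrFun ((hy' α).2.1 i (Finset.mem_univ i)) b
    rw [translate_mon_sub_one_apply] at this
    exact sub_eq_zero.1 this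
  refine ⟨y, (mem_colGrade f).2 fun α b => (hy' α).1 _, ?_⟩
  rw [← hyy, polyD_comp] at hDy'
  funext α b
  obtain ⟨a, rfl⟩ := quo_surjective f b
  exact congrFun (congrFun hDy' α) a

variable (f) in
/-- The unit of the column complex. -/
def colUnit : (ZMod p → ℕ) → CycQuot f → Lam p := fun α _ => if α = 0 then 1 else 0

theorem colUnit_mem : colUnit f ∈ colGrade f 0 := by
  refine (mem_colGrade f).2 fun α b => ?_
  unfold colUnit
  split_ifs with h
  · subst h
    simpa using one_mem_gradeLam
  · exact zero_mem _

theorem contractForm_eq_zero {c : ZMod p → TransAlg p} {x : CycQuot f → Lam p}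
    (hx : x ∈ funGrade (CycQuot f) 0) : contractForm (quo f) c x = 0 := by
  rw [contractForm, LinearMap.sum_apply]
  exact Finset.sum_eq_zero fun i _ => funext fun b => contract_eq_zero (translate_mem _ hx _ b)

theorem colGrade_zero_apply {x : (ZMod p → ℕ) → CycQuot f → Lam p} (hx : x ∈ colGrade f 0)
    {α : ZMod p → ℕ} (hα : α ≠ 0) : x α = 0 := by
  funext b
  have h1 := (mem_colGrade f).1 hx α b
  rw [gradeLam_of_neg] at h1
  · exact h1
  · obtain ⟨i, hi⟩ := Function.ne_iff.1 hα
    have : (α i : ℤ) ≤ ∑ i, (α i : ℤ) :=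
      Finset.single_le_sum (fun i _ => Int.natCast_nonneg _) (Finset.mem_univ i)
    have h2 : α i ≠ 0 := hi
    omega

theorem colD_colUnit : colD f c (colUnit f) = 0 := by
  have h0 : ∀ i : ZMod p, ∀ β : ZMod p → ℕ, translate (quo f) (mon (gen i) - 1) (colUnit f β) = 0 :=
    fun i β => by
      funext b
      rw [translate_mon_sub_one_apply]
      exact sub_self _
  have h1 : ∀ β, colUnit f β ∈ funGrade (CycQuot f) 0 := fun β b => by
    unfold colUnit
    split_ifs
    · exact one_mem_gradeLam
    · exact zero_mem _
  funext α
  rw [colD, polyD_apply, koszulD, LinearMap.sum_apply,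
    Finset.sum_eq_zero fun i _ => by rw [valOp, LinearMap.comp_apply, h0, map_zero], zero_add]
  refine Finset.sum_eq_zero fun j _ => ?_
  split_ifs
  · rfl
  · exact contractForm_eq_zero (h1 _)

/-- In degree zero only scalar-valued functions without variables occur. Contracting the cocycle
condition with each generator gives invariance under every x_i, hence constancy. -/
theorem eq_smul_colUnit {x : (ZMod p → ℕ) → CycQuot f → Lam p} (hx : x ∈ colGrade f 0)
    (hDx : colD f c x = 0) : ∃ a : ZMod p, x = a • colUnit f := by
  have hx0 : ∀ b, x 0 b ∈ gradeLam p 0 := fun b => by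
    simpa using (mem_colGrade f).1 hx 0 b
  have h1 : koszulD (quo f) Finset.univ (x 0) = 0 := by
    have := congrFun hDx 0
    rw [colD, polyD_apply, Finset.sum_eq_zero fun j _ => by simp, add_zero] at this
    exact this
  have h2 : ∀ (i : ZMod p) b, x 0 (b + quo f (gen i)) = x 0 b := fun i b => by
    have h3 := contract_koszulD_add (quo f) Finset.univ i (x 0)
    have h4 : (contract i).compLeft _ (x 0) = 0 := funext fun b => contract_eq_zero (hx0 b)
    rw [h1, h4, map_zero, map_zero, add_zero, if_pos (Finset.mem_univ i)] at h3
    have := congrFun h3 b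
    rw [translate_mon_sub_one_apply] at this
    exact (sub_eq_zero.1 this.symm)
  have h3 : ∀ b, x 0 b = x 0 0 := fun b => by
    obtain ⟨a, rfl⟩ := quo_surjective f b
    have := invariant_of_mem_closure (x := fun a => x 0 (quo f a))
      (S := Set.range fun i : ZMod p => 1 * gen i) (by
        rintro _ ⟨i, rfl⟩ b
        simp only [one_mul, map_add]
        exact h2 i _) (mul_mem_closure 1 a) 0
    simpa using this
  obtain ⟨a, ha⟩ := mem_gradeLam_zero (hx0 0)
  refine ⟨a, funext fun α => funext fun b => ?_⟩
  by_cases hα : α = 0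
  · subst hα
    rw [h3, ha]
    simp [colUnit]
  · rw [colGrade_zero_apply hx hα]
    simp [colUnit, hα]

end Column

/-! ### The periodic complex of functions on ℤ/p -/

section Periodic

variable {p : ℕ} [Fact p.Prime] (M : Type*) [AddCommGroup M] [Module (ZMod p) M]

/-- The maps of the periodic complex of functions on `ℤ/p`. -/
def perMap (i : ℕ) : (ZMod p → M) →ₗ[ZMod p] (ZMod p → M) :=
  if Even i then LinearMap.funLeft (ZMod p) M (fun r => r + 1) - LinearMap.id
  else ∑ t : ZMod p, LinearMap.funLeft (ZMod p) M fun r => r + t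

variable {M}

theorem perMap_even {i : ℕ} (hi : Even i) (x : ZMod p → M) (r : ZMod p) :
    perMap M i x r = x (r + 1) - x r := by
  simp [perMap, hi]

theorem perMap_odd {i : ℕ} (hi : ¬Even i) (x : ZMod p → M) (r : ZMod p) :
    perMap M i x r = ∑ t, x t := by
  simp only [perMap, hi, if_false, LinearMap.sum_apply, Finset.sum_apply, LinearMap.funLeft_apply]
  exact Equiv.sum_comp (Equiv.addLeft r) x

theorem perMap_perMap (i : ℕ) (x : ZMod p → M) : perMap M (i + 1) (perMap M i x) = 0 := by
  funext r
  by_cases hi : Even i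
  · have h1 : ¬Even (i + 1) := by simpa [Nat.even_add_one] using hi
    simp only [perMap_odd h1, perMap_even hi, Finset.sum_sub_distrib, Pi.zero_apply, sub_eq_zero]
    exact Equiv.sum_comp (Equiv.addRight 1) x
  · have h1 : Even (i + 1) := by simpa [Nat.even_add_one] using hi
    simp only [perMap_odd hi, perMap_even h1, sub_self, Pi.zero_apply]

theorem sum_range_natCast {A : Type*} [AddCommMonoid A] (x : ZMod p → A) : ∑ l ∈ Finset.range p, x l = ∑ r, x r := by
  refine Finset.sum_nbij' (fun l => (l : ZMod p)) (fun r => r.val) (fun _ _ => Finset.mem_univ _)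
    (fun r _ => Finset.mem_range.2 r.val_lt) (fun l hl => ZMod.val_cast_of_lt (Finset.mem_range.1 hl))
    (fun r _ => ZMod.natCast_zmod_val r) (fun _ _ => rfl)

/-- Functions on ℤ/p are coinduced, so σ - 1 and the norm alternate exactly. The submodule `K`
allows the values to be restricted to column cocycles. -/
theorem exists_perMap_eq (K : Submodule (ZMod p) M) (i : ℕ) (x : ZMod p → M) (hx : ∀ r, x r ∈ K)
    (h : perMap M (i + 1) x = 0) : ∃ y : ZMod p → M, (∀ r, y r ∈ K) ∧ perMap M i y = x := by
  have hp : 0 < p := (Fact.out : p.Prime).pos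
  by_cases hi : Even i
  · have h1 : ¬Even (i + 1) := by simpa [Nat.even_add_one] using hi
    have h2 : ∑ r, x r = 0 := by
      have := congrFun h 0
      rwa [perMap_odd h1] at this
    -- Partial sums; the wrap-around from p - 1 to 0 is consistent because the total sum is zero.
    refine ⟨fun r => ∑ l ∈ Finset.range r.val, x l, fun r => K.sum_mem fun l _ => hx _, ?_⟩
    funext r
    rw [perMap_even hi, sub_eq_iff_eq_add]
    have h3 : ∑ l ∈ Finset.range (r.val + 1), x l = x r + ∑ l ∈ Finset.range r.val, x l := by
      rw [Finset.sum_range_succ, add_comm, ZMod.natCast_zmod_val]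
    rw [← h3]
    rcases Nat.lt_or_ge (r.val + 1) p with hr | hr
    · have h4 : (r + 1).val = r.val + 1 := by
        rw [← ZMod.val_cast_of_lt hr]
        push_cast
        rw [ZMod.natCast_zmod_val]
      rw [h4]
    · have h5 : r.val + 1 = p := le_antisymm r.val_lt hr
      have h4 : r + 1 = 0 := by
        rw [← ZMod.natCast_zmod_val r, ← Nat.cast_one, ← Nat.cast_add, h5, ZMod.natCast_self]
      rw [h4, h5, sum_range_natCast, h2]
      simp
  · have h1 : Even (i + 1) := by simpa [Nat.even_add_one] using hi
    have h2 : ∀ r, x (r + 1) = x r := fun r => by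
      have := congrFun h r
      rw [perMap_even h1] at this
      exact sub_eq_zero.1 this
    have h3 : ∀ l : ℕ, x l = x 0 := fun l => by
      induction l with
      | zero => simp
      | succ l ih => rw [Nat.cast_succ, h2, ih]
    -- A constant function is the norm of its value placed at 0.
    refine ⟨Pi.single 0 (x 0), fun r => ?_, ?_⟩
    · by_cases hr : r = 0
      · subst hr; simpa using hx 0
      · simp [hr]
    · funext r
      rw [perMap_odd hi, Finset.sum_pi_single', if_pos (Finset.mem_univ _),
        ← ZMod.natCast_zmod_val r, h3]

end Periodic

/-! ### The total complex and its exactness -/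

section Total

variable {p : ℕ} [Fact p.Prime] (f : CycRing p) (c : ZMod p → ZMod p → TransAlg p)

/-- The underlying module of the total complex. -/
abbrev TotV : Type := ℕ → ZMod p → (ZMod p → ℕ) → CycQuot f → Lam p

/-- The differential of the total complex. -/
def totalD : TotV f →ₗ[ZMod p] TotV f := totD ((colD f c).compLeft (ZMod p)) (perMap _)

/-- The grading of the total complex. -/
def totGrade (n : ℤ) : Submodule (ZMod p) (TotV f) where
  carrier := {z | ∀ (i : ℕ) r, z i r ∈ colGrade f (n - i)}
  add_mem' hx hy i r := add_mem (hx i r) (hy i r)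
  zero_mem' _ _ := zero_mem _
  smul_mem' a _ hx i r := Submodule.smul_mem _ a (hx i r)

theorem mem_totGrade {n : ℤ} {z : TotV f} :
    z ∈ totGrade f n ↔ ∀ (i : ℕ) r, z i r ∈ colGrade f (n - i) := Iff.rfl

variable {f c}

/-- The pointwise grading of functions on `ℤ/p` with values in the column complex. -/
def perGrade (f : CycRing p) (n : ℤ) :
    Submodule (ZMod p) (ZMod p → (ZMod p → ℕ) → CycQuot f → Lam p) :=
  Submodule.pi Set.univ fun _ => colGrade f n

theorem mem_perGrade {n : ℤ} {x : ZMod p → (ZMod p → ℕ) → CycQuot f → Lam p} :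
    x ∈ perGrade f n ↔ ∀ r, x r ∈ colGrade f n := by
  simp [perGrade]

theorem perGrade_of_neg {n : ℤ} (hn : n < 0) : perGrade f n = ⊥ := by
  refine eq_bot_iff.2 fun x hx => funext fun r => ?_
  have := mem_perGrade.1 hx r
  rwa [colGrade_of_neg f hn] at this

theorem perMap_mem {i : ℕ} {n : ℤ} {x : ZMod p → (ZMod p → ℕ) → CycQuot f → Lam p}
    (hx : x ∈ perGrade f n) : perMap _ i x ∈ perGrade f n := by
  rw [mem_perGrade] at hx ⊢
  intro r
  by_cases hi : Even i
  · rw [perMap_even hi]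
    exact sub_mem (hx _) (hx _)
  · rw [perMap_odd hi]
    exact Submodule.sum_mem _ fun t _ => hx t

theorem compLeft_perMap {M : Type*} [AddCommGroup M] [Module (ZMod p) M]
    (F : M →ₗ[ZMod p] M) (i : ℕ) (x : ZMod p → M) :
    F.compLeft (ZMod p) (perMap M i x) = perMap M i (F.compLeft (ZMod p) x) := by
  funext r
  by_cases hi : Even i
  · simp only [LinearMap.compLeft_apply, Function.comp_apply, perMap_even hi, map_sub]
  · simp only [LinearMap.compLeft_apply, Function.comp_apply, perMap_odd hi, map_sum]

theorem colD_compLeft_mem {n : ℤ} {x : ZMod p → (ZMod p → ℕ) → CycQuot f → Lam p}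
    (hx : x ∈ perGrade f n) : (colD f c).compLeft (ZMod p) x ∈ perGrade f (n + 1) :=
  mem_perGrade.2 fun r => colD_mem (mem_perGrade.1 hx r)

theorem mem_totGrade_iff_perGrade {n : ℤ} {z : TotV f} :
    z ∈ totGrade f n ↔ ∀ i : ℕ, z i ∈ perGrade f (n - i) := by
  simp only [mem_totGrade, mem_perGrade]

theorem totalD_mem {n : ℤ} {z : TotV f} (hz : z ∈ totGrade f n) :
    totalD f c z ∈ totGrade f (n + 1) := by
  rw [mem_totGrade_iff_perGrade] at hz ⊢
  exact totD_mem (fun _ _ hx => colD_compLeft_mem hx) (fun _ _ _ hx => perMap_mem hx) hz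

theorem totalD_totalD (hc : ∀ j, ∑ i, c j i * (mon (gen i) - 1) = mon (f * gen j) - 1)
    {n : ℤ} {z : TotV f} (hz : z ∈ totGrade f n) :
    totalD f c (totalD f c z) = 0 :=
  totD_totD (𝒳 := perGrade f)
    (fun _ _ hx => funext fun r => colD_colD hc (mem_perGrade.1 hx r))
    (fun i x => compLeft_perMap _ i x) (fun i x => perMap_perMap i x)
    (mem_totGrade_iff_perGrade.1 hz)

/-- Exactness of the columns moves a cocycle of degree n + 1 to the single entry of column degree
zero. What remains is a function on ℤ/p with values in degree-zero column cocycles, where the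
periodic complex is exact. -/
theorem exists_totalD_eq (hf : ∀ a, f * a = 0 → a = 0)
    (hc : ∀ j, ∑ i, c j i * (mon (gen i) - 1) = mon (f * gen j) - 1) (n : ℕ)
    {z : TotV f} (hz : z ∈ totGrade f (n + 1 : ℕ)) (hDz : totalD f c z = 0) :
    ∃ y ∈ totGrade f n, totalD f c y = z := by
  obtain ⟨y, hy, hzy⟩ := exists_totD_eq (𝒳 := perGrade f) (fun _ hn => perGrade_of_neg hn)
    (fun _ _ hx => colD_compLeft_mem (c := c) hx) (fun _ _ _ hx => perMap_mem hx)
    (fun _ _ hx => funext fun r => colD_colD hc (mem_perGrade.1 hx r))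
    (fun i x => compLeft_perMap _ i x) (fun i x => perMap_perMap i x)
    (fun n hn x hx hdx => by
      have := fun r => exists_colD_eq hf hc n hn (x r) (mem_perGrade.1 hx r) (congrFun hdx r)
      choose y hy hdy using this
      exact ⟨y, mem_perGrade.2 hy, funext hdy⟩)
    z (mem_totGrade_iff_perGrade.1 hz) hDz
  change ∀ i : ℕ, (i : ℤ) ≠ ((n + 1 : ℕ) : ℤ) → (z - totalD f c y) i = 0 at hzy
  have hy' : y ∈ totGrade f n := mem_totGrade_iff_perGrade.2 fun i => by
    have := hy i
    push_cast at this
    rwa [add_sub_cancel_right] at this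
  set w := z - totalD f c y with hw
  have hwm : w ∈ totGrade f (n + 1 : ℕ) := sub_mem hz (by exact_mod_cast totalD_mem hy')
  have hDw : totalD f c w = 0 := by rw [hw, LinearMap.map_sub, hDz, totalD_totalD hc hy', sub_zero]
  have hwi : ∀ i : ℕ, i ≠ n + 1 → w i = 0 := fun i hi => hzy i (by exact_mod_cast hi)
  have h1 : (colD f c).compLeft (ZMod p) (w (n + 1)) = 0 := by
    have := congrFun hDw (n + 1)
    rw [totalD, totD_succ, hwi n (by omega), map_zero, add_zero] at this
    rw [← one_smul (ZMod p) ((colD f c).compLeft (ZMod p) (w (n + 1)))]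
    have h2 : (1 : ZMod p) = (-1) ^ (n + 1) * (-1) ^ (n + 1) := by
      rw [← mul_pow]; simp
    rw [h2, mul_smul, this]
    simp
  have h2 : perMap _ (n + 1) (w (n + 1)) = 0 := by
    have := congrFun hDw (n + 2)
    rw [totalD, totD_succ, hwi (n + 2) (by omega), map_zero, smul_zero, zero_add] at this
    exact this
  obtain ⟨v, hv, hvw⟩ := exists_perMap_eq (colGrade f 0 ⊓ LinearMap.ker (colD f c)) n (w (n + 1))
    (fun r => ⟨by simpa using hwm (n + 1) r, congrFun h1 r⟩) h2
  refine ⟨y + Pi.single n v, add_mem hy' fun i r => ?_, ?_⟩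
  · by_cases hi : i = n
    · subst hi
      simpa using (hv r).1
    · simp [hi]
  · rw [map_add, ← eq_sub_iff_add_eq', ← hw]
    have hv0 : (colD f c).compLeft (ZMod p) v = 0 := funext fun r => (hv r).2
    funext i
    cases i with
    | zero =>
      rw [totalD, totD_zero, hwi 0 (by omega)]
      by_cases hn : n = 0
      · subst hn
        rw [Pi.single_eq_same, hv0]
      · rw [Pi.single_eq_of_ne (Ne.symm hn), map_zero]
    | succ i =>
      rw [totalD, totD_succ]
      have h3 : (colD f c).compLeft (ZMod p) ((Pi.single n v : TotV f) (i + 1)) = 0 := by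
        by_cases hn : i + 1 = n
        · subst hn
          rw [Pi.single_eq_same, hv0]
        · rw [Pi.single_eq_of_ne hn, map_zero]
      rw [h3, smul_zero, zero_add]
      by_cases hn : i = n
      · subst hn
        rw [Pi.single_eq_same, hvw]
      · rw [Pi.single_eq_of_ne hn, map_zero, hwi _ (by omega)]

variable (f) in
/-- The unit of the total complex. -/
def totUnit : TotV f := Pi.single 0 fun _ => colUnit f

theorem totUnit_mem : totUnit f ∈ totGrade f 0 := fun i r => by
  by_cases hi : i = 0
  · subst hi
    simpa [totUnit] using colUnit_mem
  · simp [totUnit, hi]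

theorem totalD_totUnit : totalD f c (totUnit f) = 0 := by
  have h0 : (colD f c).compLeft (ZMod p) (fun _ => colUnit f) = 0 := funext fun r => colD_colUnit
  funext i
  match i with
  | 0 => rw [totalD, totD_zero, totUnit, Pi.single_eq_same, h0]; rfl
  | 1 =>
    rw [totalD, totD_succ, totUnit, Pi.single_eq_same, Pi.single_eq_of_ne (by omega), map_zero,
      smul_zero, zero_add]
    funext r
    rw [perMap_even (by simp), sub_self]
    rfl
  | i + 2 =>
    rw [totalD, totD_succ, totUnit, Pi.single_eq_of_ne (by omega), Pi.single_eq_of_ne (by omega),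
      map_zero, map_zero, smul_zero, zero_add]
    rfl

theorem eq_smul_totUnit {z : TotV f} (hz : z ∈ totGrade f 0) (hDz : totalD f c z = 0) :
    ∃ a : ZMod p, z = a • totUnit f := by
  have h0 : ∀ i : ℕ, i ≠ 0 → z i = 0 := fun i hi => funext fun r => by
    have := hz i r
    rw [colGrade_of_neg f (by omega)] at this
    exact this
  have h1 := congrFun hDz 0
  rw [totalD, totD_zero] at h1
  have h2 : perMap _ 0 (z 0) = 0 := by
    have := congrFun hDz 1
    rw [totalD, totD_succ, h0 1 (by omega), map_zero, smul_zero, zero_add] at this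
    exact this
  have h3 : ∀ r, z 0 (r + 1) = z 0 r := fun r => by
    have := congrFun h2 r
    rw [perMap_even (by simp)] at this
    exact sub_eq_zero.1 this
  have h4 : ∀ l : ℕ, z 0 (l : ZMod p) = z 0 0 := fun l => by
    induction l with
    | zero => simp
    | succ l ih => rw [Nat.cast_succ, h3, ih]
  obtain ⟨a, ha⟩ := eq_smul_colUnit (c := c) (x := z 0 0) (by simpa using hz 0 0) (congrFun h1 0)
  refine ⟨a, funext fun i => ?_⟩
  by_cases hi : i = 0
  · subst hi
    funext r
    rw [← ZMod.natCast_zmod_val r, h4, ha]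
    simp [totUnit]
  · rw [h0 i hi]
    simp [totUnit, hi]

end Total

/-! ### The affine group acting on the total complex, with acyclic terms -/

section Rotation

variable {p : ℕ} [Fact p.Prime] {f : CycRing p} {c : ZMod p → ZMod p → TransAlg p}

theorem quo_mul (x y : CycRing p) : quo f (x * y) = quo f x * quo f y :=
  map_mul (Ideal.Quotient.mk (Ideal.span {f})) x y

theorem quo_gen_mul_quo_gen (i j : ZMod p) : quo f (gen i) * quo f (gen j) = quo f (gen (i + j)) := by
  rw [← quo_mul, gen_mul_gen]

theorem quo_gen_zero : quo f (gen 0) = 1 := rfl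

/-- The action of an affine transformation of `CycQuot f` on functions. -/
def rotFun (t : ZMod p) (a : CycQuot f) : (CycQuot f → Lam p) →ₗ[ZMod p] (CycQuot f → Lam p) :=
  (shiftLam t).compLeft _ ∘ₗ LinearMap.funLeft _ _ fun b => quo f (gen (-t)) * (b - a)

theorem rotFun_apply (t : ZMod p) (a : CycQuot f) (x : CycQuot f → Lam p) (b : CycQuot f) :
    rotFun t a x b = shiftLam t (x (quo f (gen (-t)) * (b - a))) := rfl

theorem translate_rotFun (t : ZMod p) (a : CycQuot f) (u : TransAlg p) (x : CycQuot f → Lam p) :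
    translate (quo f) u (rotFun t a x) = rotFun t a (translate (quo f) (rotAlg (-t) u) x) := by
  induction u using AddMonoidAlgebra.induction_linear with
  | zero => simp
  | add s t hs ht => simp only [map_add, LinearMap.add_apply, hs, ht]
  | single u c =>
    have : (AddMonoidAlgebra.single u c : TransAlg p) = c • mon u := by simp [mon]
    rw [this]
    simp only [map_smul, LinearMap.smul_apply, rotAlg_mon]
    congr 1
    funext b
    rw [translate_mon, rotFun_apply, rotFun_apply, translate_mon, quo_mul]
    congr 2
    ring

theorem valOp_rotFun {F F' : Lam p →ₗ[ZMod p] Lam p} {t : ZMod p}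
    (h : ∀ x, F (shiftLam t x) = shiftLam t (F' x)) (a : CycQuot f) (u : TransAlg p)
    (x : CycQuot f → Lam p) :
    valOp (quo f) F u (rotFun t a x) = rotFun t a (valOp (quo f) F' (rotAlg (-t) u) x) := by
  rw [valOp, LinearMap.comp_apply, translate_rotFun]
  funext b
  exact h _

theorem koszulD_rotFun (t : ZMod p) (a : CycQuot f) (x : CycQuot f → Lam p) :
    koszulD (quo f) Finset.univ (rotFun t a x) = rotFun t a (koszulD (quo f) Finset.univ x) := by
  simp only [koszulD, LinearMap.sum_apply, map_sum]
  refine (Equiv.sum_comp (Equiv.addRight t) _).symm.trans (Finset.sum_congr rfl fun i _ => ?_)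
  rw [Equiv.coe_addRight, valOp_rotFun fun x => (shiftLam_wedge t i x).symm, map_sub, map_one,
    rotAlg_mon, gen_mul_gen, neg_add_eq_sub, add_sub_cancel_right]

theorem contractForm_rotFun (hrot : ∀ t j i, rotAlg t (c j i) = c (j + t) (i + t)) (t j : ZMod p)
    (a : CycQuot f) (x : CycQuot f → Lam p) :
    contractForm (quo f) (c (j + t)) (rotFun t a x) = rotFun t a (contractForm (quo f) (c j) x) := by
  simp only [contractForm, LinearMap.sum_apply, map_sum]
  refine (Equiv.sum_comp (Equiv.addRight t) _).symm.trans (Finset.sum_congr rfl fun i _ => ?_)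
  rw [Equiv.coe_addRight, valOp_rotFun fun x => (shiftLam_contract t i x).symm, hrot,
    add_neg_cancel_right, add_neg_cancel_right]

/-- The action of an affine transformation of `CycQuot f` on the column complex. -/
def rotCol (t : ZMod p) (a : CycQuot f) :
    ((ZMod p → ℕ) → CycQuot f → Lam p) →ₗ[ZMod p] ((ZMod p → ℕ) → CycQuot f → Lam p) :=
  (rotFun t a).compLeft _ ∘ₗ LinearMap.funLeft _ _ fun α j => α (j + t)

theorem rotCol_apply (t : ZMod p) (a : CycQuot f) (x : (ZMod p → ℕ) → CycQuot f → Lam p)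
    (α : ZMod p → ℕ) : rotCol t a x α = rotFun t a (x fun j => α (j + t)) := rfl

theorem rotCol_apply_apply (t : ZMod p) (a : CycQuot f) (x : (ZMod p → ℕ) → CycQuot f → Lam p)
    (α : ZMod p → ℕ) (b : CycQuot f) : rotCol t a x α b =
      shiftLam t (x (fun j => α (j + t)) (quo f (gen (-t)) * (b - a))) := rfl

theorem sub_single_comp_add (α : ZMod p → ℕ) (j t : ZMod p) :
    (fun i => (α - Pi.single (j + t) 1 : ZMod p → ℕ) (i + t)) =
      (fun i => α (i + t)) - Pi.single j 1 := by
  funext i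
  by_cases h : i = j
  · subst h; simp
  · simp [h]

/-- Rotation by t moves the forms, the variables v_j and the relation coefficients simultaneously
from index j to j + t; the reindexed sums agree because the coefficients are equivariant. -/
theorem colD_rotCol (hrot : ∀ t j i, rotAlg t (c j i) = c (j + t) (i + t)) (t : ZMod p)
    (a : CycQuot f) (x : (ZMod p → ℕ) → CycQuot f → Lam p) :
    colD f c (rotCol t a x) = rotCol t a (colD f c x) := by
  funext α
  rw [rotCol_apply]
  simp only [colD, polyD_apply, map_add, map_sum]
  rw [rotCol_apply, koszulD_rotFun]
  congr 1
  refine (Equiv.sum_comp (Equiv.addRight t) _).symm.trans (Finset.sum_congr rfl fun j _ => ?_)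
  rw [Equiv.coe_addRight]
  split_ifs
  · rw [map_zero]
  · rw [rotCol_apply, sub_single_comp_add, contractForm_rotFun hrot]

theorem sum_comp_add (α : ZMod p → ℕ) (t : ZMod p) : ∑ j, (α (j + t) : ℤ) = ∑ j, (α j : ℤ) :=
  Equiv.sum_comp (Equiv.addRight t) fun j => (α j : ℤ)

theorem rotCol_mem {n : ℤ} {t : ZMod p} {a : CycQuot f} {x : (ZMod p → ℕ) → CycQuot f → Lam p}
    (hx : x ∈ colGrade f n) : rotCol t a x ∈ colGrade f n := by
  rw [mem_colGrade] at hx ⊢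
  intro α b
  rw [rotCol_apply_apply]
  have := hx (fun j => α (j + t)) (quo f (gen (-t)) * (b - a))
  rw [sum_comp_add] at this
  exact shiftLam_mem this

theorem rotCol_rotCol (t t' : ZMod p) (a a' : CycQuot f) (x : (ZMod p → ℕ) → CycQuot f → Lam p) :
    rotCol t a (rotCol t' a' x) = rotCol (t + t') (a + quo f (gen t) * a') x := by
  funext α b
  simp only [rotCol_apply_apply]
  rw [shiftLam_add]
  congr 3
  · funext j
    rw [add_comm t t', ← add_assoc]
  · have h1 : quo f (gen (-(t + t'))) = quo f (gen (-t')) * quo f (gen (-t)) := by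
      rw [quo_gen_mul_quo_gen, neg_add_rev]
    have h2 : quo f (gen (-t)) * quo f (gen t) = 1 := by
      rw [quo_gen_mul_quo_gen, neg_add_cancel, quo_gen_zero]
    rw [h1]
    linear_combination (quo f (gen (-t')) * a') * h2

theorem rotCol_zero (x : (ZMod p → ℕ) → CycQuot f → Lam p) : rotCol 0 0 x = x := by
  funext α b
  rw [rotCol_apply_apply, shiftLam_zero, neg_zero, quo_gen_zero, one_mul, sub_zero]
  simp only [add_zero]

/-- The action of an affine transformation of `CycQuot f` on the total complex. -/
def rotTot (t : ZMod p) (a : CycQuot f) : TotV f →ₗ[ZMod p] TotV f :=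
  LinearMap.compLeft ((rotCol t a).compLeft _ ∘ₗ LinearMap.funLeft _ _ fun r => r - t) ℕ

theorem rotTot_apply (t : ZMod p) (a : CycQuot f) (z : TotV f) (i : ℕ) (r : ZMod p) :
    rotTot t a z i r = rotCol t a (z i (r - t)) := rfl

theorem totalD_rotTot (hrot : ∀ t j i, rotAlg t (c j i) = c (j + t) (i + t)) (t : ZMod p)
    (a : CycQuot f) (z : TotV f) : totalD f c (rotTot t a z) = rotTot t a (totalD f c z) := by
  have h1 : ∀ i r, (colD f c).compLeft (ZMod p) (rotTot t a z i) r =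
      rotCol t a ((colD f c).compLeft (ZMod p) (z i) (r - t)) := fun i r => by
    simp only [LinearMap.compLeft_apply, Function.comp_apply, rotTot_apply, colD_rotCol hrot]
  funext i r
  rw [rotTot_apply]
  cases i with
  | zero =>
    rw [totalD, totD_zero, totD_zero, h1]
  | succ i =>
    rw [totalD, totD_succ, totD_succ, Pi.add_apply, Pi.add_apply, Pi.smul_apply, h1, Pi.smul_apply,
      map_add, map_smul]
    congr 1
    by_cases hi : Even i
    · rw [perMap_even hi, perMap_even hi, rotTot_apply, rotTot_apply, map_sub, add_sub_right_comm]
    · rw [perMap_odd hi, perMap_odd hi, map_sum]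
      simp only [rotTot_apply]
      exact Equiv.sum_comp (Equiv.subRight t) fun r => rotCol t a (z i r)

theorem rotTot_mem {n : ℤ} {t : ZMod p} {a : CycQuot f} {z : TotV f} (hz : z ∈ totGrade f n) :
    rotTot t a z ∈ totGrade f n := fun _ _ => rotCol_mem (hz _ _)

theorem rotTot_totUnit (t : ZMod p) (a : CycQuot f) : rotTot t a (totUnit f) = totUnit f := by
  funext i r α b
  rw [rotTot_apply, rotCol_apply_apply]
  by_cases hi : i = 0
  · subst hi
    simp only [totUnit, Pi.single_eq_same, colUnit]
    have : ((fun j => α (j + t)) = 0) ↔ α = 0 := by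
      constructor
      · intro h
        funext j
        simpa using congrFun h (j - t)
      · rintro rfl
        rfl
    simp only [this]
    split_ifs
    · exact shiftLam_one t
    · exact map_zero _
  · simp [totUnit, hi]

/-- The augmentation of `CycQuot f`. -/
def augQ (f : CycRing p) : CycQuot f →+* ZMod (aug f).natAbs :=
  Ideal.Quotient.lift _ ((Int.castRingHom _).comp aug) fun a ha => by
    obtain ⟨w, rfl⟩ := Ideal.mem_span_singleton.1 ha
    simp only [RingHom.comp_apply, map_mul, eq_intCast]
    rw [(ZMod.intCast_zmod_eq_zero_iff_dvd (aug f) (aug f).natAbs).2 (Int.natAbs_dvd.2 dvd_rfl), zero_mul]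

theorem augQ_quo (a : CycRing p) : augQ f (quo f a) = (aug a : ℤ) := rfl

/-- A group of affine transformations of `CycQuot f`, consisting of all those with linear part
a power of the generator and translation part of augmentation zero. -/
structure AffineModel (f : CycRing p) (G : Type) [Group G] where
  /-- The exponent of the linear part. -/
  s : G → ZMod p
  /-- The translation part. -/
  a : G → CycQuot f
  s_mul : ∀ g h, s (g * h) = s g + s h
  a_mul : ∀ g h, a (g * h) = a g + quo f (gen (s g)) * a h
  injective : ∀ g h, s g = s h → a g = a h → g = h
  augQ_a : ∀ g, augQ f (a g) = 0
  surjective : ∀ t b, augQ f b = 0 → ∃ g, s g = t ∧ a g = b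

variable {G : Type} [Group G] (m : AffineModel f G)

theorem AffineModel.s_one : m.s 1 = 0 := by
  have := m.s_mul 1 1
  rw [mul_one] at this
  simpa using this

theorem AffineModel.a_one : m.a 1 = 0 := by
  have := m.a_mul 1 1
  rw [mul_one, m.s_one, quo_gen_zero, one_mul] at this
  simpa using this

/-- The representation of a group of affine transformations on the total complex. -/
def AffineModel.rep : Representation (ZMod p) G (TotV f) where
  toFun g := rotTot (m.s g) (m.a g)
  map_one' := by
    rw [m.s_one, m.a_one]
    refine LinearMap.ext fun z => funext fun i => funext fun r => ?_
    rw [rotTot_apply, rotCol_zero, sub_zero]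
    rfl
  map_mul' g h := by
    refine LinearMap.ext fun z => funext fun i => funext fun r => ?_
    rw [rotTot_apply, Module.End.mul_apply, rotTot_apply, rotTot_apply, rotCol_rotCol, m.s_mul,
      m.a_mul, sub_sub]

theorem AffineModel.rep_apply (g : G) (z : TotV f) :
    m.rep g z = rotTot (m.s g) (m.a g) z := rfl

/-- The restriction of functions to a fundamental domain. -/
def fundDom (f : CycRing p) : TotV f →ₗ[ZMod p] TotV f := by
  classical
  exact
  { toFun := fun z i r α b =>
      if r = 0 ∧ b = ((augQ f b).val : CycQuot f) then z i r α b else 0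
    map_add' := fun y z => by
      funext i r α b
      simp only [Pi.add_apply]
      split_ifs <;> simp
    map_smul' := fun k z => by
      funext i r α b
      simp only [Pi.smul_apply, RingHom.id_apply]
      split_ifs <;> simp }

open Classical in
theorem fundDom_apply (z : TotV f) (i : ℕ) (r : ZMod p) (α : ZMod p → ℕ) (b : CycQuot f) :
    fundDom f z i r α b =
      if r = 0 ∧ b = ((augQ f b).val : CycQuot f) then z i r α b else 0 := by
  simp only [fundDom, LinearMap.coe_mk, AddHom.coe_mk]

theorem fundDom_mem {n : ℤ} {z : TotV f} (hz : z ∈ totGrade f n) : fundDom f z ∈ totGrade f n :=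
  fun i r => (mem_colGrade f).2 fun α b => by
    classical
    rw [fundDom_apply]
    split_ifs
    · exact (mem_colGrade f).1 (hz i r) α b
    · exact zero_mem _

theorem augQ_quo_gen (t : ZMod p) : augQ f (quo f (gen t)) = 1 := by
  rw [augQ_quo, aug_gen, Int.cast_one]

/-- The group acts simply transitively on pairs (r, b) with b of fixed augmentation, and each such
orbit contains one base point, r = 0 and b the least nonnegative integer of that augmentation. At
every point just one summand survives. -/
theorem AffineModel.sum_fundDom [Fintype G] (hf0 : aug f ≠ 0) (z : TotV f) :
    ∑ g, m.rep g (fundDom f (m.rep g⁻¹ z)) = z := by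
  classical
  have : NeZero (aug f).natAbs := ⟨by simpa using hf0⟩
  funext i r α b
  simp only [Finset.sum_apply]
  have h1 : ∀ t t' : ZMod p, t = t' → quo f (gen t) = quo f (gen t') := fun t t' h => by rw [h]
  -- The element carrying the base point of the orbit to (r, b).
  obtain ⟨g₀, hs, ha⟩ := m.surjective r (b - quo f (gen r) * ((augQ f b).val : CycQuot f)) (by
    rw [map_sub, map_mul, augQ_quo_gen, map_natCast, one_mul, ZMod.natCast_zmod_val, sub_self])
  have key : ∀ g, m.rep g (fundDom f (m.rep g⁻¹ z)) i r α b = if g = g₀ then z i r α b else 0 := by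
    intro g
    have h2 : m.rep g (m.rep g⁻¹ z) i r α b = z i r α b := by
      rw [← Module.End.mul_apply, ← map_mul, mul_inv_cancel, map_one]
      rfl
    rw [m.rep_apply, rotTot_apply, rotCol_apply_apply] at h2 ⊢
    rw [fundDom_apply]
    have haug : augQ f (quo f (gen (-m.s g)) * (b - m.a g)) = augQ f b := by
      rw [map_mul, augQ_quo_gen, one_mul, map_sub, m.augQ_a, sub_zero]
    have hinv : quo f (gen (m.s g)) * quo f (gen (-m.s g)) = 1 := by
      rw [quo_gen_mul_quo_gen, add_neg_cancel, quo_gen_zero]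
    have hiff : (r - m.s g = 0 ∧ quo f (gen (-m.s g)) * (b - m.a g) =
        ((augQ f (quo f (gen (-m.s g)) * (b - m.a g))).val : CycQuot f)) ↔ g = g₀ := by
      rw [haug, sub_eq_zero]
      constructor
      · rintro ⟨h3, h4⟩
        refine m.injective _ _ (by rw [hs, h3]) ?_
        rw [ha, h3, ← h4, ← mul_assoc, hinv]
        ring
      · rintro rfl
        refine ⟨hs.symm, ?_⟩
        rw [hs] at hinv ⊢
        rw [ha]
        linear_combination ((augQ f b).val : CycQuot f) * hinv
    rw [if_congr hiff rfl rfl]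
    split_ifs
    · exact h2
    · exact map_zero _
  simp only [key, Finset.sum_ite_eq', Finset.mem_univ, if_true]

theorem totUnit_smul_eq_zero {k : ZMod p} (h : k • totUnit f = 0) : k = 0 := by
  have := congrFun (congrFun (congrFun (congrFun h 0) 0) 0) 0
  simp only [totUnit, colUnit, Pi.smul_apply, Pi.single_eq_same, if_true, Pi.zero_apply] at this
  exact smul_one_eq_zero this

/-- The cohomology of an affine group in terms of invariants of the total complex. -/
theorem AffineModel.nonempty_equiv_coh [Fintype G] (hf : ∀ a, f * a = 0 → a = 0) (hf0 : aug f ≠ 0)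
    (hc : ∀ j, ∑ i, c j i * (mon (gen i) - 1) = mon (f * gen j) - 1)
    (hrot : ∀ t j i, rotAlg t (c j i) = c (j + t) (i + t)) (n : ℕ) :
    Nonempty (groupCohomology (Rep.trivial (ZMod p) G (ZMod p)) n ≃ₗ[ZMod p]
      Coh (fun n : ℕ => totGrade f n ⊓ m.rep.invariants) (totalD f c) n) := by
  refine nonempty_groupCohomology_equiv_coh m.rep (totalD f c) (fun n => totGrade f n)
    (fun n g x hx => rotTot_mem hx) (fun n x hx => by exact_mod_cast totalD_mem hx)
    (fun n x hx => totalD_totalD hc hx) (fun n g x _ => totalD_rotTot hrot _ _ _)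
    (fun n x hx hdx => exists_totalD_eq hf hc n hx hdx) (fundDom f)
    (fun n x hx => fundDom_mem hx) (fun x => m.sum_fundDom hf0 x) (totUnit f)
    (by simpa using totUnit_mem) totalD_totUnit (fun g => rotTot_totUnit _ _)
    (fun k h => totUnit_smul_eq_zero h) (fun x hx hdx => eq_smul_totUnit (by simpa using hx) hdx) n

end Rotation

/-! ### The reduced complex, depending only on p and q -/

section Reduced

variable {p : ℕ} [Fact p.Prime]

variable (p) in
/-- The underlying module of the columns of the reduced complex. -/
abbrev RedX : Type := (ZMod p → ℕ) → ℕ → Lam p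

variable (p) in
/-- The part of the differential raising the form degree. -/
def redWedge : (ℕ → Lam p) →ₗ[ZMod p] (ℕ → Lam p) where
  toFun w a := ∑ i, wedge i (w (a + 1))
  map_add' w v := by
    funext a
    simp [Finset.sum_add_distrib]
  map_smul' k w := by
    funext a
    simp [Finset.smul_sum]

theorem redWedge_apply (w : ℕ → Lam p) (a : ℕ) : redWedge p w a = ∑ i, wedge i (w (a + 1)) := rfl

/-- The part of the differential lowering the form degree. -/
def redContract (q : ℕ) (j : ZMod p) : (ℕ → Lam p) →ₗ[ZMod p] (ℕ → Lam p) where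
  toFun w a := contract j (w (a + (q - 1)))
  map_add' w v := by
    funext a
    simp
  map_smul' k w := by
    funext a
    simp

variable (p) in
/-- The differential of the columns of the reduced complex. -/
def redCol (q : ℕ) : RedX p →ₗ[ZMod p] RedX p :=
  polyD Finset.univ (redWedge p) (redContract q)

theorem redCol_apply (q : ℕ) (x : RedX p) (α : ZMod p → ℕ) (a : ℕ) :
    redCol p q x α a = ∑ i, wedge i (x α (a + 1)) +
      ∑ j, if α j = 0 then 0 else contract j (x (α - Pi.single j 1) (a + (q - 1))) := by
  rw [redCol, polyD_apply, Pi.add_apply, Finset.sum_apply, redWedge_apply]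
  congr 1
  refine Finset.sum_congr rfl fun j _ => ?_
  split_ifs <;> rfl

/-- The rotation of the columns of the reduced complex. -/
def rotRed (t : ZMod p) : RedX p →ₗ[ZMod p] RedX p where
  toFun x α a := shiftLam t (x (fun j => α (j + t)) a)
  map_add' x y := by
    funext α a
    simp
  map_smul' k x := by
    funext α a
    simp

theorem rotRed_apply (t : ZMod p) (x : RedX p) (α : ZMod p → ℕ) (a : ℕ) :
    rotRed t x α a = shiftLam t (x (fun j => α (j + t)) a) := rfl

variable (p) in
/-- The horizontal differentials of the reduced complex. -/
def redPer (i : ℕ) : RedX p →ₗ[ZMod p] RedX p :=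
  if Even i then rotRed 1 - LinearMap.id else ∑ t, rotRed t

theorem redPer_even {i : ℕ} (hi : Even i) (x : RedX p) : redPer p i x = rotRed 1 x - x := by
  simp [redPer, hi]

theorem redPer_odd {i : ℕ} (hi : ¬Even i) (x : RedX p) : redPer p i x = ∑ t, rotRed t x := by
  simp [redPer, hi]

variable (p) in
/-- The differential of the reduced complex. -/
def redD (q : ℕ) : (ℕ → RedX p) →ₗ[ZMod p] (ℕ → RedX p) := totD (redCol p q) (redPer p)

variable (p) in
/-- The forms of degree `n`, truncated to the indices `a < q`. -/
def truncGrade (q a : ℕ) (n : ℤ) : Submodule (ZMod p) (Lam p) :=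
  if q ≤ a then ⊥ else gradeLam p n

theorem mem_truncGrade {q a : ℕ} {n : ℤ} {x : Lam p} :
    x ∈ truncGrade p q a n ↔ x ∈ gradeLam p n ∧ (q ≤ a → x = 0) := by
  unfold truncGrade
  split_ifs with h
  · simp only [Submodule.mem_bot, h, true_imp_iff]
    exact ⟨fun hx => ⟨hx ▸ zero_mem _, hx⟩, fun hx => hx.2⟩
  · simp [h]

variable (p) in
/-- The grading of the reduced complex. -/
def redGrade (q : ℕ) (n : ℤ) : Submodule (ZMod p) (ℕ → RedX p) :=
  Submodule.pi Set.univ fun i => Submodule.pi Set.univ fun α => Submodule.pi Set.univ fun a =>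
    truncGrade p q a (n - (i : ℕ) - 2 * ∑ j, (α j : ℤ))

theorem mem_redGrade {q : ℕ} {n : ℤ} {z : ℕ → RedX p} : z ∈ redGrade p q n ↔
    ∀ (i : ℕ) α a, z i α a ∈ gradeLam p (n - i - 2 * ∑ j, (α j : ℤ)) ∧ (q ≤ a → z i α a = 0) := by
  simp only [← mem_truncGrade, redGrade, Submodule.mem_pi, Set.mem_univ, true_imp_iff]

end Reduced

/-! ### Invariants of the total complex in Newton coordinates -/

section Invariants

variable {p : ℕ} [Fact p.Prime] {f : CycRing p} {c : ZMod p → ZMod p → TransAlg p}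

/-- Functions on `CycQuot f` which depend only on the augmentation. -/
def IsAugInv (x : CycQuot f → Lam p) : Prop := ∀ b b', augQ f b = augQ f b' → x b = x b'

theorem IsAugInv.translate_eq_zero {x : CycQuot f → Lam p} (hx : IsAugInv x) {u : TransAlg p}
    (hu : u ∈ augIdeal p) : translate (quo f) u x = 0 := by
  induction hu using Submodule.span_induction with
  | mem u hu =>
    obtain ⟨v, w, h, rfl⟩ := hu
    funext b
    rw [map_sub, LinearMap.sub_apply, Pi.sub_apply, translate_mon, translate_mon]
    exact sub_eq_zero.2 (hx _ _ (by rw [map_add, map_add, augQ_quo, augQ_quo, h]))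
  | zero => rw [map_zero]; rfl
  | add u v _ _ hu hv => rw [map_add, LinearMap.add_apply, hu, hv, add_zero]
  | smul u v _ hv => rw [smul_eq_mul, map_mul, Module.End.mul_apply, hv, map_zero]

theorem IsAugInv.translate_congr {x : CycQuot f → Lam p} (hx : IsAugInv x) {u v : TransAlg p}
    (huv : u - v ∈ augIdeal p) : translate (quo f) u x = translate (quo f) v x := by
  have := hx.translate_eq_zero huv
  rwa [map_sub, LinearMap.sub_apply, sub_eq_zero] at this

/-- The iterated forward difference of a function at zero. -/
def newton (a : ℕ) (x : CycQuot f → Lam p) : Lam p :=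
  translate (quo f) ((mon (gen 0) - 1) ^ a) x 0

/-- On functions of the augmentation all x_i - 1 act alike, so each of them raises the Newton index
by one. -/
theorem newton_koszulD {x : CycQuot f → Lam p} (hx : IsAugInv x) (a : ℕ) :
    newton a (koszulD (quo f) Finset.univ x) = ∑ i, wedge i (newton (a + 1) x) := by
  rw [newton, translate_koszulD, koszulD, LinearMap.sum_apply, Finset.sum_apply]
  refine Finset.sum_congr rfl fun i _ => ?_
  change wedge i (translate (quo f) _ (translate (quo f) _ x) 0) = _
  rw [← Module.End.mul_apply, ← map_mul, newton]
  congr 2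
  refine congrFun (hx.translate_congr ?_) 0
  rw [pow_succ', ← sub_mul, sub_sub_sub_cancel_right]
  exact Ideal.mul_mem_right _ _ (mon_sub_mon_mem (by rw [aug_gen, aug_gen]))

/-- Modulo the augmentation ideal only the diagonal coefficient survives, and it is a (q - 1)-fold
difference. -/
theorem newton_contractForm {q : ℕ}
    (hca : ∀ j i, c j i - (if i = j then (mon (gen 0) - 1) ^ (q - 1) else 0) ∈ augIdeal p)
    {x : CycQuot f → Lam p} (hx : IsAugInv x) (a : ℕ) (j : ZMod p) :
    newton a (contractForm (quo f) (c j) x) = contract j (newton (a + (q - 1)) x) := by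
  rw [newton, translate_contractForm, contractForm, LinearMap.sum_apply, Finset.sum_apply,
    Finset.sum_eq_single j]
  · change contract j (translate (quo f) _ (translate (quo f) _ x) 0) = _
    rw [← Module.End.mul_apply, ← map_mul, newton]
    congr 2
    refine congrFun (hx.translate_congr ?_) 0
    have := hca j j
    rw [if_pos rfl] at this
    rw [pow_add, mul_comm, ← mul_sub]
    exact Ideal.mul_mem_left _ _ this
  · intro i _ hi
    change contract i (translate (quo f) _ (translate (quo f) _ x) 0) = _
    have := hca j i
    rw [if_neg hi, sub_zero] at this
    rw [← Module.End.mul_apply, ← map_mul, hx.translate_eq_zero (Ideal.mul_mem_right _ _ this)]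
    exact map_zero _
  · intro h
    exact absurd (Finset.mem_univ _) h

/-- In characteristic p the q-th difference is translation by q minus one, which is trivial on
functions on ℤ/q. -/
theorem newton_of_le {s : ℕ} (hq : (aug f).natAbs = p ^ (s + 1)) {x : CycQuot f → Lam p}
    (hx : IsAugInv x) {a : ℕ} (ha : p ^ (s + 1) ≤ a) : newton a x = 0 := by
  obtain ⟨b, rfl⟩ := Nat.exists_eq_add_of_le ha
  have h1 : translate (quo f) ((mon (gen 0) - 1) ^ p ^ (s + 1)) x = 0 := by
    rw [sub_pow_char_pow, one_pow, mon_pow]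
    funext b
    rw [translate_mon_sub_one_apply]
    refine sub_eq_zero.2 (hx _ _ ?_)
    rw [map_add, augQ_quo, map_nsmul, aug_gen, add_eq_left]
    rw [nsmul_eq_mul, mul_one, ← hq, Int.cast_natCast, ZMod.natCast_self]
  rw [newton, pow_add, mul_comm, map_mul, Module.End.mul_apply, h1, map_zero]
  rfl

theorem newton_mem {x : CycQuot f → Lam p} {n : ℤ} (hx : ∀ b, x b ∈ gradeLam p n) (a : ℕ) :
    newton a x ∈ gradeLam p n := translate_mem (quo f) hx _ 0

/-- Newton's formula: expanding a power of x_0 = (x_0 - 1) + 1 recovers all values from the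
differences at zero. -/
theorem IsAugInv.eq_zero {x : CycQuot f → Lam p} (hf0 : aug f ≠ 0) (hx : IsAugInv x)
    (h : ∀ a, newton a x = 0) : x = 0 := by
  have : NeZero (aug f).natAbs := ⟨by simpa using hf0⟩
  have h1 : ∀ n : ℕ, x (quo f (n • gen 0)) = 0 := fun n => by
    have h2 : translate (quo f) (mon (n • gen 0)) x 0 = x (quo f (n • gen 0)) := by
      rw [translate_mon, zero_add]
    rw [← h2, ← mon_pow, ← sub_add_cancel (mon (gen 0) : TransAlg p) 1, add_pow, map_sum,
      LinearMap.sum_apply, Finset.sum_apply]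
    refine Finset.sum_eq_zero fun a _ => ?_
    rw [one_pow, mul_one, mul_comm, map_mul, map_natCast, Module.End.mul_apply,
      Module.End.natCast_apply, Pi.smul_apply]
    have := h a
    rw [newton] at this
    rw [this, smul_zero]
  funext b
  rw [hx b (quo f ((augQ f b).val • gen 0)) ?_, h1]
  · rfl
  · rw [augQ_quo, map_nsmul, aug_gen, nsmul_eq_mul, mul_one, Int.cast_natCast,
      ZMod.natCast_zmod_val]

theorem newton_sub (a : ℕ) (x y : CycQuot f → Lam p) : newton a (x - y) = newton a x - newton a y := by
  simp only [newton, map_sub, Pi.sub_apply]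

/-- Taking the first q differences is an injective map between finite sets of equal size, hence
bijective. -/
theorem exists_isAugInv_newton_eq {s : ℕ} (hq : (aug f).natAbs = p ^ (s + 1)) (n : ℤ)
    (w : ℕ → Lam p) (hw : ∀ a, w a ∈ gradeLam p n) (hw0 : ∀ a, p ^ (s + 1) ≤ a → w a = 0) :
    ∃ x : CycQuot f → Lam p, IsAugInv x ∧ (∀ b, x b ∈ gradeLam p n) ∧ ∀ a, newton a x = w a := by
  have hp : p.Prime := Fact.out
  have hf0 : aug f ≠ 0 := fun h => by
    rw [h] at hq
    exact (pow_pos hp.pos (s + 1)).ne hq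
  set q := (aug f).natAbs with hqdef
  have : NeZero q := ⟨by simpa [q] using hf0⟩
  have hinv : ∀ y : ZMod q → gradeLam p n, IsAugInv fun b : CycQuot f => (y (augQ f b) : Lam p) :=
    fun y b b' h => congrArg (fun t => (y t : Lam p)) h
  let Ψ : (ZMod q → gradeLam p n) → (Fin q → gradeLam p n) := fun y a =>
    ⟨newton a fun b : CycQuot f => (y (augQ f b) : Lam p), newton_mem (fun b => (y _).2) a⟩
  have hΨ : Function.Injective Ψ := by
    intro y y' h
    have h1 : ((fun b : CycQuot f => (y (augQ f b) : Lam p)) - fun b => (y' (augQ f b) : Lam p)) = 0 := by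
      refine IsAugInv.eq_zero hf0 (fun b b' h => by simp only [Pi.sub_apply, h]) fun a => ?_
      rcases Nat.lt_or_ge a q with ha | ha
      · rw [newton_sub]
        exact sub_eq_zero.2 (congrArg Subtype.val (congrFun h ⟨a, ha⟩))
      · exact newton_of_le hq (fun b b' h => by simp only [Pi.sub_apply, h]) (hq ▸ ha)
    funext t
    refine Subtype.ext (sub_eq_zero.1 ?_)
    have h2 := congrFun h1 (t.val : CycQuot f)
    simp only [Pi.sub_apply, map_natCast, ZMod.natCast_zmod_val] at h2
    exact h2
  have hcard : Nat.card (ZMod q → gradeLam p n) = Nat.card (Fin q → gradeLam p n) := by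
    rw [Nat.card_fun, Nat.card_fun, Nat.card_zmod, Nat.card_fin]
  obtain ⟨y, hy⟩ := ((Nat.bijective_iff_injective_and_card Ψ).2 ⟨hΨ, hcard⟩).2 fun a => ⟨w a, hw a⟩
  refine ⟨fun b => y (augQ f b), hinv y, fun b => (y _).2, fun a => ?_⟩
  rcases Nat.lt_or_ge a q with ha | ha
  · exact congrArg Subtype.val (congrFun hy ⟨a, ha⟩)
  · rw [newton_of_le hq (hinv y) (hq ▸ ha), hw0 a (hq ▸ ha)]

variable {G : Type} [Group G] (m : AffineModel f G)

/-- The group contains every translation by an element of augmentation zero. -/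
theorem AffineModel.isAugInv {z : TotV f} (hz : z ∈ m.rep.invariants) (i : ℕ) (α : ZMod p → ℕ) :
    IsAugInv (z i 0 α) := by
  intro b b' h
  obtain ⟨g, hs, ha⟩ := m.surjective 0 (b - b') (by rw [map_sub, h, sub_self])
  have h1 := congrFun (congrFun (congrFun (congrFun (hz g) i) 0) α) b
  rw [m.rep_apply, rotTot_apply, rotCol_apply_apply, hs, ha, shiftLam_zero, neg_zero, sub_zero,
    quo_gen_zero, one_mul, sub_sub_cancel] at h1
  simp only [add_zero] at h1
  exact h1.symm

/-- Invariance under the pure rotation by t determines the value at t from the value at 0. Under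
this identification the shift on ℤ/p becomes rotation of the reduced columns. -/
theorem AffineModel.apply_eq {z : TotV f} (hz : z ∈ m.rep.invariants) (i : ℕ) (t : ZMod p)
    (α : ZMod p → ℕ) (b : CycQuot f) :
    z i t α b = shiftLam t (z i 0 (fun j => α (j + t)) b) := by
  obtain ⟨g, hs, ha⟩ := m.surjective t 0 (map_zero _)
  have h1 := congrFun (congrFun (congrFun (congrFun (hz g) i) t) α) b
  rw [m.rep_apply, rotTot_apply, rotCol_apply_apply, hs, ha, sub_self, sub_zero] at h1
  rw [← h1]
  congr 1
  exact m.isAugInv hz i _ _ _ (by rw [map_mul, augQ_quo_gen, one_mul])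

theorem mem_invariants_of_apply_eq {z : TotV f} (h1 : ∀ i α, IsAugInv (z i 0 α))
    (h2 : ∀ i t α b, z i t α b = shiftLam t (z i 0 (fun j => α (j + t)) b)) :
    z ∈ m.rep.invariants := by
  intro g
  funext i r α b
  rw [m.rep_apply, rotTot_apply, rotCol_apply_apply, h2 i (r - m.s g), ← shiftLam_add,
    add_sub_cancel, h2 i r]
  have h3 : (fun j => α (j + (r - m.s g) + m.s g)) = fun j => α (j + r) := by
    funext j
    congr 1
    ring
  rw [h3]
  congr 1
  refine h1 i _ _ _ ?_
  rw [map_mul, augQ_quo_gen, one_mul, map_sub, m.augQ_a, sub_zero]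

variable (f) in
/-- The restriction of the total complex to the reduced complex. -/
def toRed : TotV f →ₗ[ZMod p] (ℕ → RedX p) where
  toFun z i α a := newton a (z i 0 α)
  map_add' y z := by
    funext i α a
    simp only [newton, Pi.add_apply, map_add]
  map_smul' k z := by
    funext i α a
    simp only [newton, Pi.smul_apply, map_smul, RingHom.id_apply]

theorem toRed_apply (z : TotV f) (i : ℕ) (α : ZMod p → ℕ) (a : ℕ) :
    toRed f z i α a = newton a (z i 0 α) := rfl

theorem newton_smul (a : ℕ) (k : ZMod p) (x : CycQuot f → Lam p) :
    newton a (k • x) = k • newton a x := by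
  simp only [newton, map_smul, Pi.smul_apply]

theorem newton_add (a : ℕ) (x y : CycQuot f → Lam p) : newton a (x + y) = newton a x + newton a y := by
  simp only [newton, map_add, Pi.add_apply]

theorem newton_sum {ι : Type*} (s : Finset ι) (a : ℕ) (x : ι → CycQuot f → Lam p) :
    newton a (∑ i ∈ s, x i) = ∑ i ∈ s, newton a (x i) := by
  simp only [newton, map_sum, Finset.sum_apply]

theorem newton_shiftLam (a : ℕ) (t : ZMod p) (x : CycQuot f → Lam p) :
    newton a (fun b => shiftLam t (x b)) = shiftLam t (newton a x) := by
  have := translate_compLeft (quo f) (shiftLam t) ((mon (gen 0) - 1) ^ a) x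
  exact congrFun this 0

theorem toRed_totalD {q : ℕ}
    (hca : ∀ j i, c j i - (if i = j then (mon (gen 0) - 1) ^ (q - 1) else 0) ∈ augIdeal p)
    {z : TotV f} (hz : z ∈ m.rep.invariants) :
    redD p q (toRed f z) = toRed f (totalD f c z) := by
  have hcol : ∀ i α a, newton a (colD f c (z i 0) α) = redCol p q (toRed f z i) α a := by
    intro i α a
    rw [colD, polyD_apply, newton_add, newton_sum, redCol_apply, newton_koszulD (m.isAugInv hz i α)]
    congr 1
    refine Finset.sum_congr rfl fun j _ => ?_
    split_ifs
    · simp [newton]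
    · rw [newton_contractForm hca (m.isAugInv hz i _)]
      rfl
  have hrot : ∀ i t α a, newton a (z i t α) = rotRed t (toRed f z i) α a := by
    intro i t α a
    rw [rotRed_apply, toRed_apply, ← newton_shiftLam]
    congr 1
    funext b
    exact m.apply_eq hz i t α b
  funext i α a
  cases i with
  | zero =>
    rw [toRed_apply, totalD, totD_zero, redD, totD_zero, ← hcol]
    rfl
  | succ i =>
    rw [toRed_apply, totalD, totD_succ, redD, totD_succ]
    simp only [Pi.add_apply, Pi.smul_apply, newton_add, newton_smul]
    rw [← hcol]
    congr 1
    by_cases hi : Even i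
    · rw [perMap_even hi, redPer_even hi, zero_add]
      exact (congrArg (· - _) (hrot i 1 α a).symm).trans (newton_sub a _ _).symm
    · rw [perMap_odd hi, redPer_odd hi]
      simp only [Finset.sum_apply, newton_sum, hrot]

theorem toRed_mem {s : ℕ} (hq : (aug f).natAbs = p ^ (s + 1)) {n : ℤ} {z : TotV f}
    (hz : z ∈ totGrade f n) (hzi : z ∈ m.rep.invariants) : toRed f z ∈ redGrade p (p ^ (s + 1)) n :=
  mem_redGrade.2 fun i α a => ⟨newton_mem ((mem_colGrade f).1 (hz i 0) α) a,
    fun ha => newton_of_le hq (m.isAugInv hzi i α) ha⟩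

theorem eq_zero_of_toRed_eq_zero (hf0 : aug f ≠ 0) {z : TotV f} (hz : z ∈ m.rep.invariants)
    (h : toRed f z = 0) : z = 0 := by
  have h1 : ∀ i α, z i 0 α = 0 := fun i α =>
    (m.isAugInv hz i α).eq_zero hf0 fun a => congrFun (congrFun (congrFun h i) α) a
  funext i t α b
  rw [m.apply_eq hz, h1]
  exact map_zero _

theorem exists_toRed_eq {s : ℕ} (hq : (aug f).natAbs = p ^ (s + 1)) {n : ℤ} {w : ℕ → RedX p}
    (hw : w ∈ redGrade p (p ^ (s + 1)) n) :
    ∃ z ∈ totGrade f n ⊓ m.rep.invariants, toRed f z = w := by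
  rw [mem_redGrade] at hw
  have := fun (i : ℕ) (α : ZMod p → ℕ) => exists_isAugInv_newton_eq hq
    (n - (i : ℤ) - 2 * ∑ j, (α j : ℤ)) (w i α) (fun a => (hw i α a).1) (fun a => (hw i α a).2)
  choose x hxi hxm hx using this
  let z : TotV f := fun i t α b => shiftLam t (x i (fun j => α (j + t)) b)
  have hz0 : ∀ i α, z i 0 α = x i α := fun i α => by
    funext b
    simp only [z, shiftLam_zero, add_zero]
  refine ⟨z, ⟨fun i t => (mem_colGrade f).2 fun α b => ?_, mem_invariants_of_apply_eq m
    (fun i α => by rw [hz0]; exact hxi i α) fun i t α b => by rw [hz0 i fun j => α (j + t)]⟩, ?_⟩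
  · have := hxm i (fun j => α (j + t)) b
    rw [sum_comp_add] at this
    exact shiftLam_mem this
  · funext i α a
    rw [toRed_apply, hz0, hx]

theorem AffineModel.nonempty_equiv_red [Fintype G] (m : AffineModel f G) {f' : CycRing p} {s : ℕ} (hff' : f = p • f')
    (hf' : aug f' = p ^ s) (hf : ∀ a, f * a = 0 → a = 0) (n : ℕ) :
    Nonempty (groupCohomology (Rep.trivial (ZMod p) G (ZMod p)) n ≃ₗ[ZMod p]
      Coh (fun n : ℕ => redGrade p (p ^ (s + 1)) n) (redD p (p ^ (s + 1))) n) := by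
  have hp : p.Prime := Fact.out
  obtain ⟨c, hc, hrot, hca⟩ := exists_coeffs hf'
  rw [← hff'] at hc
  have haug : aug f = ((p ^ (s + 1) : ℕ) : ℤ) := by
    rw [hff', map_nsmul, hf', nsmul_eq_mul, pow_succ']
    push_cast
    rfl
  have hf0 : aug f ≠ 0 := by
    rw [haug]
    exact_mod_cast (pow_pos hp.pos (s + 1)).ne'
  have hq : (aug f).natAbs = p ^ (s + 1) := by rw [haug, Int.natAbs_natCast]
  obtain ⟨e⟩ := m.nonempty_equiv_coh hf hf0 hc hrot n
  have hdinv : ∀ z ∈ m.rep.invariants, totalD f c z ∈ m.rep.invariants := fun z hz g => by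
    rw [m.rep_apply, ← totalD_rotTot hrot, ← m.rep_apply, hz g]
  have hinj : ∀ x ∈ m.rep.invariants, ∀ y ∈ m.rep.invariants, toRed f x = toRed f y → x = y :=
    fun x hx y hy h => sub_eq_zero.1 (eq_zero_of_toRed_eq_zero m hf0 (sub_mem hx hy)
      (by rw [LinearMap.map_sub, h, sub_self]))
  have key := Coh.nonempty_equiv (W := fun n : ℕ => totGrade f n ⊓ m.rep.invariants)
    (d := totalD f c) (W' := fun n : ℕ => redGrade p (p ^ (s + 1)) n)
    (d' := redD p (p ^ (s + 1))) (fun _ => toRed f)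
    (fun n x hx => toRed_mem m hq hx.1 hx.2) (fun n x hx => toRed_totalD m hca hx.2)
    (fun n x hx _ hx' => ?_) (fun n y hy hdy => ?_) n
  · obtain ⟨e'⟩ := key
    exact ⟨e.trans e'⟩
  · cases n with
    | zero =>
      have h0 : toRed f x = 0 := hx'
      rw [eq_zero_of_toRed_eq_zero m hf0 hx.2 h0]
      exact zero_mem _
    | succ n =>
      obtain ⟨y, hy, hyx⟩ := hx'
      obtain ⟨z, hz, rfl⟩ := exists_toRed_eq m hq hy
      refine ⟨z, hz, ?_⟩
      rw [toRed_totalD m hca hz.2] at hyx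
      exact hinj _ (hdinv z hz.2) _ hx.2 hyx
  · obtain ⟨x, hx, rfl⟩ := exists_toRed_eq m hq hy
    refine ⟨x, hx, ?_, by rw [sub_self]; exact zero_mem _⟩
    rw [toRed_totalD m hca hx.2] at hdy
    exact eq_zero_of_toRed_eq_zero m hf0 (hdinv x hx.2) hdy

end Invariants

/-! ### Independence of the reduced complex from q -/

section Comparison

variable {p : ℕ} [Fact p.Prime]

/-- The form degree of the coefficient of exponent `α` of an element of degree `m`. -/
def formDeg (m : ℤ) (α : ZMod p → ℕ) : ℤ := m - 2 * ∑ j, (α j : ℤ)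

theorem formDeg_sub_single (m : ℤ) {α : ZMod p → ℕ} {j : ZMod p} (hj : α j ≠ 0) :
    formDeg m (α - Pi.single j 1) = formDeg m α + 2 := by
  rw [formDeg, sum_sub_single hj, formDeg]
  ring

theorem formDeg_add_one (m : ℤ) (α : ZMod p → ℕ) : formDeg (m + 1) α = formDeg m α + 1 := by
  rw [formDeg, formDeg]
  ring

theorem formDeg_sub_one (m : ℤ) (α : ZMod p → ℕ) : formDeg (m - 1) α = formDeg m α - 1 := by
  rw [formDeg, formDeg]
  ring

theorem formDeg_comp_add (m : ℤ) (α : ZMod p → ℕ) (t : ZMod p) :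
    formDeg m (fun j => α (j + t)) = formDeg m α := by
  rw [formDeg, sum_comp_add, formDeg]

open Classical in
variable (p) in
/-- The elements of degree `m` of a column of the reduced complex, with prescribed support. -/
def suppGrade (S : ℤ → ℕ → Prop) (m : ℤ) : Submodule (ZMod p) (RedX p) :=
  Submodule.pi Set.univ fun α => Submodule.pi Set.univ fun a =>
    if S (formDeg m α) a then gradeLam p (formDeg m α) else ⊥

theorem mem_suppGrade {S : ℤ → ℕ → Prop} {m : ℤ} {x : RedX p} : x ∈ suppGrade p S m ↔
    ∀ α a, x α a ∈ gradeLam p (formDeg m α) ∧ (¬S (formDeg m α) a → x α a = 0) := by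
  classical
  simp only [suppGrade, Submodule.mem_pi, Set.mem_univ, true_imp_iff]
  refine forall_congr' fun α => forall_congr' fun a => ?_
  split_ifs with h
  · simp [h]
  · simp only [Submodule.mem_bot, h, not_false_eq_true, true_imp_iff]
    exact ⟨fun hx => ⟨hx ▸ zero_mem _, hx⟩, fun hx => hx.2⟩

theorem mem_redGrade_iff {q : ℕ} {n : ℤ} {z : ℕ → RedX p} :
    z ∈ redGrade p q n ↔ ∀ i : ℕ, z i ∈ suppGrade p (fun _ a => a < q) (n - i) := by
  simp only [mem_redGrade, mem_suppGrade, not_lt]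
  rfl

theorem wedge_eq_zero {i : ZMod p} {k : ℤ} (hk : p ≤ k) {x : Lam p} (hx : x ∈ gradeLam p k) :
    wedge i x = 0 := by
  have := wedge_mem (i := i) hx
  rwa [gradeLam_of_lt (by omega)] at this

theorem eq_zero_of_mem_gradeLam {k : ℤ} (hk : k < 0 ∨ p < k) {x : Lam p} (hx : x ∈ gradeLam p k) :
    x = 0 := by
  rcases hk with hk | hk
  · rwa [gradeLam_of_neg hk] at hx
  · rwa [gradeLam_of_lt hk] at hx

theorem contract_eq_zero_of {j : ZMod p} {k : ℤ} (hk : k < 1 ∨ p < k) {x : Lam p}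
    (hx : x ∈ gradeLam p k) : contract j x = 0 := by
  by_cases h0 : k = 0
  · subst h0
    exact contract_eq_zero hx
  · rw [eq_zero_of_mem_gradeLam (by omega) hx, map_zero]

/-- The inclusion of the columns of the reduced complex for `q = p`. -/
def embCol (q : ℕ) (m : ℤ) : RedX p →ₗ[ZMod p] RedX p where
  toFun x α a := if a + formDeg m α < p then x α a else
    if q ≤ a + formDeg m α then x α (a - (q - p)) else 0
  map_add' x y := by
    funext α a
    simp only [Pi.add_apply]
    split_ifs <;> simp
  map_smul' k x := by
    funext α a
    simp only [Pi.smul_apply, RingHom.id_apply]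
    split_ifs <;> simp

theorem embCol_apply (q : ℕ) (m : ℤ) (x : RedX p) (α : ZMod p → ℕ) (a : ℕ) :
    embCol q m x α a = if a + formDeg m α < p then x α a else
      if q ≤ a + formDeg m α then x α (a - (q - p)) else 0 := rfl

/-- The projection to the columns of the reduced complex for `q = p`. -/
def projCol (q : ℕ) (m : ℤ) : RedX p →ₗ[ZMod p] RedX p where
  toFun x α a := if a + formDeg m α < p then x α a else x α (a + (q - p))
  map_add' x y := by
    funext α a
    simp only [Pi.add_apply]
    split_ifs <;> simp
  map_smul' k x := by
    funext α a
    simp only [Pi.smul_apply, RingHom.id_apply]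
    split_ifs <;> simp

theorem projCol_apply (q : ℕ) (m : ℤ) (x : RedX p) (α : ZMod p → ℕ) (a : ℕ) :
    projCol q m x α a = if a + formDeg m α < p then x α a else x α (a + (q - p)) := rfl

variable {q : ℕ}

theorem embCol_mem (hq : p ≤ q) {m : ℤ} {x : RedX p} (hx : x ∈ suppGrade p (fun _ a => a < p) m) :
    embCol q m x ∈ suppGrade p (fun _ a => a < q) m := by
  rw [mem_suppGrade] at hx ⊢
  intro α a
  rw [embCol_apply]
  refine ⟨?_, fun ha => ?_⟩
  · split_ifs
    · exact (hx α _).1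
    · exact (hx α _).1
    · exact zero_mem _
  · split_ifs with h1 h2
    · by_cases hap : a < p
      · exact eq_zero_of_mem_gradeLam (by omega) (hx α a).1
      · exact (hx α a).2 hap
    · by_cases hk : formDeg m α < 0
      · exact eq_zero_of_mem_gradeLam (by omega) (hx α _).1
      · exact (hx α _).2 (by omega)
    · rfl

theorem projCol_mem {m : ℤ} {x : RedX p} (hx : x ∈ suppGrade p (fun _ a => a < q) m) :
    projCol q m x ∈ suppGrade p (fun _ a => a < p) m := by
  rw [mem_suppGrade] at hx ⊢
  intro α a
  rw [projCol_apply]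
  refine ⟨?_, fun ha => ?_⟩
  · split_ifs
    · exact (hx α _).1
    · exact (hx α _).1
  · split_ifs with h1
    · exact eq_zero_of_mem_gradeLam (by omega) (hx α a).1
    · exact (hx α _).2 (by omega)

theorem projCol_embCol (hq : p ≤ q) (m : ℤ) (x : RedX p) : projCol q m (embCol q m x) = x := by
  funext α a
  rw [projCol_apply, embCol_apply, embCol_apply]
  split_ifs with h1 h2 h3
  · rfl
  · omega
  · rw [Nat.add_sub_cancel]
  · omega

/-- The embedding keeps the part with index plus form degree below p and moves the rest up by q - p.
The wedge part preserves this sum, and the contraction part reads index a + (q - 1) or a + (p - 1),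
which correspond under the move. -/
theorem redCol_embCol (hq : p ≤ q) {m : ℤ} {x : RedX p}
    (hx : x ∈ suppGrade p (fun _ a => a < p) m) :
    redCol p q (embCol q m x) = embCol q (m + 1) (redCol p p x) := by
  have hp : 0 < p := (Fact.out : p.Prime).pos
  rw [mem_suppGrade] at hx
  funext α a
  rw [embCol_apply, formDeg_add_one]
  simp only [redCol_apply]
  have hw : ∀ i, wedge i (embCol q m x α (a + 1)) =
      if a + (formDeg m α + 1) < p then wedge i (x α (a + 1)) else
        if q ≤ a + (formDeg m α + 1) then wedge i (x α (a - (q - p) + 1)) else 0 := by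
    intro i
    rw [embCol_apply]
    -- In top degree the wedge vanishes. Below it, q ≤ a + k + 1 forces q - p ≤ a, so the
    -- natural-number subtraction is a true one.
    by_cases hk : (p : ℤ) ≤ formDeg m α
    · simp only [wedge_eq_zero hk (hx α _).1, ite_self]
      split_ifs
      · exact wedge_eq_zero hk (hx α _).1
      · exact wedge_eq_zero hk (hx α _).1
      · exact map_zero _
    · push_cast
      simp only [add_assoc, add_comm (1 : ℤ)]
      split_ifs with h1 h2
      · rfl
      · congr 2
        omega
      · exact map_zero _
  have hcn : ∀ j, (if α j = 0 then 0 else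
      contract j (embCol q m x (α - Pi.single j 1) (a + (q - 1)))) =
      if a + (formDeg m α + 1) < p then
        (if α j = 0 then 0 else contract j (x (α - Pi.single j 1) (a + (p - 1)))) else
        if q ≤ a + (formDeg m α + 1) then
          (if α j = 0 then 0 else contract j (x (α - Pi.single j 1) (a - (q - p) + (p - 1))))
        else 0 := by
    intro j
    by_cases hj : α j = 0
    · simp only [hj, if_true, ite_self]
    · simp only [hj, if_false]
      have hX := hx (α - Pi.single j 1)
      rw [embCol_apply]
      rw [formDeg_sub_single m hj] at hX ⊢
      by_cases hk : formDeg m α + 2 < 1 ∨ (p : ℤ) < formDeg m α + 2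
      · simp only [contract_eq_zero_of hk (hX _).1, ite_self]
        split_ifs
        · exact contract_eq_zero_of hk (hX _).1
        · exact contract_eq_zero_of hk (hX _).1
        · exact map_zero _
      · rw [not_or, not_lt, not_lt] at hk
        rw [if_neg (by omega), if_pos (by omega),
          show a + (q - 1) - (q - p) = a + (p - 1) by omega]
        split_ifs with h1 h2
        · rfl
        -- Outside the low part a is positive, so both indices read by the contraction exceed the
        -- truncation at p.
        · rw [(hX _).2 (by omega), (hX _).2 (by omega)]
        · rw [(hX _).2 (by omega), map_zero]
  rw [Finset.sum_congr rfl fun i _ => hw i, Finset.sum_congr rfl fun j _ => hcn j]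
  split_ifs <;> simp

theorem redCol_projCol (hq : p ≤ q) {m : ℤ} {x : RedX p}
    (hx : x ∈ suppGrade p (fun _ a => a < q) m) :
    redCol p p (projCol q m x) = projCol q (m + 1) (redCol p q x) := by
  have hp : 0 < p := (Fact.out : p.Prime).pos
  rw [mem_suppGrade] at hx
  funext α a
  rw [projCol_apply, formDeg_add_one]
  simp only [redCol_apply]
  have hw : ∀ i, wedge i (projCol q m x α (a + 1)) =
      if a + (formDeg m α + 1) < p then wedge i (x α (a + 1)) else
        wedge i (x α (a + (q - p) + 1)) := by
    intro i
    rw [projCol_apply]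
    push_cast
    simp only [add_assoc, add_comm (1 : ℤ), add_comm 1 (q - p)]
    split_ifs <;> rfl
  have hcn : ∀ j, (if α j = 0 then 0 else
      contract j (projCol q m x (α - Pi.single j 1) (a + (p - 1)))) =
      if a + (formDeg m α + 1) < p then
        (if α j = 0 then 0 else contract j (x (α - Pi.single j 1) (a + (q - 1)))) else
        (if α j = 0 then 0 else contract j (x (α - Pi.single j 1) (a + (q - p) + (q - 1)))) := by
    intro j
    by_cases hj : α j = 0
    · simp only [hj, if_true, ite_self]
    · simp only [hj, if_false]
      have hX := hx (α - Pi.single j 1)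
      rw [projCol_apply]
      rw [formDeg_sub_single m hj] at hX ⊢
      by_cases hk : formDeg m α + 2 < 1 ∨ (p : ℤ) < formDeg m α + 2
      · simp only [contract_eq_zero_of hk (hX _).1, ite_self]
        split_ifs
        · exact contract_eq_zero_of hk (hX _).1
        · exact contract_eq_zero_of hk (hX _).1
      · rw [not_or, not_lt, not_lt] at hk
        rw [if_neg (by omega), show a + (p - 1) + (q - p) = a + (q - 1) by omega]
        split_ifs with h1
        · rfl
        · rw [(hX _).2 (by omega), (hX _).2 (by omega)]
  rw [Finset.sum_congr rfl fun i _ => hw i, Finset.sum_congr rfl fun j _ => hcn j]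
  split_ifs <;> simp

variable (p) in
/-- The support of the complement of the image of `embCol`. -/
def midSupp (q : ℕ) (k : ℤ) (a : ℕ) : Prop := p ≤ a + k ∧ a + k < q

theorem midSupp_le {m : ℤ} {x : RedX p} (hx : x ∈ suppGrade p (midSupp p q) m) :
    x ∈ suppGrade p (fun _ a => a < q) m := by
  rw [mem_suppGrade] at hx ⊢
  refine fun α a => ⟨(hx α a).1, fun ha => ?_⟩
  by_cases hk : formDeg m α < 0
  · exact eq_zero_of_mem_gradeLam (Or.inl hk) (hx α a).1
  · exact (hx α a).2 (fun h => by have := h.2; omega)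

theorem sub_embCol_projCol_mem (hq : p ≤ q) {m : ℤ} {x : RedX p}
    (hx : x ∈ suppGrade p (fun _ a => a < q) m) :
    x - embCol q m (projCol q m x) ∈ suppGrade p (midSupp p q) m := by
  have h1 := mem_suppGrade.1 (sub_mem hx (embCol_mem hq (projCol_mem hx)))
  refine mem_suppGrade.2 fun α a => ⟨(h1 α a).1, fun ha => ?_⟩
  by_cases hk : formDeg m α < 0 ∨ (p : ℤ) < formDeg m α
  · exact eq_zero_of_mem_gradeLam hk (h1 α a).1
  rw [not_or, not_lt, not_lt] at hk
  rw [midSupp, not_and_or, not_le, not_lt] at ha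
  rw [Pi.sub_apply, Pi.sub_apply, embCol_apply, sub_eq_zero, projCol_apply, projCol_apply]
  split_ifs with h2 h3 h4
  · rfl
  · omega
  · congr 1
    omega
  · omega

/-- Contraction reads index a + (q - 1) in form degree at least 1, where index plus degree is
already at least q, outside the strip. -/
theorem redCol_apply_of_midSupp {m : ℤ} {x : RedX p} (hx : x ∈ suppGrade p (midSupp p q) m)
    (α : ZMod p → ℕ) (a : ℕ) : redCol p q x α a = ∑ i, wedge i (x α (a + 1)) := by
  rw [mem_suppGrade] at hx
  rw [redCol_apply, add_eq_left]
  refine Finset.sum_eq_zero fun j _ => ?_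
  split_ifs with hj
  · rfl
  · have hX := hx (α - Pi.single j 1) (a + (q - 1))
    by_cases hk : formDeg m (α - Pi.single j 1) < 1
    · exact contract_eq_zero_of (Or.inl hk) hX.1
    · rw [hX.2 (fun h => by have := h.2; omega), map_zero]

theorem redCol_mem_midSupp {m : ℤ} {x : RedX p} (hx : x ∈ suppGrade p (midSupp p q) m) :
    redCol p q x ∈ suppGrade p (midSupp p q) (m + 1) := by
  refine mem_suppGrade.2 fun α a => ?_
  rw [redCol_apply_of_midSupp hx, formDeg_add_one]
  have h1 := mem_suppGrade.1 hx α (a + 1)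
  refine ⟨Submodule.sum_mem _ fun i _ => wedge_mem h1.1, fun h => ?_⟩
  rw [h1.2 ?_]
  · simp
  · intro h'
    unfold midSupp at h h'
    push_cast at h'
    exact h (by omega)

theorem sum_wedge_sum_wedge (x : Lam p) : ∑ i, wedge i (∑ j, wedge j x) = 0 := by
  simp only [map_sum]
  exact sum_sum_eq_zero_of_antisymm Finset.univ _ (fun i => wedge_wedge_self i x)
    (fun i j => wedge_wedge i j x)

theorem redCol_redCol_of_midSupp {m : ℤ} {x : RedX p} (hx : x ∈ suppGrade p (midSupp p q) m) :
    redCol p q (redCol p q x) = 0 := by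
  funext α a
  rw [redCol_apply_of_midSupp (redCol_mem_midSupp hx)]
  simp only [redCol_apply_of_midSupp hx]
  exact sum_wedge_sum_wedge _

/-- The one-form ∑ y_i pairs to 1 with the zeroth coordinate, so contraction by 0 is a contracting
homotopy for multiplication by it. -/
theorem sum_wedge_contract_add (x : Lam p) :
    ∑ i, wedge i (contract 0 x) + contract 0 (∑ i, wedge i x) = x := by
  rw [map_sum, ← Finset.sum_add_distrib]
  simp only [wedge_contract_add, Finset.sum_ite_eq', Finset.mem_univ, if_true]

theorem exists_redCol_eq {m : ℤ} {x : RedX p} (hx : x ∈ suppGrade p (midSupp p q) m)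
    (hdx : redCol p q x = 0) : ∃ y ∈ suppGrade p (midSupp p q) (m - 1), redCol p q y = x := by
  -- The shift by one compensates the index shift in the wedge part, so that index plus form degree
  -- is preserved.
  let y : RedX p := fun α a => if a = 0 then 0 else contract 0 (x α (a - 1))
  have hx' := mem_suppGrade.1 hx
  have hy : y ∈ suppGrade p (midSupp p q) (m - 1) := by
    refine mem_suppGrade.2 fun α a => ?_
    rw [formDeg_sub_one]
    by_cases ha : a = 0
    · subst ha
      simp [y]
    · have h1 := hx' α (a - 1)
      simp only [y, ha, if_false]
      refine ⟨contract_mem h1.1, fun h => ?_⟩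
      rw [h1.2 ?_, map_zero]
      intro h'
      unfold midSupp at h h'
      exact h (by omega)
  refine ⟨y, hy, ?_⟩
  funext α a
  rw [redCol_apply_of_midSupp hy]
  simp only [y, Nat.add_eq_zero_iff, one_ne_zero, and_false, if_false, Nat.add_sub_cancel]
  have h1 := sum_wedge_contract_add (x α a)
  have h2 : ∑ i, wedge i (x α a) = 0 := by
    cases a with
    | zero =>
      -- The cocycle condition says nothing at a = 0. There the strip demands form degree at least
      -- p, where wedging gives zero; in lower degree the coefficient itself is zero.
      refine Finset.sum_eq_zero fun i _ => ?_
      by_cases hk : (p : ℤ) ≤ formDeg m α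
      · exact wedge_eq_zero hk (hx' α 0).1
      · rw [(hx' α 0).2 (fun h => by have := h.1; omega), map_zero]
    | succ a =>
      rw [← redCol_apply_of_midSupp hx, hdx]
      rfl
  rwa [h2, map_zero, add_zero] at h1

theorem rotRed_rotRed (s t : ZMod p) (x : RedX p) : rotRed s (rotRed t x) = rotRed (s + t) x := by
  funext α a
  rw [rotRed_apply, rotRed_apply, rotRed_apply, shiftLam_add]
  congr 3
  funext j
  congr 1
  ring

theorem redCol_rotRed (t : ZMod p) (x : RedX p) :
    redCol p q (rotRed t x) = rotRed t (redCol p q x) := by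
  funext α a
  rw [rotRed_apply]
  simp only [redCol_apply, map_add, map_sum, rotRed_apply]
  congr 1
  · refine (Equiv.sum_comp (Equiv.addRight t) _).symm.trans (Finset.sum_congr rfl fun i _ => ?_)
    rw [shiftLam_wedge]
    rfl
  · refine (Equiv.sum_comp (Equiv.addRight t) _).symm.trans (Finset.sum_congr rfl fun j _ => ?_)
    rw [Equiv.coe_addRight]
    split_ifs
    · rw [map_zero]
    · rw [shiftLam_contract, sub_single_comp_add]

theorem redPer_comm {F : RedX p →ₗ[ZMod p] RedX p} (hF : ∀ t x, F (rotRed t x) = rotRed t (F x))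
    (i : ℕ) (x : RedX p) : F (redPer p i x) = redPer p i (F x) := by
  by_cases hi : Even i
  · rw [redPer_even hi, redPer_even hi, LinearMap.map_sub, hF]
  · rw [redPer_odd hi, redPer_odd hi, map_sum]
    simp only [hF]

theorem redPer_redPer (i : ℕ) (x : RedX p) : redPer p (i + 1) (redPer p i x) = 0 := by
  have h1 : rotRed 1 (∑ t, rotRed t x) = ∑ t, rotRed t x := by
    rw [map_sum]
    simp only [rotRed_rotRed]
    exact Equiv.sum_comp (Equiv.addLeft 1) fun t => rotRed t x
  by_cases hi : Even i
  · have h2 : ¬Even (i + 1) := by simpa [Nat.even_add_one] using hi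
    rw [redPer_odd h2, redPer_even hi]
    simp only [LinearMap.map_sub, Finset.sum_sub_distrib, rotRed_rotRed, sub_eq_zero]
    exact Equiv.sum_comp (Equiv.addRight 1) fun t => rotRed t x
  · have h2 : Even (i + 1) := by simpa [Nat.even_add_one] using hi
    rw [redPer_even h2, redPer_odd hi, h1, sub_self]

theorem rotRed_mem {S : ℤ → ℕ → Prop} {m : ℤ} {t : ZMod p} {x : RedX p}
    (hx : x ∈ suppGrade p S m) : rotRed t x ∈ suppGrade p S m := by
  rw [mem_suppGrade] at hx ⊢
  intro α a
  have := hx (fun j => α (j + t)) a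
  rw [formDeg_comp_add] at this
  rw [rotRed_apply]
  exact ⟨shiftLam_mem this.1, fun h => by rw [this.2 h, map_zero]⟩

theorem redPer_mem {S : ℤ → ℕ → Prop} {m : ℤ} {i : ℕ} {x : RedX p}
    (hx : x ∈ suppGrade p S m) : redPer p i x ∈ suppGrade p S m := by
  by_cases hi : Even i
  · rw [redPer_even hi]
    exact sub_mem (rotRed_mem hx) hx
  · rw [redPer_odd hi]
    exact Submodule.sum_mem _ fun t _ => rotRed_mem hx

theorem embCol_rotRed (m : ℤ) (t : ZMod p) (x : RedX p) :
    embCol q m (rotRed t x) = rotRed t (embCol q m x) := by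
  funext α a
  rw [rotRed_apply, embCol_apply, embCol_apply, formDeg_comp_add]
  split_ifs
  · rfl
  · rfl
  · exact (map_zero _).symm

theorem projCol_rotRed (m : ℤ) (t : ZMod p) (x : RedX p) :
    projCol q m (rotRed t x) = rotRed t (projCol q m x) := by
  funext α a
  rw [rotRed_apply, projCol_apply, projCol_apply, formDeg_comp_add]
  split_ifs <;> rfl

/-- A family of operators on the columns, as an operator on elements of degree `n`. -/
def columnwise (F : ℤ → RedX p →ₗ[ZMod p] RedX p) (n : ℤ) :
    (ℕ → RedX p) →ₗ[ZMod p] (ℕ → RedX p) :=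
  LinearMap.pi fun i => F (n - (i : ℕ)) ∘ₗ LinearMap.proj i

theorem columnwise_apply (F : ℤ → RedX p →ₗ[ZMod p] RedX p) (n : ℤ) (z : ℕ → RedX p) (i : ℕ) :
    columnwise F n z i = F (n - i) (z i) := rfl

theorem redD_columnwise {q q' : ℕ} {F : ℤ → RedX p →ₗ[ZMod p] RedX p}
    (hF : ∀ m, ∀ x ∈ suppGrade p (fun _ a => a < q) m,
      redCol p q' (F m x) = F (m + 1) (redCol p q x))
    (hrot : ∀ m t x, F m (rotRed t x) = rotRed t (F m x)) {n : ℤ} {z : ℕ → RedX p}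
    (hz : z ∈ redGrade p q n) :
    redD p q' (columnwise F n z) = columnwise F (n + 1) (redD p q z) := by
  rw [mem_redGrade_iff] at hz
  funext i
  rw [columnwise_apply]
  cases i with
  | zero =>
    rw [redD, totD_zero, redD, totD_zero, columnwise_apply, hF _ _ (hz 0)]
    simp
  | succ i =>
    rw [redD, totD_succ, redD, totD_succ, columnwise_apply, columnwise_apply, hF _ _ (hz _), map_add,
      map_smul, redPer_comm (hrot _)]
    push_cast
    rw [show n + 1 - ((i : ℤ) + 1) = n - i by ring, show n - ((i : ℤ) + 1) + 1 = n - i by ring]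

/-- On the strip the columns are exact in degree zero too, so the total complex is exact. The column
homotopy is not rotation invariant, but only columnwise exactness is needed. -/
theorem exists_redD_eq_of_midSupp {n : ℤ} {w : ℕ → RedX p}
    (hw : ∀ i : ℕ, w i ∈ suppGrade p (midSupp p q) (n - i)) (hDw : redD p q w = 0) :
    ∃ y : ℕ → RedX p, (∀ i : ℕ, y i ∈ suppGrade p (midSupp p q) (n - 1 - i)) ∧ redD p q y = w := by
  have hneg : ∀ m < 0, suppGrade p (midSupp p q) m = ⊥ := fun m hm => by
    refine eq_bot_iff.2 fun x hx => ?_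
    refine funext fun α => funext fun a => ?_
    refine eq_zero_of_mem_gradeLam (Or.inl ?_) (mem_suppGrade.1 hx α a).1
    have : 0 ≤ ∑ i, (α i : ℤ) := Finset.sum_nonneg fun i _ => Int.natCast_nonneg _
    unfold formDeg
    omega
  have hdd : ∀ m, ∀ x ∈ suppGrade p (midSupp p q) m, redCol p q (redCol p q x) = 0 :=
    fun _ _ hx => redCol_redCol_of_midSupp hx
  have hdτ : ∀ i x, redCol p q (redPer p i x) = redPer p i (redCol p q x) :=
    fun i x => redPer_comm (fun t x => redCol_rotRed t x) i x
  obtain ⟨y, hy, hwy⟩ := exists_totD_eq hneg (fun _ _ hx => redCol_mem_midSupp hx)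
    (fun _ _ _ hx => redPer_mem hx) hdd hdτ redPer_redPer
    (fun m _ x hx hdx => exists_redCol_eq hx hdx) w hw hDw
  refine ⟨y, hy, ?_⟩
  have hDy : ∀ i : ℕ, redD p q y i ∈ suppGrade p (midSupp p q) (n - i) := fun i => by
    have := totD_mem (fun _ _ hx => redCol_mem_midSupp (q := q) hx)
      (fun j _ _ hx => redPer_mem (i := j) hx) hy i
    rwa [sub_add_cancel] at this
  have hDDy : redD p q (redD p q y) = 0 := totD_totD hdd hdτ redPer_redPer hy
  symm
  rw [← sub_eq_zero]
  change ∀ i : ℕ, (i : ℤ) ≠ n → (w - redD p q y) i = 0 at hwy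
  set v := w - redD p q y with hv
  have hDv : redD p q v = 0 := by rw [hv, LinearMap.map_sub, hDw, hDDy, sub_zero]
  funext i
  by_cases hi : (i : ℤ) = n
  · have hvi : v i ∈ suppGrade p (midSupp p q) 0 := by
      have := sub_mem (hw i) (hDy i)
      rwa [hi, sub_self] at this
    have hdv : redCol p q (v i) = 0 := by
      have := congrFun hDv i
      cases i with
      | zero =>
        rwa [redD, totD_zero] at this
      | succ i =>
        rw [redD, totD_succ, hwy i (by push_cast at hi; omega), map_zero, add_zero] at this
        have h2 : (1 : ZMod p) = (-1) ^ (i + 1) * (-1) ^ (i + 1) := by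
          rw [← mul_pow]; simp
        rw [← one_smul (ZMod p) (redCol p q (v (i + 1))), h2, mul_smul, this]
        simp
    obtain ⟨y', hy', hdy'⟩ := exists_redCol_eq hvi hdv
    rw [hneg _ (by omega)] at hy'
    rw [← hdy', (Submodule.mem_bot _).1 hy', map_zero]
    rfl
  · exact hwy i hi

theorem columnwise_projCol_embCol (hq : p ≤ q) (n : ℤ) (z : ℕ → RedX p) :
    columnwise (projCol q) n (columnwise (embCol q) n z) = z :=
  funext fun _ => projCol_embCol hq _ _

theorem columnwise_embCol_mem (hq : p ≤ q) {n : ℤ} {z : ℕ → RedX p} (hz : z ∈ redGrade p p n) :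
    columnwise (embCol q) n z ∈ redGrade p q n :=
  mem_redGrade_iff.2 fun i => embCol_mem hq (mem_redGrade_iff.1 hz i)

theorem columnwise_projCol_mem {n : ℤ} {z : ℕ → RedX p} (hz : z ∈ redGrade p q n) :
    columnwise (projCol q) n z ∈ redGrade p p n :=
  mem_redGrade_iff.2 fun i => projCol_mem (mem_redGrade_iff.1 hz i)

theorem redD_columnwise_embCol (hq : p ≤ q) {n : ℤ} {z : ℕ → RedX p} (hz : z ∈ redGrade p p n) :
    redD p q (columnwise (embCol q) n z) = columnwise (embCol q) (n + 1) (redD p p z) :=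
  redD_columnwise (F := embCol q) (fun _ _ hx => redCol_embCol hq hx) embCol_rotRed hz

theorem redD_columnwise_projCol (hq : p ≤ q) {n : ℤ} {z : ℕ → RedX p} (hz : z ∈ redGrade p q n) :
    redD p p (columnwise (projCol q) n z) = columnwise (projCol q) (n + 1) (redD p q z) :=
  redD_columnwise (F := projCol q) (fun _ _ hx => redCol_projCol hq hx) projCol_rotRed hz

/-- The projection is a chain map left inverse to the embedding. -/
theorem mem_coboundaries_of_columnwise_embCol (hq : p ≤ q) (n : ℕ) {z : ℕ → RedX p}
    (h : columnwise (embCol q) n z ∈ coboundaries (fun n : ℕ => redGrade p q n) (redD p q) n) :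
    z ∈ coboundaries (fun n : ℕ => redGrade p p n) (redD p p) n := by
  rw [← columnwise_projCol_embCol hq n z]
  cases n with
  | zero =>
    have h0 : columnwise (embCol q) (0 : ℕ) z = 0 := h
    rw [h0, map_zero]
    exact zero_mem _
  | succ n =>
    obtain ⟨y, hy, hyz⟩ := h
    refine ⟨columnwise (projCol q) n y, columnwise_projCol_mem hy, ?_⟩
    rw [redD_columnwise_projCol hq hy, hyz]
    push_cast
    rfl

/-- The difference is a cocycle supported in the acyclic strip. -/
theorem sub_columnwise_mem_coboundaries (hq : p ≤ q) (n : ℕ) {y : ℕ → RedX p}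
    (hy : y ∈ redGrade p q n) (hdy : redD p q y = 0) :
    y - columnwise (embCol q) n (columnwise (projCol q) n y) ∈
      coboundaries (fun n : ℕ => redGrade p q n) (redD p q) n := by
  have hwm : ∀ i : ℕ, (y - columnwise (embCol q) n (columnwise (projCol q) n y)) i ∈
      suppGrade p (midSupp p q) (n - i) := fun i =>
    sub_embCol_projCol_mem hq (mem_redGrade_iff.1 hy i)
  have hDw : redD p q (y - columnwise (embCol q) n (columnwise (projCol q) n y)) = 0 := by
    rw [LinearMap.map_sub, hdy, redD_columnwise_embCol hq (columnwise_projCol_mem hy),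
      redD_columnwise_projCol hq hy, hdy, map_zero, map_zero, sub_zero]
  obtain ⟨v, hv, hvw⟩ := exists_redD_eq_of_midSupp hwm hDw
  rw [← hvw]
  have hvm : v ∈ redGrade p q (n - 1) := mem_redGrade_iff.2 fun i => midSupp_le (hv i)
  cases n with
  | zero =>
    have : v = 0 := by
      funext i α a
      refine eq_zero_of_mem_gradeLam (Or.inl ?_) (mem_suppGrade.1 (hv i) α a).1
      have : 0 ≤ ∑ i, (α i : ℤ) := Finset.sum_nonneg fun i _ => Int.natCast_nonneg _
      unfold formDeg
      push_cast
      omega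
    rw [this, map_zero]
    exact zero_mem _
  | succ n =>
    refine ⟨v, ?_, rfl⟩
    push_cast at hvm
    rwa [add_sub_cancel_right] at hvm

/-- The cohomology of the reduced complex does not depend on `q`. -/
theorem nonempty_red_equiv (hq : p ≤ q) (n : ℕ) :
    Nonempty (Coh (fun n : ℕ => redGrade p p n) (redD p p) n ≃ₗ[ZMod p]
      Coh (fun n : ℕ => redGrade p q n) (redD p q) n) :=
  Coh.nonempty_equiv (fun n : ℕ => columnwise (embCol q) n)
    (fun _ _ hz => columnwise_embCol_mem hq hz)
    (fun n z hz => by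
      rw [redD_columnwise_embCol hq hz]
      push_cast
      rfl)
    (fun n _ _ _ h => mem_coboundaries_of_columnwise_embCol hq n h)
    (fun n y hy hdy => ⟨columnwise (projCol q) n y, columnwise_projCol_mem hy,
      by rw [redD_columnwise_projCol hq hy, hdy, map_zero],
      sub_columnwise_mem_coboundaries hq n hy hdy⟩) n

end Comparison

/-! ### Arithmetic of ℤ[ℤ/p]: σ - 1, the norm, and the relation f -/

section Arithmetic

variable {p : ℕ} [Fact p.Prime]

variable (p) in
/-- The element `σ - 1` of `ℤ[ℤ/p]`. -/
def tau : CycRing p := gen 1 - 1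

variable (p) in
/-- The norm element of `ℤ[ℤ/p]`. -/
def nrm : CycRing p := ∑ i, gen i

theorem gen_one_pow (n : ℕ) : (gen 1 : CycRing p) ^ n = gen n := by
  induction n with
  | zero => rw [pow_zero, Nat.cast_zero, gen_zero]
  | succ n ih => rw [pow_succ, ih, gen_mul_gen, Nat.cast_succ]

theorem aug_tau : aug (tau p) = 0 := by rw [tau, map_sub, aug_gen, map_one, sub_self]

theorem aug_nrm : aug (nrm p) = p := by
  simp only [nrm, map_sum, aug_gen, Finset.sum_const, Finset.card_univ, ZMod.card, nsmul_eq_mul,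
    mul_one]

theorem gen_mul_nrm (i : ZMod p) : gen i * nrm p = nrm p := by
  simp only [nrm, Finset.mul_sum, gen_mul_gen]
  exact Equiv.sum_comp (Equiv.addLeft i) fun j => gen j

theorem mul_nrm (a : CycRing p) : a * nrm p = aug a • nrm p := by
  induction a using AddMonoidAlgebra.induction_linear with
  | zero => simp
  | add x y hx hy => rw [add_mul, hx, hy, map_add, add_smul]
  | single i n =>
    have : (AddMonoidAlgebra.single i n : CycRing p) = n • gen i := by simp [gen]
    rw [this, smul_mul_assoc, gen_mul_nrm, map_zsmul, aug_gen, smul_eq_mul, mul_one]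

theorem tau_mul_nrm : tau p * nrm p = 0 := by rw [mul_nrm, aug_tau, zero_smul]

theorem tau_dvd_sub_aug (a : CycRing p) : tau p ∣ a - aug a • 1 := by
  induction a using AddMonoidAlgebra.induction_linear with
  | zero => simp
  | add x y hx hy =>
    have := dvd_add hx hy
    convert this using 1
    rw [map_add, add_smul]
    ring
  | single i n =>
    have : (AddMonoidAlgebra.single i n : CycRing p) = n • gen i := by simp [gen]
    rw [this, map_zsmul, aug_gen, smul_eq_mul, mul_one, ← smul_sub]
    rw [zsmul_eq_mul]
    refine Dvd.dvd.mul_left ?_ _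
    rw [← ZMod.natCast_zmod_val i, ← gen_one_pow]
    exact sub_one_dvd_pow_sub_one _ _

theorem tau_dvd_of_aug_eq_zero {a : CycRing p} (h : aug a = 0) : tau p ∣ a := by
  have := tau_dvd_sub_aug a
  rwa [h, zero_smul, sub_zero] at this

theorem eq_smul_nrm_of_tau_mul_eq_zero {a : CycRing p} (h : tau p * a = 0) :
    ∃ k : ℤ, a = k • nrm p := by
  have h1 : gen 1 * a = a := by
    rw [tau, sub_mul, one_mul] at h
    exact sub_eq_zero.1 h
  have h2 : ∀ i, a.coeff (1 + i) = a.coeff i := fun i => by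
    have := AddMonoidAlgebra.coeff_single_mul_add a (1 : ℤ) 1 i
    rw [one_mul] at this
    rw [← this]
    exact congrArg (fun b : CycRing p => b.coeff (1 + i)) h1.symm
  have h3 : ∀ n : ℕ, a.coeff (n : ZMod p) = a.coeff 0 := fun n => by
    induction n with
    | zero => rw [Nat.cast_zero]
    | succ n ih => rw [Nat.cast_succ, add_comm, h2, ih]
  refine ⟨a.coeff 0, ?_⟩
  ext i
  rw [← ZMod.natCast_zmod_val i, h3]
  simp only [AddMonoidAlgebra.coeff_smul, Finsupp.smul_apply, nrm, AddMonoidAlgebra.coeff_sum,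
    Finsupp.finsetSum_apply, AddMonoidAlgebra.coeff_single, Finsupp.single_apply,
    Finset.sum_ite_eq', Finset.mem_univ, if_true, smul_eq_mul, mul_one]

theorem zsmul_cancel {k : ℤ} (hk : k ≠ 0) {a : CycRing p} (h : k • a = 0) : a = 0 := by
  ext i
  have := congrArg (fun b : CycRing p => b.coeff i) h
  simp only [AddMonoidAlgebra.coeff_smul, Finsupp.smul_apply, smul_eq_mul,
    AddMonoidAlgebra.coeff_zero, Finsupp.zero_apply, mul_eq_zero, hk, false_or] at this
  exact this

theorem tau_mul_eq_zero_of_aug {a : CycRing p} (ha : aug a = 0) (h : tau p * a = 0) : a = 0 := by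
  obtain ⟨k, rfl⟩ := eq_smul_nrm_of_tau_mul_eq_zero h
  rw [map_zsmul, aug_nrm, smul_eq_mul, mul_eq_zero] at ha
  rcases ha with rfl | ha
  · exact zero_smul _ _
  · exact absurd (by exact_mod_cast ha) (Fact.out : p.Prime).ne_zero

theorem tau_pow_mul_eq_zero_of_aug (r : ℕ) {a : CycRing p} (ha : aug a = 0)
    (h : tau p ^ r * a = 0) : a = 0 := by
  induction r with
  | zero => rwa [pow_zero, one_mul] at h
  | succ r ih =>
    refine ih (tau_mul_eq_zero_of_aug (by rw [map_mul, ha, mul_zero]) ?_)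
    rw [← mul_assoc, ← pow_succ', h]

/-- Modulo p, (X - 1)^(p-1) = 1 + X + ⋯ + X^(p-1), since both become X^p - 1 after multiplication by
X - 1. -/
theorem exists_tau_pow_eq : ∃ v : CycRing p, tau p ^ (p - 1) = nrm p + p * v := by
  have hp : p.Prime := Fact.out
  have h1 : ((Polynomial.X - 1) ^ (p - 1) : Polynomial (ZMod p)) =
      ∑ i ∈ Finset.range p, Polynomial.X ^ i := by
    have h0 : (Polynomial.X - 1 : Polynomial (ZMod p)) ≠ 0 := by
      simpa using Polynomial.X_sub_C_ne_zero (1 : ZMod p)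
    refine mul_right_cancel₀ h0 ?_
    rw [← pow_succ, Nat.sub_add_cancel hp.one_le, geom_sum_mul, sub_pow_char, one_pow]
  have h2 : Polynomial.C (p : ℤ) ∣
      ((Polynomial.X - 1) ^ (p - 1) - ∑ i ∈ Finset.range p, Polynomial.X ^ i : Polynomial ℤ) := by
    rw [Polynomial.C_dvd_iff_dvd_coeff]
    intro i
    rw [← ZMod.intCast_zmod_eq_zero_iff_dvd]
    have h3 := congrArg (fun P => Polynomial.coeff P i) (sub_eq_zero.2 h1)
    have h4 : Polynomial.map (Int.castRingHom (ZMod p))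
        ((Polynomial.X - 1) ^ (p - 1) - ∑ i ∈ Finset.range p, Polynomial.X ^ i) =
        (Polynomial.X - 1) ^ (p - 1) - ∑ i ∈ Finset.range p, Polynomial.X ^ i := by
      simp [Polynomial.map_sum]
    rw [← h4] at h3
    simpa only [Polynomial.coeff_map, eq_intCast, Polynomial.coeff_zero] using h3
  obtain ⟨V, hV⟩ := h2
  have h5 := congrArg (Polynomial.aeval (gen 1 : CycRing p)) hV
  refine ⟨Polynomial.aeval (gen 1 : CycRing p) V, ?_⟩
  simp only [map_sub, map_pow, Polynomial.aeval_X, map_one, map_sum, map_mul, Polynomial.aeval_C] at h5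
  have h6 : ∑ i ∈ Finset.range p, (gen 1 : CycRing p) ^ i = nrm p := by
    rw [nrm, ← sum_range_natCast (fun i : ZMod p => (gen i : CycRing p))]
    exact Finset.sum_congr rfl fun i _ => gen_one_pow i
  rw [h6, sub_eq_iff_eq_add'] at h5
  rw [tau, h5]
  simp

/-- In `exists_tau_pow_eq` the cofactor has augmentation -1, so it is -(1 - τw) and p(1 - τw) lies
in the ideal. A geometric sum turns this into p(1 - (τw)^(p-1)), and p(τw)^(p-1) is in the ideal
anyway. -/
theorem natCast_mem_span_tau_pow : (p : CycRing p) ∈ Ideal.span {tau p ^ (p - 1), nrm p} := by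
  have hp : p.Prime := Fact.out
  set J := Ideal.span {tau p ^ (p - 1), nrm p}
  have hτ : tau p ^ (p - 1) ∈ J := Ideal.subset_span (by simp)
  have hN : nrm p ∈ J := Ideal.subset_span (by simp)
  obtain ⟨v, hv⟩ := exists_tau_pow_eq (p := p)
  have haug : aug v = -1 := by
    have := congrArg aug hv
    rw [map_pow, aug_tau, zero_pow (Nat.sub_ne_zero_of_lt hp.one_lt), map_add, aug_nrm, map_mul,
      map_natCast] at this
    have h2 : (p : ℤ) * (1 + aug v) = 0 := by linarith
    rcases mul_eq_zero.1 h2 with h3 | h3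
    · exact absurd (by exact_mod_cast h3) hp.ne_zero
    · linarith
  obtain ⟨w, hw⟩ := tau_dvd_sub_aug v
  rw [haug, neg_smul, one_smul, sub_neg_eq_add] at hw
  have h1 : (p : CycRing p) * (1 - tau p * w) ∈ J := by
    have : (p : CycRing p) * (1 - tau p * w) = nrm p - tau p ^ (p - 1) := by
      rw [hv, ← hw]
      ring
    rw [this]
    exact sub_mem hN hτ
  have h2 : (p : CycRing p) * (1 - (tau p * w) ^ (p - 1)) ∈ J := by
    rw [← mul_neg_geom_sum, ← mul_assoc]
    exact Ideal.mul_mem_right _ _ h1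
  have h3 : (p : CycRing p) * (tau p * w) ^ (p - 1) ∈ J := by
    rw [mul_pow]
    exact Ideal.mul_mem_left _ _ (Ideal.mul_mem_right _ _ hτ)
  have := add_mem h2 h3
  rwa [← mul_add, sub_add_cancel, mul_one] at this

/-- The relation module of `T_{-n} / T_0` in terms of the ring `ℤ[ℤ/p]`. -/
theorem exists_relation {n : ℕ} (hn : p - 1 ≤ n) :
    ∃ (f' : CycRing p) (s : ℕ), aug f' = p ^ s ∧ (∀ a, p • f' * a = 0 → a = 0) ∧
      ∀ a, (∃ w, tau p * a = p • f' * w) ↔ a ∈ Ideal.span {tau p ^ n, nrm p} := by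
  have hp : p.Prime := Fact.out
  have hp0 : (p : ℤ) ≠ 0 := by exact_mod_cast hp.ne_zero
  -- Only f' modulo the norm matters for the ideal: there p and τ^(p-1) generate the same ideal, so
  -- p τ^(n-(p-1)) can stand for τ^n.
  suffices h : ∃ (f' : CycRing p) (s : ℕ), aug f' = p ^ s ∧ (∀ a, f' * a = 0 → a = 0) ∧
      ∃ b, f' = tau p ^ (n - (p - 1)) + b * nrm p by
    obtain ⟨f', s, haug, hnzd, b, hb⟩ := h
    refine ⟨f', s, haug, fun a ha => hnzd a ?_, fun a => ⟨?_, fun ha => ?_⟩⟩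
    · rw [smul_mul_assoc, ← natCast_zsmul] at ha
      exact zsmul_cancel hp0 ha
    · rintro ⟨w, hw⟩
      have h1 := congrArg aug hw
      rw [map_mul, aug_tau, zero_mul, map_mul, map_nsmul, haug, nsmul_eq_mul] at h1
      have h2 : aug w = 0 := by
        rcases mul_eq_zero.1 h1.symm with h2 | h2
        · exact absurd h2 (mul_ne_zero hp0 (pow_ne_zero _ hp0))
        · exact h2
      obtain ⟨w', rfl⟩ := tau_dvd_of_aug_eq_zero h2
      obtain ⟨k, hk⟩ := eq_smul_nrm_of_tau_mul_eq_zero (a := a - p • f' * w') (by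
        rw [mul_sub, hw]
        ring)
      rw [sub_eq_iff_eq_add'.1 hk]
      have hN : nrm p ∈ Ideal.span {tau p ^ n, nrm p} := Ideal.subset_span (by simp)
      refine add_mem (Ideal.mul_mem_right _ _ ?_) (zsmul_mem hN k)
      rw [hb, nsmul_eq_mul, mul_add]
      refine add_mem ?_ (Ideal.mul_mem_left _ _ (Ideal.mul_mem_left _ _ hN))
      obtain ⟨x, y, hxy⟩ := Ideal.mem_span_pair.1 (natCast_mem_span_tau_pow (p := p))
      rw [← hxy, add_mul]
      refine add_mem ?_ (Ideal.mul_mem_right _ _ (Ideal.mul_mem_left _ _ hN))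
      rw [mul_assoc, ← pow_add, Nat.add_sub_cancel' hn]
      exact Ideal.mul_mem_left _ _ (Ideal.subset_span (by simp))
    · obtain ⟨x, y, rfl⟩ := Ideal.mem_span_pair.1 ha
      obtain ⟨v, hv⟩ := exists_tau_pow_eq (p := p)
      refine ⟨tau p * x * v, ?_⟩
      have h1 : tau p ^ n = nrm p * tau p ^ (n - (p - 1)) + p * v * tau p ^ (n - (p - 1)) := by
        rw [← add_mul, ← hv, ← pow_add, Nat.add_sub_cancel' hn]
      rw [hb, h1, nsmul_eq_mul]
      linear_combination (x * tau p ^ (n - (p - 1)) + y - p * b * x * v) * tau_mul_nrm (p := p)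
  -- For n = p - 1 one takes f' = 1, so q = p. For larger n the power of τ is a zero divisor of
  -- augmentation 0; adding the norm repairs both and gives q = p².
  rcases Nat.eq_zero_or_pos (n - (p - 1)) with hr | hr
  · exact ⟨1, 0, by simp, fun a ha => by rwa [one_mul] at ha, 0, by rw [hr]; simp⟩
  · have haug : aug (tau p ^ (n - (p - 1)) + 1 * nrm p) = p := by
      rw [one_mul, map_add, map_pow, aug_tau, zero_pow hr.ne', zero_add, aug_nrm]
    refine ⟨tau p ^ (n - (p - 1)) + 1 * nrm p, 1, by rw [haug, pow_one], fun a ha => ?_, 1, rfl⟩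
    have h1 := congrArg aug ha
    rw [map_mul, haug, map_zero, mul_eq_zero] at h1
    have h2 : aug a = 0 := h1.resolve_left hp0
    refine tau_pow_mul_eq_zero_of_aug (n - (p - 1)) h2 ?_
    rwa [one_mul, add_mul, mul_comm (nrm p), mul_nrm, h2, zero_smul, add_zero] at ha

end Arithmetic

/-! ### The groups of the theorem as affine groups over ℤ[ℤ/p] -/

section LocalField

set_option synthInstance.maxHeartbeats 200000

variable {p : ℕ} [Fact p.Prime] {K : Type} [Field K] [Algebra ℤ_[p] K] {θ : K}
  (hθ : IsPrimitiveRoot θ p)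

theorem thetaUnit_pow_eq_one : thetaUnit hθ ^ p = 1 := by
  refine Units.ext (Subtype.ext ?_)
  simp [thetaUnit]

theorem isPrimitiveRoot_thetaUnit : IsPrimitiveRoot (thetaUnit hθ) p := by
  have h1 : IsPrimitiveRoot ((thetaUnit hθ : Zpθ p θ) : K) p := hθ
  have h2 : Function.Injective ((Zpθ p θ).val.toMonoidHom.comp (Units.coeHom (Zpθ p θ))) :=
    Subtype.val_injective.comp Units.val_injective
  exact IsPrimitiveRoot.of_map_of_injective (f := (Zpθ p θ).val.toMonoidHom.comp (Units.coeHom _))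
    h1 h2

/-- The ring homomorphism from `ℤ[ℤ/p]` to `ℤ_p[θ]`. -/
def ev : CycRing p →+* Zpθ p θ :=
  (AddMonoidAlgebra.lift ℤ (Zpθ p θ) (ZMod p)
    { toFun := fun i => (thetaUnit hθ : Zpθ p θ) ^ i.toAdd.val
      map_one' := by simp
      map_mul' := fun i j => by
        have h1 : (thetaUnit hθ : Zpθ p θ) ^ p = 1 := by
          rw [← Units.val_pow_eq_pow_val, thetaUnit_pow_eq_one, Units.val_one]
        rw [toAdd_mul, ZMod.val_add, ← pow_eq_pow_mod _ h1, pow_add] }).toRingHom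

theorem ev_gen (i : ZMod p) : ev hθ (gen i) = (thetaUnit hθ : Zpθ p θ) ^ i.val := by
  simp [ev, gen]

theorem ev_tau : ev hθ (tau p) = (thetaUnit hθ : Zpθ p θ) - 1 := by
  have : (1 : ZMod p).val = 1 := ZMod.val_one p
  rw [tau, map_sub, map_one, ev_gen, this, pow_one]

theorem ev_tau_ne_zero : ev hθ (tau p) ≠ 0 := fun h => by
  rw [ev_tau, sub_eq_zero] at h
  have := congrArg Subtype.val h
  exact hθ.ne_one (Fact.out : p.Prime).one_lt this

theorem ev_nrm : ev hθ (nrm p) = 0 := by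
  have := congrArg (ev hθ) (tau_mul_nrm (p := p))
  rw [map_mul, map_zero] at this
  exact (mul_eq_zero.1 this).resolve_left (ev_tau_ne_zero hθ)

/-- By `exists_tau_pow_eq` p divides (θ - 1)^(p-1). If θ - 1 were a unit, p would be one in ℤ_p[θ],
hence in ℤ_p by integrality. -/
theorem not_isUnit_ev_tau (hinj : Function.Injective (algebraMap ℤ_[p] K)) :
    ¬IsUnit (ev hθ (tau p)) := by
  intro h
  obtain ⟨v, hv⟩ := exists_tau_pow_eq (p := p)
  have h1 := congrArg (ev hθ) hv
  rw [map_pow, map_add, ev_nrm, zero_add, map_mul, map_natCast] at h1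
  have h2 : IsUnit ((p : ℕ) : Zpθ p θ) := isUnit_of_mul_isUnit_left (h1 ▸ h.pow (p - 1))
  have hint : Algebra.IsIntegral ℤ_[p] (Zpθ p θ) := by
    refine Algebra.IsIntegral.adjoin fun x hx => ?_
    rw [Set.mem_singleton_iff.1 hx]
    exact IsIntegral.of_pow (Fact.out : p.Prime).pos (by rw [hθ.pow_eq_one]; exact isIntegral_one)
  have hinj' : Function.Injective (algebraMap ℤ_[p] (Zpθ p θ)) := fun x y hxy =>
    hinj (congrArg Subtype.val hxy)
  have hloc := (algebraMap_isIntegral_iff.mpr hint).isLocalHom hinj'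
  have h3 : IsUnit ((p : ℕ) : ℤ_[p]) := by
    refine hloc.map_nonunit _ ?_
    rwa [map_natCast]
  exact PadicInt.prime_p.not_isUnit h3

theorem ev_tau_dvd_natCast : ev hθ (tau p) ∣ ((p : ℕ) : Zpθ p θ) := by
  have := map_dvd (ev hθ) (tau_dvd_sub_aug (nrm p))
  rw [map_sub, ev_nrm, aug_nrm, zero_sub, dvd_neg, map_zsmul, map_one, zsmul_eq_mul, mul_one,
    Int.cast_natCast] at this
  exact this

/-- Density of ℤ[θ] in ℤ_p[θ]: p-adic integers are approximated by integers modulo p^n, and θ - 1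
divides p. -/
theorem exists_ev_sub_dvd (n : ℕ) (r : Zpθ p θ) : ∃ a, ev hθ (tau p) ^ n ∣ r - ev hθ a := by
  obtain ⟨r, hr⟩ := r
  induction hr using Algebra.adjoin_induction with
  | mem x hx =>
    rw [Set.mem_singleton_iff] at hx
    subst hx
    refine ⟨gen 1, ?_⟩
    have : (1 : ZMod p).val = 1 := ZMod.val_one p
    rw [ev_gen, this, pow_one]
    convert dvd_zero _
    exact sub_self _
  | algebraMap z =>
    refine ⟨((z.appr n : ℕ) : CycRing p), ?_⟩
    obtain ⟨w, hw⟩ := Ideal.mem_span_singleton.1 (PadicInt.appr_spec n z)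
    have h1 : (⟨algebraMap ℤ_[p] K z, Subalgebra.algebraMap_mem _ z⟩ : Zpθ p θ) -
        ev hθ ((z.appr n : ℕ) : CycRing p) = (p : Zpθ p θ) ^ n * algebraMap ℤ_[p] (Zpθ p θ) w := by
      rw [map_natCast]
      have := congrArg (algebraMap ℤ_[p] (Zpθ p θ)) hw
      rw [map_sub, map_natCast, map_mul, map_pow, map_natCast] at this
      exact this
    rw [h1]
    exact Dvd.dvd.mul_right (pow_dvd_pow_of_dvd (ev_tau_dvd_natCast hθ) n) _
  | add x y hx hy hx' hy' =>
    obtain ⟨a, ha⟩ := hx'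
    obtain ⟨b, hb⟩ := hy'
    refine ⟨a + b, ?_⟩
    have := dvd_add ha hb
    change _ ∣ (⟨x, hx⟩ + ⟨y, hy⟩ : Zpθ p θ) - _
    convert this using 1
    rw [map_add]
    ring
  | mul x y hx hy hx' hy' =>
    obtain ⟨a, ha⟩ := hx'
    obtain ⟨b, hb⟩ := hy'
    refine ⟨a * b, ?_⟩
    have := dvd_add (Dvd.dvd.mul_right ha ⟨y, hy⟩) (Dvd.dvd.mul_left hb (ev hθ a))
    change _ ∣ (⟨x, hx⟩ * ⟨y, hy⟩ : Zpθ p θ) - _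
    convert this using 1
    rw [map_mul]
    ring

/-- Induction on n. If θ - 1 divides the image of a, it divides aug a, so p divides aug a: otherwise
θ - 1 would divide two coprime integers and be a unit. Then a is τ times something plus a multiple
of the norm, and one factor θ - 1 cancels. -/
theorem ev_tau_pow_dvd_iff (hinj : Function.Injective (algebraMap ℤ_[p] K)) (n : ℕ)
    (a : CycRing p) :
    ev hθ (tau p) ^ n ∣ ev hθ a ↔ a ∈ Ideal.span {tau p ^ n, nrm p} := by
  constructor
  · intro h
    induction n generalizing a with
    | zero =>
      have h1 : (1 : CycRing p) ∈ Ideal.span {tau p ^ 0, nrm p} := by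
        rw [pow_zero]
        exact Ideal.subset_span (Set.mem_insert _ _)
      simpa using Ideal.mul_mem_left _ a h1
    | succ n ih =>
      obtain ⟨b, hb⟩ := tau_dvd_sub_aug a
      have h1 : ev hθ (tau p) ∣ ((aug a : ℤ) : Zpθ p θ) := by
        have h2 : ev hθ a = ev hθ (tau p) * ev hθ b + ((aug a : ℤ) : Zpθ p θ) := by
          rw [← map_mul, ← hb, map_sub, map_zsmul, map_one, zsmul_eq_mul, mul_one, sub_add_cancel]
        rw [← dvd_add_right (Dvd.intro (ev hθ b) rfl), ← h2]
        exact (dvd_pow_self _ (Nat.succ_ne_zero n)).trans h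
      have h3 : (p : ℤ) ∣ aug a := by
        by_contra hdvd
        have hcop : IsCoprime (p : ℤ) (aug a) :=
          ((Nat.prime_iff_prime_int.1 (Fact.out : p.Prime)).coprime_iff_not_dvd).2 hdvd
        obtain ⟨u, v, huv⟩ := hcop
        refine not_isUnit_ev_tau hθ hinj (isUnit_of_dvd_one ?_)
        have : (1 : Zpθ p θ) = (u : Zpθ p θ) * ((p : ℕ) : Zpθ p θ) +
            (v : Zpθ p θ) * ((aug a : ℤ) : Zpθ p θ) := by
          have := congrArg (fun z : ℤ => (z : Zpθ p θ)) huv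
          push_cast at this
          exact this.symm
        rw [this]
        exact dvd_add (Dvd.dvd.mul_left (ev_tau_dvd_natCast hθ) _) (Dvd.dvd.mul_left h1 _)
      obtain ⟨k, hk⟩ := h3
      obtain ⟨c, hc⟩ := tau_dvd_sub_aug (nrm p)
      have h4 : a = tau p * (b - k * c) + k * nrm p := by
        rw [aug_nrm] at hc
        rw [sub_eq_iff_eq_add.1 hb, sub_eq_iff_eq_add.1 hc, hk]
        simp only [zsmul_eq_mul]
        push_cast
        ring
      have h5 : ev hθ (tau p) ^ n ∣ ev hθ (b - k * c) := by
        rw [h4, map_add, map_mul _ (k : CycRing p), ev_nrm, mul_zero, add_zero, map_mul,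
          pow_succ'] at h
        exact (mul_dvd_mul_iff_left (ev_tau_ne_zero hθ)).1 h
      obtain ⟨x, y, hxy⟩ := Ideal.mem_span_pair.1 (ih _ h5)
      rw [h4]
      refine Ideal.mem_span_pair.2 ⟨x, tau p * y + k, ?_⟩
      rw [← hxy, pow_succ]
      ring
  · intro h
    obtain ⟨x, y, rfl⟩ := Ideal.mem_span_pair.1 h
    rw [map_add, map_mul, map_mul, ev_nrm, mul_zero, add_zero, map_pow]
    exact Dvd.intro_left _ rfl

variable (p θ) in
/-- The surjection `ℤ_p[θ] → T_{-n} / T_0`. -/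
def toTQuot (n : ℕ) : Zpθ p θ →ₗ[Zpθ p θ] TQuot p θ n :=
  Submodule.mkQ _ ∘ₗ LinearMap.codRestrict (T p θ (-(n : ℤ)))
    (LinearMap.toSpanSingleton (Zpθ p θ) K ((θ - 1) ^ (-(n : ℤ))))
    fun r => Submodule.smul_mem _ r (Submodule.mem_span_singleton_self _)

theorem toTQuot_surjective (n : ℕ) : Function.Surjective (toTQuot p θ n) := by
  refine (Submodule.mkQ_surjective _).comp fun x => ?_
  obtain ⟨r, hr⟩ := Submodule.mem_span_singleton.1 x.2
  exact ⟨r, Subtype.ext hr⟩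

theorem toTQuot_eq_zero_iff (n : ℕ) (r : Zpθ p θ) :
    toTQuot p θ n r = 0 ↔ ev hθ (tau p) ^ n ∣ r := by
  have hne : θ - 1 ≠ 0 := sub_ne_zero.2 (hθ.ne_one (Fact.out : p.Prime).one_lt)
  have hcoe : ((ev hθ (tau p) ^ n : Zpθ p θ) : K) = (θ - 1) ^ n := by
    rw [ev_tau]
    rfl
  have h1 : toTQuot p θ n r = 0 ↔ (r : K) * (θ - 1) ^ (-(n : ℤ)) ∈ T p θ 0 := by
    rw [toTQuot, LinearMap.comp_apply, Submodule.mkQ_apply, Submodule.Quotient.mk_eq_zero]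
    rfl
  rw [h1, T, Submodule.mem_span_singleton]
  constructor
  · rintro ⟨s, hs⟩
    refine ⟨s, Subtype.ext ?_⟩
    have hs' : (s : K) * (θ - 1) ^ (0 : ℤ) = (r : K) * (θ - 1) ^ (-(n : ℤ)) := hs
    rw [zpow_zero, mul_one, zpow_neg, zpow_natCast] at hs'
    rw [MulMemClass.coe_mul, hcoe, hs']
    field_simp
  · rintro ⟨s, rfl⟩
    refine ⟨s, ?_⟩
    change (s : K) * (θ - 1) ^ (0 : ℤ) = _
    rw [MulMemClass.coe_mul, hcoe, zpow_zero, mul_one, zpow_neg, zpow_natCast]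
    field_simp

/-- The surjection `ℤ[ℤ/p] → T_{-n} / T_0`. -/
def kappa (n : ℕ) : CycRing p →+ TQuot p θ n :=
  (toTQuot p θ n).toAddMonoidHom.comp (ev hθ).toAddMonoidHom

theorem kappa_apply (n : ℕ) (a : CycRing p) : kappa hθ n a = toTQuot p θ n (ev hθ a) := rfl

theorem kappa_surjective (n : ℕ) : Function.Surjective (kappa hθ n) := by
  intro x
  obtain ⟨r, rfl⟩ := toTQuot_surjective n x
  obtain ⟨a, ha⟩ := exists_ev_sub_dvd hθ n r
  refine ⟨a, ?_⟩
  rw [← toTQuot_eq_zero_iff, map_sub, sub_eq_zero] at ha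
  exact ha.symm

theorem kappa_eq_zero_iff (hinj : Function.Injective (algebraMap ℤ_[p] K)) (n : ℕ)
    (a : CycRing p) : kappa hθ n a = 0 ↔ a ∈ Ideal.span {tau p ^ n, nrm p} := by
  rw [kappa_apply, toTQuot_eq_zero_iff hθ, ev_tau_pow_dvd_iff hθ hinj]

/-- The exponent of an element of `⟨θ⟩`. -/
def thetaLog : Additive (thetaGroup hθ) ≃+ ZMod p :=
  (isPrimitiveRoot_thetaUnit hθ).zmodEquivZPowers.symm

theorem kappa_gen_mul (n : ℕ) (h : thetaGroup hθ) (a : CycRing p) :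
    kappa hθ n (gen (thetaLog hθ (Additive.ofMul h)) * a) =
      ((h : (Zpθ p θ)ˣ) : Zpθ p θ) • kappa hθ n a := by
  set t := thetaLog hθ (Additive.ofMul h) with ht
  have h1 : (h : (Zpθ p θ)ˣ) = thetaUnit hθ ^ t.val := by
    have h2 : Additive.ofMul h = (isPrimitiveRoot_thetaUnit hθ).zmodEquivZPowers t :=
      ((isPrimitiveRoot_thetaUnit hθ).zmodEquivZPowers.apply_symm_apply _).symm
    rw [← ZMod.natCast_zmod_val t, IsPrimitiveRoot.zmodEquivZPowers_apply_coe_nat] at h2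
    exact congrArg Subtype.val (Additive.ofMul.injective h2)
  rw [kappa_apply, map_mul, ev_gen, ← smul_eq_mul, map_smul, ← kappa_apply,
    ← Units.val_pow_eq_pow_val, ← h1]

theorem finite_TQuot (hθ : IsPrimitiveRoot θ p) (n : ℕ) :
    Finite (TQuot p θ n) := by
  have hfg : Module.Finite ℤ (TQuot p θ n) :=
    Module.Finite.of_surjective (kappa hθ n).toIntLinearMap (kappa_surjective hθ n)
  refine Module.finite_of_fg_torsion _ ?_
  intro x
  obtain ⟨a, rfl⟩ := kappa_surjective hθ n x
  have hp0 : ((p ^ n : ℕ) : ℤ) ≠ 0 := by exact_mod_cast pow_ne_zero n (Fact.out : p.Prime).ne_zero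
  refine ⟨⟨((p ^ n : ℕ) : ℤ), mem_nonZeroDivisors_of_ne_zero hp0⟩, ?_⟩
  change ((p ^ n : ℕ) : ℤ) • kappa hθ n a = 0
  rw [← map_zsmul, kappa_apply, toTQuot_eq_zero_iff hθ, map_zsmul, zsmul_eq_mul]
  push_cast
  exact Dvd.dvd.mul_right (pow_dvd_pow_of_dvd (ev_tau_dvd_natCast hθ) n) _

theorem finite_G (n : ℕ) : Finite (G hθ n) := by
  have h1 : Finite (Multiplicative (TQuot p θ n)) := finite_TQuot hθ n
  have h2 : Finite (thetaGroup hθ) :=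
    Finite.of_injective (fun h => thetaLog hθ (Additive.ofMul h))
      ((thetaLog hθ).injective.comp Additive.ofMul.injective)
  exact Finite.of_injective (fun g : G hθ n => (g.left, g.right)) fun g h hgh =>
    SemidirectProduct.ext (congrArg Prod.fst hgh) (congrArg Prod.snd hgh)

/-- The group `T_{-n} / T_0 ⋊ ⟨θ⟩` as a group of affine transformations. -/
theorem nonempty_affineModel (hinj : Function.Injective (algebraMap ℤ_[p] K)) {n : ℕ}
    {f : CycRing p}
    (hf : ∀ a, (∃ w, tau p * a = f * w) ↔ a ∈ Ideal.span {tau p ^ n, nrm p}) :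
    Nonempty (AffineModel f (G hθ n)) := by
  -- Multiplication by τ has the same kernel as `kappa`, so it induces an equivariant embedding of
  -- T_{-n}/T_0 into the quotient by f.
  let μ : CycRing p →+ CycQuot f := (quo f).comp (AddMonoidHom.mulLeft (tau p))
  have hμ : ∀ a, μ a = 0 ↔ kappa hθ n a = 0 := fun a => by
    rw [kappa_eq_zero_iff hθ hinj, ← hf]
    exact quo_eq_zero_iff
  have hker : (kappa hθ n).ker ≤ μ.ker := fun a ha => (hμ a).2 ha
  let ψ : TQuot p θ n →+ CycQuot f :=
    (kappa hθ n).liftOfSurjective (kappa_surjective hθ n) ⟨μ, hker⟩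
  have hψ : ∀ a, ψ (kappa hθ n a) = μ a := fun a =>
    (kappa hθ n).liftOfRightInverse_comp_apply _ _ ⟨μ, hker⟩ a
  have hψinj : Function.Injective ψ := by
    rw [injective_iff_map_eq_zero]
    intro x hx
    obtain ⟨a, rfl⟩ := kappa_surjective hθ n x
    rw [hψ] at hx
    exact (hμ a).1 hx
  have hψs : ∀ (h : thetaGroup hθ) x,
      ψ (((h : (Zpθ p θ)ˣ) : Zpθ p θ) • x) = quo f (gen (thetaLog hθ (Additive.ofMul h))) * ψ x := fun h x => by
    obtain ⟨a, rfl⟩ := kappa_surjective hθ n x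
    rw [← kappa_gen_mul, hψ, hψ]
    change quo f (tau p * (_ * a)) = _ * quo f (tau p * a)
    rw [← quo_mul]
    congr 1
    ring
  refine ⟨{
    s := fun g => thetaLog hθ (Additive.ofMul g.right)
    a := fun g => ψ g.left.toAdd
    s_mul := fun g h => map_add (thetaLog hθ) (Additive.ofMul g.right) (Additive.ofMul h.right)
    a_mul := fun g h => ?_
    injective := fun g h hs ha => SemidirectProduct.ext
      (Multiplicative.toAdd.injective (hψinj ha))
      (Additive.ofMul.injective ((thetaLog hθ).injective hs))
    augQ_a := fun g => ?_
    surjective := fun t b hb => ?_ }⟩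
  · rw [← hψs, ← map_add]
    rfl
  · obtain ⟨a, ha⟩ := kappa_surjective hθ n g.left.toAdd
    rw [← ha, hψ]
    change augQ f (quo f (tau p * a)) = 0
    rw [augQ_quo, map_mul, aug_tau, zero_mul, Int.cast_zero]
  · obtain ⟨b, rfl⟩ := quo_surjective f b
    rw [augQ_quo, ZMod.intCast_zmod_eq_zero_iff_dvd, Int.natAbs_dvd] at hb
    obtain ⟨k, hk⟩ := hb
    -- A class of augmentation zero modulo aug f is adjusted by a multiple of f to have augmentation
    -- exactly zero; it is then divisible by τ.
    obtain ⟨a, ha⟩ := tau_dvd_of_aug_eq_zero (a := b - f * ((k : ℤ) : CycRing p)) (by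
      rw [map_sub, map_mul, map_intCast, hk, Int.cast_id, sub_self])
    refine ⟨⟨Multiplicative.ofAdd (kappa hθ n a), ((thetaLog hθ).symm t).toMul⟩, ?_, ?_⟩
    · exact (thetaLog hθ).apply_symm_apply t
    · change ψ (kappa hθ n a) = quo f b
      rw [hψ]
      change quo f (tau p * a) = quo f b
      rw [← ha, map_sub, quo_eq_zero_iff.2 ⟨_, rfl⟩, sub_zero]

/-- The target no longer involves n: the relation affects the reduced complex only through q =
p^(s+1) ≥ p, and q may be lowered to p. -/
theorem nonempty_H_equiv_red (hinj : Function.Injective (algebraMap ℤ_[p] K)) {n : ℕ}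
    (hn : p - 1 ≤ n) (k : ℕ) :
    Nonempty (H p (G hθ n) k ≃ₗ[ZMod p] Coh (fun n : ℕ => redGrade p p n) (redD p p) k) := by
  obtain ⟨f', s, haug, hnzd, hf⟩ := exists_relation hn
  obtain ⟨m⟩ := nonempty_affineModel hθ hinj hf
  have : Finite (G hθ n) := finite_G hθ n
  have := Fintype.ofFinite (G hθ n)
  obtain ⟨e⟩ := m.nonempty_equiv_red rfl haug hnzd k
  obtain ⟨e'⟩ := nonempty_red_equiv (p := p) (q := p ^ (s + 1))
    (Nat.le_self_pow (Nat.succ_ne_zero s) p) k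
  exact ⟨e.trans e'.symm⟩

end LocalField

end MaxClass

end

theorem mainTheorem2 (p : ℕ) [Fact p.Prime] {K : Type} [Field K]
    [Algebra ℤ_[p] K] [Algebra ℚ_[p] K] [IsScalarTower ℤ_[p] ℚ_[p] K]
    [IsCyclotomicExtension {p} ℚ_[p] K] (θ : K) (hθ : IsPrimitiveRoot θ p)
    (n : ℕ) (hn : p - 1 ≤ n) :
    Nonempty (∀ k : ℕ,
      MaxClass.H p (MaxClass.G hθ n) k ≃ₗ[ZMod p] MaxClass.H p (MaxClass.G hθ (p - 1)) k) := by
  have hinj : Function.Injective (algebraMap ℤ_[p] K) := by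
    rw [IsScalarTower.algebraMap_eq ℤ_[p] ℚ_[p] K]
    exact (algebraMap ℚ_[p] K).injective.comp (IsFractionRing.injective ℤ_[p] ℚ_[p])
  refine ⟨fun k => ?_⟩
  exact (MaxClass.nonempty_H_equiv_red hθ hinj hn k).some.trans
    (MaxClass.nonempty_H_equiv_red hθ hinj le_rfl k).some.symm
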